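/- **Theorem (De Giorgi conjecture on the cylinder).** Let $d\ge 1$ be an integer and $\Omega_d=\mathbb R\times\mathbb T^{d-1}$, $\mathbb T=\mathbb R/\mathbb Z$, with points $w=(x,y)$. Let $H:\mathbb R^d\to\mathbb R$, put $K(x,y)=\sum_{j\in\mathbb Z^{d-1}}H(x,y+j)$ and $$(\mathcal L u)(w)=\mathrm{P.V.}\int_{\Omega_d}(u(w)-u(w'))\,K(w-w')\,dw' .$$ For $\nu=(\xi,k)\in\mathbb R\times\mathbb Z^{d-1}$ let $\hat u(\nu)=\int_{\Omega_d}e^{-2\pi i(x\xi+y\cdot k)}u(x,y)\,dx\,dy$ (extended to $L^2(\Omega_d)$ in the usual way), and let $H^1(\Omega_d)=\{v\in L^2(\Omega_d): |\nu|\hat v\in L^2(\mathbb R\times\mathbb Z^{d-1})\}$. Assume: - (A) there are constants $c,C>0$ and a real function $\sigma$ with $c|\nu|\le\sigma(\nu)\le C|\nu|$ for all $\nu$ such that $\widehat{\mathcal L\varphi}(\nu)=\sigma(\nu)\hat\varphi(\nu)$ for all $\nu$ and all $\varphi\in C_c^\infty(\Omega_d)$ (where $\mathcal L\varphi$ exists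 everywhere and is integrable); - (B) $H$ is positive and continuous on $\mathbb R^d\setminus\{0\}$; - (C) $H(az)=a^{-d-1}H(z)$ for all $z\ne0$ and $a>0$; - (D) $H(z)=H(-z)$ for all $z$. Let $\gamma\in C^\infty(\mathbb R)$ satisfy $\gamma>0$ on $(-1,1)$, $\gamma(\pm1)=0$ and $\gamma''(\pm1)>0$. Let $\eta\in C^\infty(\mathbb R)$ satisfy $\eta=1$ on $[1,\infty)$ and $\eta=-1$ on $(-\infty,-1]$, regarded also as a function of $(x,y)$. Let $u:\Omega_d\to\mathbb R$ be such that $u-\eta\in H^1(\Omega_d)$, and let $u$ be a layer solution of $\mathcal Lu+\gamma'(u)=0$: for almost every $w\in\Omega_d$ the principal value $(\mathcal Lu)(w)$ exists and $(\mathcal Lu)(w)+\gamma'(u(w))=0$; and for every $(x,y)\in\Omega_d$ the derivative $\partial_xu(x,y)$ exists and is positive, and $\lim_{x\to\pm\infty}u(x,y)=\pm1$. Then $u$ depends only on $x$: there is $\phi:\mathbb R\to\mathbb R$ with $u(x,y)=\phi(x)$ for almost every $(x,y)\in\Omega_d$; and this holds for every $(x,y)\in\Omega_d$ if $u$ is continuous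 or if the equation holds at every point of $\Omega_d$. -/

import Mathlib

open MeasureTheory Filter Topology
open scoped ContDiff

noncomputable section

namespace DeGiorgi

/-- The cylinder `Ω_d = ℝ × 𝕋^(d-1)` with `𝕋 = ℝ/ℤ`, `d ≥ 1`. A point is `(x, y)`. -/
abbrev Cyl (d : ℕ) : Type := ℝ × (Fin (d - 1) → UnitAddCircle)

/-- The universal cover `ℝ^d = ℝ × ℝ^(d-1)` of the cylinder. -/
abbrev Cover (d : ℕ) : Type := ℝ × (Fin (d - 1) → ℝ)

/-- The covering projection `ℝ^d → Ω_d`. -/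
def proj {d : ℕ} (z : Cover d) : Cyl d := (z.1, fun i => (z.2 i : UnitAddCircle))

/-- The representative in `ℝ × [0,1)^(d-1)` of a point of the cylinder. -/
def rep {d : ℕ} (w : Cyl d) : Cover d :=
  (w.1, fun i => ((AddCircle.equivIco (1 : ℝ) 0 (w.2 i) : Set.Ico (0 : ℝ) (0 + 1)) : ℝ))

/-- The translate `(x, y + j)` of `(x, y)` by an integer vector `j`. -/
def shift {d : ℕ} (z : Cover d) (j : Fin (d - 1) → ℤ) : Cover d :=
  (z.1, fun i => z.2 i + (j i : ℝ))

/-- The kernel on the cylinder, `K(x, y) = ∑_{j ∈ ℤ^(d-1)} H(x, y + j)`. -/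
def periodize {d : ℕ} (H : Cover d → ℝ) (w : Cyl d) : ℝ :=
  ∑' j : Fin (d - 1) → ℤ, H (shift (rep w) j)

theorem proj_rep {d : ℕ} (w : Cyl d) : proj (rep w) = w := by
  refine Prod.ext rfl (funext fun i => ?_)
  exact AddCircle.coe_equivIco

/-- `K` does not depend on the representative. -/
theorem periodize_proj {d : ℕ} (H : Cover d → ℝ) (z : Cover d) :
    periodize H (proj z) = ∑' j : Fin (d - 1) → ℤ, H (shift z j) := by
  have h : ∀ i, ∃ m : ℤ, (rep (proj z)).2 i + (m : ℝ) = z.2 i := by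
    intro i
    have h1 := congrFun (congrArg Prod.snd (proj_rep (proj z))) i
    have h2 : ((z.2 i - (rep (proj z)).2 i : ℝ) : UnitAddCircle) = 0 := by
      rw [AddCircle.coe_sub, sub_eq_zero]
      exact h1.symm
    obtain ⟨m, hm⟩ := (AddCircle.coe_eq_zero_iff (1 : ℝ)).1 h2
    refine ⟨m, ?_⟩
    have : (m : ℝ) = z.2 i - (rep (proj z)).2 i := by simpa using hm
    linarith
  choose m hm using h
  rw [periodize, ← (Equiv.addLeft m).tsum_eq]
  refine tsum_congr fun j => congrArg H (Prod.ext rfl (funext fun i => ?_))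
  simp only [shift, Equiv.coe_addLeft, Pi.add_apply, Int.cast_add]
  rw [← hm i]
  ring

/-- The Euclidean (geodesic) distance to the origin on `Ω_d`; on the circle `‖·‖` is the
distance to the nearest integer. -/
def cylNorm {d : ℕ} (w : Cyl d) : ℝ := Real.sqrt (w.1 ^ 2 + ∑ i, ‖w.2 i‖ ^ 2)

/-- `(𝓛u)(w) = ℓ`: the principal value `P.V. ∫_{Ω_d} (u(w) - u(w')) K(w - w') dw'` exists and
equals `ℓ`. -/
def HasL {d : ℕ} (H : Cover d → ℝ) (u : Cyl d → ℝ) (w : Cyl d) (l : ℝ) : Prop :=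
  Tendsto (fun ε : ℝ => ∫ w' in {w' : Cyl d | ε < cylNorm (w - w')},
    (u w - u w') * periodize H (w - w')) (𝓝[>] 0) (𝓝 l)

/-- `|ν|` for a frequency `ν = (ξ, k) ∈ ℝ × ℤ^(d-1)`. -/
def freqNorm {d : ℕ} (ξ : ℝ) (k : Fin (d - 1) → ℤ) : ℝ :=
  Real.sqrt (ξ ^ 2 + ∑ i, (k i : ℝ) ^ 2)

/-- The character `e^{-2πi k·y}` of the torus. -/
def torusChar {d : ℕ} (k : Fin (d - 1) → ℤ) (y : Fin (d - 1) → UnitAddCircle) : ℂ :=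
  ∏ i, fourier (-(k i)) (y i)

/-- The Fourier integral `∫_{Ω_d} e^{-2πi(xξ + y·k)} f(x,y) dx dy` of an integrable function. -/
def fourierInt {d : ℕ} (f : Cyl d → ℝ) (ξ : ℝ) (k : Fin (d - 1) → ℤ) : ℂ :=
  ∫ w : Cyl d, Complex.exp (-(2 * Real.pi * Complex.I * (w.1 * ξ))) * torusChar k w.2 * (f w : ℂ)

/-- The `k`-th Fourier coefficient of `f` in the periodic variables, a function of `x`. -/
def torusCoeff {d : ℕ} (f : Cyl d → ℝ) (k : Fin (d - 1) → ℤ) (x : ℝ) : ℂ :=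
  ∫ y : Fin (d - 1) → UnitAddCircle, torusChar k y * (f (x, y) : ℂ)

/-- `f ∈ H^s(Ω_d)`: `f ∈ L²(Ω_d)` and `|ν|^s f̂ ∈ L²(ℝ × ℤ^(d-1))`. The Fourier transform of
`f ∈ L²` is the Fourier series in `y` (the coefficients `g k` lie in `L²(ℝ)`) followed by the
`L²` Fourier transform in `x`. -/
def MemH {d : ℕ} (s : ℝ) (f : Cyl d → ℝ) : Prop :=
  MemLp f 2 ∧
  ∃ g : (Fin (d - 1) → ℤ) → Lp ℂ 2 (volume : Measure ℝ),
    (∀ k, (g k : ℝ → ℂ) =ᵐ[volume] torusCoeff f k) ∧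
    ∑' k, ∫⁻ ξ : ℝ, ENNReal.ofReal (freqNorm ξ k ^ s) ^ 2 *
      ‖(FourierTransform.fourier (g k) : Lp ℂ 2 (volume : Measure ℝ)) ξ‖ₑ ^ 2 < (⊤ : ENNReal)

/-- Test functions on the cylinder: smooth with compact support. -/
def IsTest {d : ℕ} (φ : Cyl d → ℝ) : Prop :=
  ContDiff ℝ ∞ (fun z : Cover d => φ (proj z)) ∧ HasCompactSupport φ

/-- The assumptions on `𝓛` and on its kernel `H : ℝ^d → ℝ`. -/
structure KernelAssumptions (d : ℕ) (H : Cover d → ℝ) : Prop where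
  /-- (A) `𝓛` is a Fourier multiplier whose symbol is comparable with `|ν|`. -/
  symbol : ∃ (σ : ℝ → (Fin (d - 1) → ℤ) → ℝ) (c C : ℝ), 0 < c ∧ 0 < C ∧
    (∀ ξ k, c * freqNorm ξ k ≤ σ ξ k ∧ σ ξ k ≤ C * freqNorm ξ k) ∧
    ∀ φ : Cyl d → ℝ, IsTest φ → ∃ Lφ : Cyl d → ℝ, (∀ w, HasL H φ w (Lφ w)) ∧ Integrable Lφ ∧
      ∀ ξ k, fourierInt Lφ ξ k = (σ ξ k : ℂ) * fourierInt φ ξ k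
  /-- (B) positivity -/
  pos : ∀ z, z ≠ 0 → 0 < H z
  /-- (B) continuity -/
  cont : ContinuousOn H {z | z ≠ 0}
  /-- (C) homogeneity of degree `-d-1` -/
  homog : ∀ (z : Cover d) (a : ℝ), z ≠ 0 → 0 < a → H (a • z) = a ^ (-(d : ℤ) - 1) * H z
  /-- (D) symmetry -/
  symm : ∀ z, H z = H (-z)

/-- Smooth double-well type potentials. -/
structure IsDoubleWell (γ : ℝ → ℝ) : Prop where
  smooth : ContDiff ℝ ∞ γ
  pos : ∀ x, -1 < x → x < 1 → 0 < γ x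
  left : γ (-1) = 0
  right : γ 1 = 0
  left_convex : 0 < deriv (deriv γ) (-1)
  right_convex : 0 < deriv (deriv γ) 1

/-- Smooth reference profiles equal to `-1` on `(-∞,-1]` and to `1` on `[1,∞)`. -/
structure IsProfile (η : ℝ → ℝ) : Prop where
  smooth : ContDiff ℝ ∞ η
  right : ∀ x, 1 ≤ x → η x = 1
  left : ∀ x, x ≤ -1 → η x = -1

/-- The equation `𝓛u(w) + γ'(u(w)) = 0` holds at the point `w`. -/
def SolvesAt {d : ℕ} (H : Cover d → ℝ) (γ : ℝ → ℝ) (u : Cyl d → ℝ) (w : Cyl d) : Prop :=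
  ∃ l, HasL H u w l ∧ l + deriv γ (u w) = 0

/-- Layer solutions: the equation holds (almost everywhere), `∂u/∂x > 0` everywhere, and
`u(x,y) → ±1` as `x → ±∞` for every `y`. -/
structure IsLayerSolution {d : ℕ} (H : Cover d → ℝ) (γ : ℝ → ℝ) (u : Cyl d → ℝ) : Prop where
  solves : ∀ᵐ w : Cyl d, SolvesAt H γ u w
  differentiable : ∀ x y, DifferentiableAt ℝ (fun t => u (t, y)) x
  deriv_pos : ∀ x y, 0 < deriv (fun t => u (t, y)) x
  tendsto_top : ∀ y, Tendsto (fun x => u (x, y)) atTop (𝓝 1)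
  tendsto_bot : ∀ y, Tendsto (fun x => u (x, y)) atBot (𝓝 (-1))

end DeGiorgi

end

open MeasureTheory Filter Topology
open scoped ContDiff ComplexConjugate

noncomputable section

namespace DeGiorgi

/-! ### Invariant measures on the cylinder and its cover -/

/-! Formally, differentiating the equation shows that `v = ∂u/∂x > 0` and `w = ∂u/∂b`, for a
direction `b` along the torus, both solve the linearized equation `𝓛f + γ''(u) f = 0`. Hence `v 𝓛w -
w 𝓛v = 0`. Multiply by `φ = arctan (w / v)` and integrate. Exchanging the two endpoints of each jump
turns the result into half of the double integral of `(w(p) v(q) - v(p) w(q)) (φ(p) - φ(q)) K(p -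
q)`. The factor `w(p) v(q) - v(p) w(q)` is `v(p) v(q)` times the increment of `w / v`, so the
integrand is nonnegative, and since the integral is zero it vanishes. As `K > 0`, the ratio `w / v`
is a constant `c`. By periodicity `w` has mean zero on the slab `[0,1] × 𝕋^(d-1)`, while `v` is
positive there, so `c = 0`. Thus `u` is invariant under torus translations. Because arctan is
bounded, `φ` multiplies `L²` functions into `L²` and no cutoff is needed.

Since `𝓛v` and `𝓛w` need not make sense, `v` and `w` are replaced by difference quotients with step
`1/(n+1)`, and `𝓛` by its truncations to jumps longer than `ε`, which are integrals against finite
symmetric measures. Four facts make this work. The symbols of the truncations are at most `C|ν|`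
uniformly in `ε`, by homogeneity of `H` (`exists_symbol_bound`). So the truncations are bounded in
`L²` at functions with a spectral measure of finite second moment (`IsSpectral.nonlocal_bound`), and
from there at difference quotients of `u`. An `L²` bound together with convergence almost everywhere
gives weak convergence (`tendsto_integral_mul_of_tendsto_ae`), so the principal value equation can
be tested with arctan of the quotient (`wronskian_energy_le`). The discrete chain rule
(`diffQuot_comp`) leaves an error with factor `cc (1, 0) - cc b`, where both coefficients tend to
`γ''(u)`. The error vanishes because transversal quotients converge strongly in `L²` and axial ones
stay bounded. Fatou's lemma passes to the limit in the energy and gives `ae_eq_const_mul_deriv`; the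
mean-zero argument is in `ae_translate_eq`.

Translation invariance yields a common profile for almost every `y`. It extends to all `y` by
density if `u` is continuous. If the equation holds everywhere, a wrong value of `u` at one point
would make the truncated integrals there diverge, because the total jump mass is infinite
(`eq_of_solvesAt`). -/

instance isProbabilityMeasure_circle : IsProbabilityMeasure (volume : Measure UnitAddCircle) :=
  ⟨by simp⟩

instance isAddHaarMeasure_torus (n : ℕ) :
    Measure.IsAddHaarMeasure (volume : Measure (Fin n → UnitAddCircle)) :=
  inferInstanceAs (Measure.IsAddHaarMeasure
    (Measure.pi fun _ => volume : Measure (Fin n → UnitAddCircle)))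

instance isAddHaarMeasure_cyl (d : ℕ) : Measure.IsAddHaarMeasure (volume : Measure (Cyl d)) :=
  inferInstanceAs (Measure.IsAddHaarMeasure (Measure.prod volume volume))

instance isAddHaarMeasure_cover (d : ℕ) :
    Measure.IsAddHaarMeasure (volume : Measure (Cover d)) :=
  inferInstanceAs (Measure.IsAddHaarMeasure (Measure.prod volume volume))

instance regular_cyl (d : ℕ) : Measure.Regular (volume : Measure (Cyl d)) :=
  Measure.Regular.of_sigmaCompactSpace_of_isLocallyFiniteMeasure _

instance isNegInvariant_cyl (d : ℕ) : Measure.IsNegInvariant (volume : Measure (Cyl d)) :=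
  Measure.IsAddHaarMeasure.isNegInvariant_of_regular _

instance isNegInvariant_cover (d : ℕ) : Measure.IsNegInvariant (volume : Measure (Cover d)) :=
  Measure.IsAddHaarMeasure.isNegInvariant_of_regular _

/-! ### Parseval on the torus -/

theorem pi_haarAddCircle (ι : Type*) [Fintype ι] :
    (Measure.pi fun _ : ι => (AddCircle.haarAddCircle : Measure UnitAddCircle)) =
      (volume : Measure (ι → UnitAddCircle)) := by
  have : (volume : Measure UnitAddCircle) = AddCircle.haarAddCircle := by
    have := AddCircle.volume_eq_smul_haarAddCircle (T := 1)
    simpa using this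
  rw [volume_pi, this]

theorem hasSum_parseval {ι : Type*} [Fintype ι] {F G : (ι → UnitAddCircle) → ℂ}
    (hF : MemLp F 2) (hG : MemLp G 2) :
    HasSum (fun k : ι → ℤ => conj (∫ y, UnitAddTorus.mFourier (-k) y * F y) *
      ∫ y, UnitAddTorus.mFourier (-k) y * G y) (∫ y, conj (F y) * G y) := by
  -- The torus Parseval identity refers to the product of Haar measures. Quantifying over `μ` lets
  -- the equality with `volume` be eliminated by `rfl`, also inside the `MemLp` hypotheses.
  have key : ∀ μ : Measure (ι → UnitAddCircle),
      (Measure.pi fun _ : ι => (AddCircle.haarAddCircle : Measure UnitAddCircle)) = μ →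
      MemLp F 2 μ → MemLp G 2 μ →
      HasSum (fun k : ι → ℤ => conj (∫ y, UnitAddTorus.mFourier (-k) y * F y ∂μ) *
        ∫ y, UnitAddTorus.mFourier (-k) y * G y ∂μ) (∫ y, conj (F y) * G y ∂μ) := by
    rintro μ rfl hF hG
    have hc : ∀ {E : (ι → UnitAddCircle) → ℂ} (hE : MemLp E 2 (Measure.pi fun _ : ι =>
        (AddCircle.haarAddCircle : Measure UnitAddCircle))) (k : ι → ℤ),
        UnitAddTorus.mFourierCoeff (hE.toLp E) k =
          ∫ y, UnitAddTorus.mFourier (-k) y * E y ∂(Measure.pi fun _ : ι =>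
            (AddCircle.haarAddCircle : Measure UnitAddCircle)) := by
      intro E hE k
      refine integral_congr_ae (hE.coeFn_toLp.mono fun y hy => ?_)
      simp only [smul_eq_mul]
      rw [hy]
    have h := UnitAddTorus.hasSum_prod_mFourierCoeff (hF.toLp F) (hG.toLp G)
    simp only [hc] at h
    convert h using 1
    refine integral_congr_ae ?_
    filter_upwards [hF.coeFn_toLp, hG.coeFn_toLp] with y hy hy'
    rw [hy, hy']
  exact key _ (pi_haarAddCircle ι) hF hG

/-! ### Plancherel on the line, with translations -/

/-- The character `e^{2πi a ξ}`. -/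
def lineChar (a ξ : ℝ) : ℂ := Complex.exp (2 * Real.pi * Complex.I * (a * ξ))

theorem norm_lineChar (a ξ : ℝ) : ‖lineChar a ξ‖ = 1 := by
  have : lineChar a ξ = Complex.exp (((2 * Real.pi * (a * ξ) : ℝ) : ℂ) * Complex.I) := by
    rw [lineChar]; push_cast; ring_nf
  rw [this, Complex.norm_exp_ofReal_mul_I]

theorem continuous_lineChar (a : ℝ) : Continuous (lineChar a) := by
  unfold lineChar; fun_prop

theorem memLp_lineChar_mul (a : ℝ) {g : ℝ → ℂ} (hg : MemLp g 2) :
    MemLp (fun ξ => lineChar a ξ * g ξ) 2 := by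
  refine hg.of_le ((continuous_lineChar a).aestronglyMeasurable.mul hg.1) (ae_of_all _ fun ξ => ?_)
  rw [norm_mul, norm_lineChar, one_mul]

open FourierTransform in
-- Both sides are isometric in `g`, so it suffices to compare them on the dense class of Schwartz
-- functions, where the Fourier integral is explicit.
theorem fourier_translate (g : Lp ℂ 2 (volume : Measure ℝ)) (a : ℝ) :
    𝓕 (Lp.compMeasurePreserving _ (measurePreserving_add_right volume a) g) =
      (memLp_lineChar_mul a (Lp.memLp (𝓕 g))).toLp := by
  have hd : DenseRange (SchwartzMap.toLpCLM ℝ ℂ 2 (volume : Measure ℝ)) :=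
    SchwartzMap.denseRange_toLpCLM ENNReal.ofNat_ne_top
  refine hd.induction_on (p := fun g : Lp ℂ 2 (volume : Measure ℝ) =>
    𝓕 (Lp.compMeasurePreserving _ (measurePreserving_add_right volume a) g) =
      (memLp_lineChar_mul a (Lp.memLp (𝓕 g))).toLp) g ?_ ?_
  · refine isClosed_eq ?_ ?_
    · exact (Lp.fourierTransformₗᵢ ℝ ℂ).continuous.comp
        (Lp.isometry_compMeasurePreserving _).continuous
    · have : Isometry fun h : Lp ℂ 2 (volume : Measure ℝ) =>
          (memLp_lineChar_mul a (Lp.memLp h)).toLp := by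
        refine Isometry.of_dist_eq fun h h' => ?_
        rw [dist_eq_norm, dist_eq_norm, ← MemLp.toLp_sub, Lp.norm_toLp, Lp.norm_def]
        congr 1
        refine eLpNorm_congr_norm_ae ?_
        filter_upwards [Lp.coeFn_sub h h'] with ξ hξ
        rw [hξ]
        simp only [Pi.sub_apply]
        rw [← mul_sub, norm_mul, norm_lineChar, one_mul]
      exact this.continuous.comp (Lp.fourierTransformₗᵢ ℝ ℂ).continuous
  · intro f
    have h1 : Lp.compMeasurePreserving _ (measurePreserving_add_right volume a)
        (SchwartzMap.toLpCLM ℝ ℂ 2 volume f) =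
        (f.compSubConstCLM ℂ (-a)).toLp 2 := by
      apply Lp.ext
      filter_upwards [Lp.coeFn_compMeasurePreserving (SchwartzMap.toLpCLM ℝ ℂ 2 volume f)
          (measurePreserving_add_right volume a),
        (measurePreserving_add_right volume a).quasiMeasurePreserving.ae
          (SchwartzMap.coeFn_toLp f 2 volume),
        SchwartzMap.coeFn_toLp (f.compSubConstCLM ℂ (-a)) 2 volume] with x h1 h2 h3
      rw [h1, h3]
      simpa using h2
    rw [h1, SchwartzMap.toLp_fourier_eq]
    apply Lp.ext
    filter_upwards [MemLp.coeFn_toLp (memLp_lineChar_mul a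
        (Lp.memLp (𝓕 (SchwartzMap.toLpCLM ℝ ℂ 2 volume f)))),
      SchwartzMap.coeFn_toLp (𝓕 (f.compSubConstCLM ℂ (-a))) 2 volume,
      SchwartzMap.coeFn_toLp (𝓕 f) 2 volume] with x h1 h2 h3
    rw [h1, h2]
    have h4 : 𝓕 (SchwartzMap.toLpCLM ℝ ℂ 2 volume f) = (𝓕 f).toLp 2 :=
      SchwartzMap.toLp_fourier_eq f
    rw [h4, h3, SchwartzMap.fourier_coe, SchwartzMap.fourier_coe]
    have h5 : ⇑(f.compSubConstCLM ℂ (-a)) = ⇑f ∘ fun v => v + a := by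
      ext v; simp
    rw [h5]
    have := congrFun (VectorFourier.fourierIntegral_comp_add_right Real.fourierChar volume
      (innerₗ ℝ) (⇑f) a) x
    rw [Real.fourier_eq, Real.fourier_eq]
    rw [VectorFourier.fourierIntegral, VectorFourier.fourierIntegral] at this
    simp only [innerₗ_apply_apply] at this
    rw [this, Circle.smul_def, smul_eq_mul, Real.fourierChar_apply, lineChar]
    congr 2
    simp
    ring

open FourierTransform in
-- Plancherel for the pair formed by `g` and its translate.
theorem integral_translate_line (g : Lp ℂ 2 (volume : Measure ℝ)) (a : ℝ) :
    ∫ x, conj (g x) * g (x + a) = ∫ ξ, lineChar a ξ * ((‖𝓕 g ξ‖ ^ 2 : ℝ) : ℂ) := by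
  have h := Lp.inner_fourier_eq g
    (Lp.compMeasurePreserving _ (measurePreserving_add_right volume a) g)
  rw [fourier_translate, L2.inner_def, L2.inner_def] at h
  trans ∫ x, inner ℂ (g x) ((Lp.compMeasurePreserving _ (measurePreserving_add_right volume a) g) x)
  · refine integral_congr_ae ?_
    filter_upwards [Lp.coeFn_compMeasurePreserving g (measurePreserving_add_right volume a)]
      with x hx
    rw [hx, RCLike.inner_apply', Function.comp]
  rw [← h]
  refine integral_congr_ae ?_
  filter_upwards [MemLp.coeFn_toLp (memLp_lineChar_mul a (Lp.memLp (𝓕 g)))] with x hx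
  rw [hx, RCLike.inner_apply', mul_left_comm, ← Complex.normSq_eq_conj_mul_self,
    Complex.normSq_eq_norm_sq]

/-! ### The spectral measure of an `L²` function -/

/-- Frequencies, i.e. the dual group of the cylinder. -/
abbrev Freq (d : ℕ) : Type := ℝ × (Fin (d - 1) → ℤ)

/-- The character of the cylinder with frequency `ν`. -/
def chi {d : ℕ} (ν : Freq d) (a : Cyl d) : ℂ := lineChar a.1 ν.1 * UnitAddTorus.mFourier ν.2 a.2

theorem norm_mFourier_apply {ι : Type*} [Fintype ι] (k : ι → ℤ) (y : ι → UnitAddCircle) :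
    ‖UnitAddTorus.mFourier k y‖ = 1 := by
  simp [UnitAddTorus.mFourier, norm_prod, fourier_apply, Circle.norm_coe]

theorem mFourier_apply_add {ι : Type*} [Fintype ι] (k : ι → ℤ) (y z : ι → UnitAddCircle) :
    UnitAddTorus.mFourier k (y + z) = UnitAddTorus.mFourier k y * UnitAddTorus.mFourier k z := by
  simp [UnitAddTorus.mFourier, fourier_apply, AddCircle.toCircle_add, Finset.prod_mul_distrib]

theorem mFourier_apply_zero {ι : Type*} [Fintype ι] (k : ι → ℤ) :
    UnitAddTorus.mFourier k (0 : ι → UnitAddCircle) = 1 := by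
  simp [UnitAddTorus.mFourier]

theorem norm_chi {d : ℕ} (ν : Freq d) (a : Cyl d) : ‖chi ν a‖ = 1 := by
  rw [chi, norm_mul, norm_lineChar, norm_mFourier_apply, one_mul]

theorem lineChar_add (a b ξ : ℝ) : lineChar (a + b) ξ = lineChar a ξ * lineChar b ξ := by
  rw [lineChar, lineChar, lineChar, ← Complex.exp_add]
  push_cast; ring_nf

theorem chi_add {d : ℕ} (ν : Freq d) (a b : Cyl d) : chi ν (a + b) = chi ν a * chi ν b := by
  rw [chi, chi, chi, Prod.fst_add, Prod.snd_add, lineChar_add, mFourier_apply_add]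
  ring

theorem chi_zero {d : ℕ} (ν : Freq d) : chi ν (0 : Cyl d) = 1 := by
  simp [chi, lineChar, mFourier_apply_zero]

theorem chi_neg {d : ℕ} (ν : Freq d) (a : Cyl d) : chi ν (-a) = conj (chi ν a) := by
  have h : chi ν (-a) * chi ν a = 1 := by rw [← chi_add, neg_add_cancel, chi_zero]
  have h2 : conj (chi ν a) * chi ν a = 1 := by
    rw [← Complex.normSq_eq_conj_mul_self, Complex.normSq_eq_norm_sq, norm_chi]; simp
  have h3 : chi ν a ≠ 0 := by
    intro h0; rw [h0, mul_zero] at h; exact zero_ne_one h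
  exact mul_right_cancel₀ h3 (h.trans h2.symm)

theorem chi_sub {d : ℕ} (ν : Freq d) (a b : Cyl d) :
    chi ν (a - b) = chi ν a * conj (chi ν b) := by
  rw [sub_eq_add_neg, chi_add, chi_neg]

theorem measurable_mFourier (ι : Type*) [Fintype ι] :
    Measurable fun p : (ι → ℤ) × (ι → UnitAddCircle) => UnitAddTorus.mFourier p.1 p.2 :=
  measurable_from_prod_countable_right fun k => (UnitAddTorus.mFourier k).continuous.measurable

theorem measurable_chi {d : ℕ} : Measurable fun p : Freq d × Cyl d => chi p.1 p.2 := by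
  have h1 : Measurable fun p : Freq d × Cyl d => lineChar p.2.1 p.1.1 := by
    unfold lineChar
    fun_prop
  have h2 : Measurable fun p : Freq d × Cyl d => (p.1.2, p.2.2) := by fun_prop
  have h3 := (measurable_mFourier (Fin (d - 1))).comp h2
  unfold chi
  exact h1.mul h3

theorem torusChar_eq {d : ℕ} (k : Fin (d - 1) → ℤ) (y : Fin (d - 1) → UnitAddCircle) :
    torusChar (d := d) k y = UnitAddTorus.mFourier (-k) y := rfl

theorem ae_memLp_section {α β : Type*} [MeasurableSpace α] [MeasurableSpace β] {μ : Measure α}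
    {ν : Measure β} [SFinite μ] [SFinite ν] {f : α × β → ℝ} (hf : MemLp f 2 (μ.prod ν)) :
    ∀ᵐ x ∂μ, MemLp (fun y => (f (x, y) : ℂ)) 2 ν := by
  filter_upwards [hf.1.prodMk_left, hf.integrable_sq.prod_right_ae] with x h1 h2
  have : MemLp (fun y => f (x, y)) 2 ν := (memLp_two_iff_integrable_sq h1).2 h2
  exact this.ofReal

theorem torusCoeff_translate {d : ℕ} (f : Cyl d → ℝ) (a : Cyl d) (k : Fin (d - 1) → ℤ) (x : ℝ) :
    ∫ y, UnitAddTorus.mFourier (-k) y * (f ((x, y) + a) : ℂ) =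
      UnitAddTorus.mFourier k a.2 * torusCoeff f k (x + a.1) := by
  have hk : UnitAddTorus.mFourier k a.2 * UnitAddTorus.mFourier (-k) a.2 = 1 := by
    rw [UnitAddTorus.mFourier_neg, mul_comm, ← Complex.normSq_eq_conj_mul_self,
      Complex.normSq_eq_norm_sq, norm_mFourier_apply]
    simp
  rw [torusCoeff, ← integral_const_mul, ← integral_add_right_eq_self
    (fun y => UnitAddTorus.mFourier k a.2 * (torusChar (d := d) k y * (f (x + a.1, y) : ℂ))) a.2]
  refine integral_congr_ae (ae_of_all _ fun y => ?_)
  simp only [torusChar_eq, mFourier_apply_add]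
  have : ((x, y) + a : Cyl d) = (x + a.1, y + a.2) := rfl
  rw [this]
  linear_combination (-UnitAddTorus.mFourier (-k) y * (f (x + a.1, y + a.2) : ℂ)) * hk

/-- Parseval on the fibre over `x`, valid for almost every `x` because almost every slice of an `L²`
function is in `L²`. -/
theorem hasSum_torusCoeff {d : ℕ} {f : Cyl d → ℝ} (hf : MemLp f 2) (a : Cyl d) :
    ∀ᵐ x : ℝ, HasSum (fun k => UnitAddTorus.mFourier k a.2 *
      (conj (torusCoeff f k x) * torusCoeff f k (x + a.1)))
      (∫ y, ((f ((x, y) + a) * f (x, y) : ℝ) : ℂ)) := by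
  have hfa : MemLp (fun w => f (w + a)) 2 :=
    hf.comp_measurePreserving (measurePreserving_add_right volume a)
  filter_upwards [ae_memLp_section hf, ae_memLp_section hfa] with x h1 h2
  convert hasSum_parseval h1 h2 using 1
  · ext k
    rw [torusCoeff_translate, torusCoeff]
    simp only [torusChar_eq]
    ring
  · refine integral_congr_ae (ae_of_all _ fun y => ?_)
    simp only [Complex.conj_ofReal]
    push_cast; ring

theorem summable_norm_torusCoeff {d : ℕ} {f : Cyl d → ℝ} (hf : MemLp f 2)
    {g : (Fin (d - 1) → ℤ) → Lp ℂ 2 (volume : Measure ℝ)}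
    (hg : ∀ k, (g k : ℝ → ℂ) =ᵐ[volume] torusCoeff f k) :
    ∑' k, ∫⁻ x, ‖g k x‖ₑ ^ 2 < ⊤ := by
  have h1 : ∀ᵐ x : ℝ, ∑' k, ‖g k x‖ₑ ^ 2 = ENNReal.ofReal (∫ y, f (x, y) ^ 2) := by
    filter_upwards [hasSum_torusCoeff hf 0, ae_all_iff.2 hg] with x hx hx'
    have h2 : HasSum (fun k => ‖g k x‖ ^ 2) (∫ y, f (x, y) ^ 2) := by
      rw [← Complex.hasSum_ofReal]
      convert hx using 1
      · ext k
        rw [hx' k]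
        simp [mFourier_apply_zero, ← Complex.normSq_eq_conj_mul_self, Complex.normSq_eq_norm_sq]
      · rw [← integral_complex_ofReal]
        simp [sq]
    rw [← h2.tsum_eq, ENNReal.ofReal_tsum_of_nonneg (fun k => by positivity) h2.summable]
    congr 1; ext k
    rw [ENNReal.ofReal_pow (norm_nonneg _), ofReal_norm]
  rw [← lintegral_tsum fun k => ((Lp.aestronglyMeasurable (g k)).enorm.pow_const 2),
    lintegral_congr_ae h1]
  have h3 : Integrable fun x : ℝ => ∫ y, f (x, y) ^ 2 := hf.integrable_sq.integral_prod_left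
  refine lt_of_le_of_lt (lintegral_mono fun x => ?_) h3.2
  exact Real.ofReal_le_enorm _

/-- The spectral measure `|f̂|² dν`, from the Fourier coefficients of `f` in the torus. -/
def spectralMeasure {d : ℕ} (g : (Fin (d - 1) → ℤ) → Lp ℂ 2 (volume : Measure ℝ)) :
    Measure (Freq d) :=
  Measure.sum fun k => Measure.map (fun ξ => (ξ, k))
    (volume.withDensity fun ξ =>
      ‖(FourierTransform.fourier (g k) : Lp ℂ 2 (volume : Measure ℝ)) ξ‖ₑ ^ 2)

theorem measurable_freq_mk {d : ℕ} (k : Fin (d - 1) → ℤ) :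
    Measurable fun ξ : ℝ => ((ξ, k) : Freq d) := measurable_id.prodMk measurable_const

theorem lintegral_spectralMeasure {d : ℕ} (g : (Fin (d - 1) → ℤ) → Lp ℂ 2 (volume : Measure ℝ))
    {F : Freq d → ENNReal} (hF : Measurable F) :
    ∫⁻ ν, F ν ∂spectralMeasure g = ∑' k, ∫⁻ ξ, F (ξ, k) *
      ‖(FourierTransform.fourier (g k) : Lp ℂ 2 (volume : Measure ℝ)) ξ‖ₑ ^ 2 := by
  rw [spectralMeasure, lintegral_sum_measure]
  congr 1; ext k
  rw [lintegral_map hF (measurable_freq_mk k), lintegral_withDensity_eq_lintegral_mul₀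
    ((Lp.aestronglyMeasurable _).enorm.pow_const 2) (g := fun ξ => F (ξ, k))
    (hF.comp (measurable_freq_mk k)).aemeasurable]
  refine lintegral_congr fun ξ => ?_
  simp [mul_comm]

theorem lintegral_enorm_sq_fourier (g : Lp ℂ 2 (volume : Measure ℝ)) :
    ∫⁻ ξ, ‖(FourierTransform.fourier g : Lp ℂ 2 (volume : Measure ℝ)) ξ‖ₑ ^ 2 =
      ∫⁻ x, ‖g x‖ₑ ^ 2 := by
  have h : ∀ h : Lp ℂ 2 (volume : Measure ℝ),
      ∫⁻ ξ, ‖h ξ‖ₑ ^ 2 = ENNReal.ofReal (‖h‖ ^ 2) := by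
    intro h
    rw [Lp.norm_def, ← ENNReal.toReal_pow, ENNReal.ofReal_toReal
      (ENNReal.pow_ne_top (Lp.eLpNorm_ne_top h)),
      eLpNorm_eq_lintegral_rpow_enorm_toReal (by norm_num) (by norm_num),
      ← ENNReal.rpow_natCast, ← ENNReal.rpow_mul]
    norm_num
  rw [h, h, Lp.norm_fourier_eq]

/-- `f ∈ H¹` has a finite spectral measure with finite second moment, whose cosine transform is
the autocorrelation of `f`. -/
theorem MemH.exists_spectral {d : ℕ} {f : Cyl d → ℝ} (hf : MemH 1 f) :
    ∃ m : Measure (Freq d), IsFiniteMeasure m ∧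
      ∫⁻ ν, ENNReal.ofReal (freqNorm ν.1 ν.2) ^ 2 ∂m < ⊤ ∧
      ∀ a : Cyl d, ∫ w, f (w + a) * f w = ∫ ν, (chi ν a).re ∂m := by
  obtain ⟨h2, g, hg, hs⟩ := hf
  have hsum := summable_norm_torusCoeff h2 hg
  have hfin : IsFiniteMeasure (spectralMeasure g) := by
    refine ⟨?_⟩
    rw [← lintegral_one, lintegral_spectralMeasure g measurable_const]
    simpa only [one_mul, lintegral_enorm_sq_fourier] using hsum
  refine ⟨spectralMeasure g, hfin, ?_, fun a => ?_⟩
  · rw [lintegral_spectralMeasure]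
    · simpa only [Real.rpow_one] using hs
    · unfold freqNorm
      have : Measurable fun ν : Freq d => ν.1 ^ 2 + ∑ i, (ν.2 i : ℝ) ^ 2 := by
        refine (measurable_fst.pow_const 2).add (Finset.measurable_sum _ fun i _ => ?_)
        exact ((measurable_from_top (f := fun n : ℤ => (n : ℝ))).comp
          ((measurable_pi_apply i).comp measurable_snd)).pow_const 2
      exact (this.sqrt.ennreal_ofReal).pow_const 2
  have hint : Integrable (fun ν => chi ν a) (spectralMeasure g) := by
    refine Integrable.of_bound
      (measurable_chi.comp (measurable_id.prodMk measurable_const)).aestronglyMeasurable 1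
      (ae_of_all _ fun ν => (norm_chi ν a).le)
  have hfa : MemLp (fun w => f (w + a)) 2 :=
    h2.comp_measurePreserving (measurePreserving_add_right volume a)
  have hmain : ((∫ w, f (w + a) * f w : ℝ) : ℂ) = ∫ ν, chi ν a ∂spectralMeasure g := by
    rw [← integral_complex_ofReal]
    have hi : Integrable fun w => ((f (w + a) * f w : ℝ) : ℂ) := (hfa.integrable_mul h2).ofReal
    have e1 : ∫ w, ((f (w + a) * f w : ℝ) : ℂ) =
        ∫ x : ℝ, ∫ y : Fin (d - 1) → UnitAddCircle, ((f ((x, y) + a) * f (x, y) : ℝ) : ℂ) :=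
      integral_prod _ hi
    have e2 : ∀ᵐ x : ℝ, ∫ y : Fin (d - 1) → UnitAddCircle, ((f ((x, y) + a) * f (x, y) : ℝ) : ℂ)
        = ∑' k, UnitAddTorus.mFourier k a.2 * (conj (g k x) * g k (x + a.1)) := by
      filter_upwards [hasSum_torusCoeff h2 a, ae_all_iff.2 hg, ae_all_iff.2 fun k =>
        (measurePreserving_add_right volume a.1).quasiMeasurePreserving.ae (hg k)] with x h1 h3 h4
      rw [← h1.tsum_eq]
      congr 1; ext k
      rw [h3 k, h4 k]
    rw [e1, integral_congr_ae e2, integral_tsum]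
    · have hint' := hint
      rw [spectralMeasure] at hint' ⊢
      rw [integral_sum_measure hint']
      congr 1; ext k
      rw [integral_const_mul, integral_translate_line, integral_map,
        integral_withDensity_eq_integral_toReal_smul₀, ← integral_const_mul]
      · refine integral_congr_ae (ae_of_all _ fun ξ => ?_)
        simp only [chi, ENNReal.toReal_pow, toReal_enorm, Complex.real_smul]
        push_cast; ring
      · exact (Lp.aestronglyMeasurable _).enorm.pow_const 2
      · exact ae_of_all _ fun ξ => by simp
      · exact (measurable_freq_mk k).aemeasurable
      · exact (measurable_chi.comp (measurable_id.prodMk measurable_const)).aestronglyMeasurable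
    · intro k
      exact ((Lp.aestronglyMeasurable (g k)).star.mul
        ((Lp.aestronglyMeasurable (g k)).comp_measurePreserving
          (measurePreserving_add_right volume a.1))).const_mul _
    -- Absolute convergence, which allows the sum over `k` to leave the integral, from `|a b| ≤ |a|²
    -- + |b|²`.
    · refine ne_of_lt ?_
      calc ∑' k, ∫⁻ x, ‖UnitAddTorus.mFourier k a.2 * (conj (g k x) * g k (x + a.1))‖ₑ
          ≤ ∑' k, ((∫⁻ x, ‖g k x‖ₑ ^ 2) + ∫⁻ x, ‖g k (x + a.1)‖ₑ ^ 2) := by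
            refine ENNReal.tsum_le_tsum fun k => ?_
            rw [← lintegral_add_left' ((Lp.aestronglyMeasurable (g k)).enorm.pow_const 2)]
            refine lintegral_mono fun x => ?_
            have h1 : ‖UnitAddTorus.mFourier k a.2‖ₑ = 1 := by
              rw [← ofReal_norm, norm_mFourier_apply, ENNReal.ofReal_one]
            rw [enorm_mul, enorm_mul, h1, one_mul, RCLike.enorm_conj]
            rcases le_total ‖g k x‖ₑ ‖g k (x + a.1)‖ₑ with h | h
            · exact (mul_le_mul_left h _).trans (by rw [← sq]; exact le_add_self)
            · exact (mul_le_mul_right h _).trans (by rw [← sq]; exact le_self_add)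
        _ = (∑' k, ∫⁻ x, ‖g k x‖ₑ ^ 2) + ∑' k, ∫⁻ x, ‖g k x‖ₑ ^ 2 := by
            rw [← ENNReal.tsum_add]
            congr 1; ext k
            rw [lintegral_add_right_eq_self (fun x => ‖g k x‖ₑ ^ 2)]
        _ < ⊤ := ENNReal.add_lt_top.2 ⟨hsum, hsum⟩
  have h3 : ∫ ν, (chi ν a).re ∂spectralMeasure g = (∫ ν, chi ν a ∂spectralMeasure g).re :=
    integral_re hint
  rw [h3, ← hmain, Complex.ofReal_re]

/-! ### The jump measure on the cover -/

/-- The measure `H(z) dz` on the universal cover. -/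
def coverJump {d : ℕ} (H : Cover d → ℝ) : Measure (Cover d) :=
  volume.withDensity fun z => ENNReal.ofReal (H z)

theorem KernelAssumptions.measurable {d : ℕ} {H : Cover d → ℝ} (hH : KernelAssumptions d H) :
    Measurable H := measurable_of_continuousOn_compl_singleton 0 hH.cont

theorem finrank_cover {d : ℕ} (hd : 1 ≤ d) : Module.finrank ℝ (Cover d) = d := by
  rw [Module.finrank_prod, Module.finrank_self, Module.finrank_fin_fun]
  omega

theorem ae_ne_zero_cover (d : ℕ) : ∀ᵐ z : Cover d, z ≠ 0 := by
  have : Set.Countable ({0} : Set (Cover d)) := Set.countable_singleton 0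
  have h := this.ae_notMem (volume : Measure (Cover d))
  simpa using h

theorem lintegral_coverJump {d : ℕ} {H : Cover d → ℝ} (hH : KernelAssumptions d H)
    {F : Cover d → ENNReal} (hF : Measurable F) :
    ∫⁻ z, F z ∂coverJump H = ∫⁻ z, F z * ENNReal.ofReal (H z) := by
  rw [coverJump, lintegral_withDensity_eq_lintegral_mul _ hH.measurable.ennreal_ofReal hF]
  simp [mul_comm]

/-- The Jacobian contributes `a^(-d)` and homogeneity `a^(d+1)`, leaving one factor `a`. This
order-one scaling makes the truncated symbols grow at most linearly in `|ν|`. -/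
theorem lintegral_coverJump_smul {d : ℕ} (hd : 1 ≤ d) {H : Cover d → ℝ}
    (hH : KernelAssumptions d H) {F : Cover d → ENNReal} (hF : Measurable F) {a : ℝ}
    (ha : 0 < a) :
    ∫⁻ z, F (a • z) ∂coverJump H = ENNReal.ofReal a * ∫⁻ z, F z ∂coverJump H := by
  rw [lintegral_coverJump hH hF,
    lintegral_coverJump hH (F := fun z => F (a • z)) (hF.comp (measurable_const_smul a))]
  have hG : Measurable fun z => F z * ENNReal.ofReal (H (a⁻¹ • z)) :=
    hF.mul (hH.measurable.comp (measurable_const_smul a⁻¹)).ennreal_ofReal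
  have h1 : ∫⁻ z, F (a • z) * ENNReal.ofReal (H z) =
      ∫⁻ z, F z * ENNReal.ofReal (H (a⁻¹ • z)) ∂(volume.map (a • ·)) := by
    rw [lintegral_map hG (measurable_const_smul a)]
    simp [smul_smul, ha.ne']
  rw [h1, Measure.map_addHaar_smul _ ha.ne', lintegral_smul_measure, finrank_cover hd, smul_eq_mul]
  have h2 : ∫⁻ z, F z * ENNReal.ofReal (H (a⁻¹ • z)) =
      ENNReal.ofReal (a ^ (d + 1)) * ∫⁻ z, F z * ENNReal.ofReal (H z) := by
    rw [← lintegral_const_mul (f := fun z => F z * ENNReal.ofReal (H z)) _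
      (hF.mul hH.measurable.ennreal_ofReal)]
    refine lintegral_congr_ae ((ae_ne_zero_cover d).mono fun z hz => ?_)
    have h3 := hH.homog z a⁻¹ hz (inv_pos.2 ha)
    have h4 : a⁻¹ ^ (-(d : ℤ) - 1) = a ^ (d + 1) := by
      rw [inv_zpow', ← zpow_natCast]; congr 1; push_cast; ring
    simp only
    rw [h3, h4, ENNReal.ofReal_mul (by positivity)]
    ring
  rw [h2, ← mul_assoc, ← ENNReal.ofReal_mul (abs_nonneg _)]
  congr 2
  rw [abs_of_pos (by positivity), pow_succ]
  field_simp

/-- Compactness of the unit sphere bounds `H` there; homogeneity does the rest. -/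
theorem KernelAssumptions.exists_upper_bound {d : ℕ} {H : Cover d → ℝ}
    (hH : KernelAssumptions d H) :
    ∃ C, 0 < C ∧ ∀ z, z ≠ 0 → H z ≤ C * ‖z‖ ^ (-(d : ℤ) - 1) := by
  have hc : ContinuousOn H (Metric.sphere 0 1) :=
    hH.cont.mono fun z hz => ne_zero_of_mem_unit_sphere ⟨z, hz⟩
  obtain ⟨C, hC⟩ := (isCompact_sphere (0 : Cover d) 1).bddAbove_image hc
  refine ⟨max C 1, by positivity, fun z hz => ?_⟩
  have hz' : 0 < ‖z‖ := norm_pos_iff.2 hz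
  have h1 : H (‖z‖⁻¹ • z) ≤ max C 1 := by
    refine (hC ⟨_, ?_, rfl⟩).trans (le_max_left _ _)
    rw [mem_sphere_zero_iff_norm, norm_smul, norm_inv, norm_norm, inv_mul_cancel₀ hz'.ne']
  have h2 := hH.homog (‖z‖⁻¹ • z) ‖z‖ (smul_ne_zero (inv_ne_zero hz'.ne') hz) hz'
  rw [smul_smul, mul_inv_cancel₀ hz'.ne', one_smul] at h2
  rw [h2, mul_comm]
  gcongr

/-- The Lévy condition. In polar coordinates the radial integrand is a multiple of `min (r⁻²) 1`,
integrable at both ends. -/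
theorem lintegral_coverJump_min_lt_top {d : ℕ} (hd : 1 ≤ d) {H : Cover d → ℝ}
    (hH : KernelAssumptions d H) :
    ∫⁻ z, ENNReal.ofReal (min 1 (‖z‖ ^ 2)) ∂coverJump H < ⊤ := by
  obtain ⟨C, hC, hCb⟩ := hH.exists_upper_bound
  rw [lintegral_coverJump hH (by fun_prop)]
  have : Nontrivial (Cover d) := inferInstanceAs (Nontrivial (ℝ × _))
  have hint : Integrable (fun z : Cover d =>
      (fun r : ℝ => min 1 (r ^ 2) * (C * r ^ (-(d : ℤ) - 1))) ‖z‖) := by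
    refine (integrable_fun_norm_addHaar (volume : Measure (Cover d))
      (f := fun r : ℝ => min 1 (r ^ 2) * (C * r ^ (-(d : ℤ) - 1)))).2 ?_
    rw [finrank_cover hd]
    have h1 : ∀ y ∈ Set.Ioi (0 : ℝ), C * min (y ^ (-2 : ℝ)) 1 =
        y ^ (d - 1) • (min 1 (y ^ 2) * (C * y ^ (-(d : ℤ) - 1))) := by
      intro y hy
      have hy : 0 < y := hy
      have e1 : y ^ (d - 1) * y ^ (-(d : ℤ) - 1) = y ^ (-2 : ℝ) := by
        rw [← zpow_natCast, ← zpow_add₀ hy.ne', ← Real.rpow_intCast]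
        congr 1; push_cast [Nat.cast_sub hd]; ring
      have e2 : y ^ (-2 : ℝ) * min 1 (y ^ 2) = min (y ^ (-2 : ℝ)) 1 := by
        rw [mul_min_of_nonneg _ _ (by positivity), mul_one, ← Real.rpow_natCast,
          ← Real.rpow_add hy]
        norm_num
      rw [smul_eq_mul, ← e2, ← e1]; ring
    refine IntegrableOn.congr_fun ?_ h1 measurableSet_Ioi
    refine Integrable.const_mul ?_ C
    rw [← IntegrableOn, ← Set.Ioc_union_Ioi_eq_Ioi zero_le_one]
    have hm : Measurable fun y : ℝ => min (y ^ (-2 : ℝ)) 1 := by fun_prop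
    refine IntegrableOn.union ?_ ?_
    · refine Measure.integrableOn_of_bounded (M := 1) (by simp) hm.aestronglyMeasurable ?_
      refine (ae_restrict_mem measurableSet_Ioc).mono fun y hy => ?_
      rw [Real.norm_of_nonneg (le_min (Real.rpow_nonneg hy.1.le _) zero_le_one)]
      exact min_le_right _ _
    · refine Integrable.mono' (integrableOn_Ioi_rpow_of_lt (by norm_num : (-2 : ℝ) < -1) one_pos)
        hm.aestronglyMeasurable ?_
      refine (ae_restrict_mem measurableSet_Ioi).mono fun y hy => ?_
      have hy : (1 : ℝ) < y := hy
      rw [Real.norm_of_nonneg (le_min (Real.rpow_nonneg (by linarith) _) zero_le_one)]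
      exact min_le_left _ _
  refine lt_of_le_of_lt (lintegral_mono_ae ((ae_ne_zero_cover d).mono fun z hz => ?_)) hint.2
  rw [← ENNReal.ofReal_mul (by positivity)]
  refine le_trans (ENNReal.ofReal_le_ofReal ?_) (Real.ofReal_le_enorm _)
  exact mul_le_mul_of_nonneg_left (hCb z hz) (by positivity)

/-- Scaling by `2` shows that the total mass equals twice itself; it is not zero, so it is infinite.
-/
theorem coverJump_univ {d : ℕ} (hd : 1 ≤ d) {H : Cover d → ℝ} (hH : KernelAssumptions d H) :
    coverJump H Set.univ = ⊤ := by
  have h := lintegral_coverJump_smul hd hH (F := fun _ => 1) measurable_const two_pos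
  simp only [lintegral_one] at h
  by_contra hne
  have h0 : coverJump H Set.univ ≠ 0 := by
    intro h0
    rw [Measure.measure_univ_eq_zero, coverJump, withDensity_eq_zero_iff
      hH.measurable.ennreal_ofReal.aemeasurable] at h0
    have h1 : ∀ᵐ z : Cover d, False := by
      filter_upwards [h0, ae_ne_zero_cover d] with z hz hz'
      have := hH.pos z hz'
      simp only [Pi.zero_apply, ENNReal.ofReal_eq_zero] at hz
      linarith
    rw [eventually_false_iff_eq_bot, ae_eq_bot] at h1
    exact NeZero.ne (volume : Measure (Cover d)) h1
  have h2 := congrArg ENNReal.toReal h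
  rw [ENNReal.toReal_mul, ENNReal.toReal_ofReal (by norm_num)] at h2
  have h3 := ENNReal.toReal_pos h0 hne
  linarith

theorem map_neg_coverJump {d : ℕ} {H : Cover d → ℝ} (hH : KernelAssumptions d H) :
    (coverJump H).map Neg.neg = coverJump H := by
  refine Measure.ext_of_lintegral _ fun F hF => ?_
  rw [lintegral_map hF measurable_neg, lintegral_coverJump hH hF,
    lintegral_coverJump hH (F := fun z => F (-z)) (hF.comp measurable_neg), ← lintegral_neg_eq_self]
  refine lintegral_congr fun z => ?_
  rw [neg_neg, ← hH.symm z]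

/-! ### The jump measure on the cylinder -/

/-- The measure `K(w) dw` on the cylinder. -/
def jump {d : ℕ} (H : Cover d → ℝ) : Measure (Cyl d) := (coverJump H).map proj

/-- The measure `K(w) dw` restricted to `|w| > ε`. -/
def jumpTrunc {d : ℕ} (H : Cover d → ℝ) (ε : ℝ) : Measure (Cyl d) :=
  (jump H).restrict {w | ε < cylNorm w}

theorem continuous_proj {d : ℕ} : Continuous (proj : Cover d → Cyl d) := by
  unfold proj
  refine continuous_fst.prodMk (continuous_pi fun i => ?_)
  exact (AddCircle.continuous_mk' 1).comp ((continuous_apply i).comp continuous_snd)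

theorem continuous_cylNorm {d : ℕ} : Continuous (cylNorm : Cyl d → ℝ) := by
  unfold cylNorm
  fun_prop

theorem measurableSet_lt_cylNorm {d : ℕ} (ε : ℝ) : MeasurableSet {w : Cyl d | ε < cylNorm w} :=
  (isOpen_lt continuous_const continuous_cylNorm).measurableSet

theorem cylNorm_neg {d : ℕ} (w : Cyl d) : cylNorm (-w) = cylNorm w := by
  simp [cylNorm]

theorem cylNorm_proj_le {d : ℕ} (hd : 1 ≤ d) (z : Cover d) :
    cylNorm (proj z) ^ 2 ≤ d * ‖z‖ ^ 2 := by
  rw [cylNorm, Real.sq_sqrt (by positivity)]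
  have h1 : z.1 ^ 2 ≤ ‖z‖ ^ 2 := by
    rw [← sq_abs]
    exact pow_le_pow_left₀ (abs_nonneg _) (norm_fst_le z) 2
  have h2 : ∀ i, ‖(proj z).2 i‖ ^ 2 ≤ ‖z‖ ^ 2 := by
    intro i
    refine pow_le_pow_left₀ (norm_nonneg _) ?_ 2
    refine le_trans ?_ ((norm_le_pi_norm z.2 i).trans (norm_snd_le z))
    exact QuotientAddGroup.norm_mk_le_norm
  have h3 := Finset.sum_le_sum fun i (_ : i ∈ Finset.univ) => h2 i
  rw [Finset.sum_const, Finset.card_univ, Fintype.card_fin, nsmul_eq_mul, Nat.cast_sub hd] at h3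
  have h4 : (proj z).1 = z.1 := rfl
  rw [h4]
  push_cast at h3
  linarith

theorem cylNorm_eq_zero {d : ℕ} {w : Cyl d} : cylNorm w = 0 ↔ w = 0 := by
  constructor
  · intro h
    rw [cylNorm, Real.sqrt_eq_zero (by positivity)] at h
    have h1 : w.1 ^ 2 = 0 := le_antisymm (by
      have : 0 ≤ ∑ i, ‖w.2 i‖ ^ 2 := by positivity
      linarith) (sq_nonneg _)
    have h2 : ∑ i, ‖w.2 i‖ ^ 2 = 0 := by linarith
    rw [Finset.sum_eq_zero_iff_of_nonneg fun i _ => by positivity] at h2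
    refine Prod.ext (by simpa using h1) (funext fun i => ?_)
    simpa using h2 i (Finset.mem_univ i)
  · rintro rfl
    simp [cylNorm]

theorem cylNorm_pos {d : ℕ} {w : Cyl d} (hw : w ≠ 0) : 0 < cylNorm w :=
  lt_of_le_of_ne (Real.sqrt_nonneg _) fun h => hw (cylNorm_eq_zero.1 h.symm)

theorem isFiniteMeasure_jumpTrunc {d : ℕ} (hd : 1 ≤ d) {H : Cover d → ℝ}
    (hH : KernelAssumptions d H) {ε : ℝ} (hε : 0 < ε) : IsFiniteMeasure (jumpTrunc H ε) := by
  refine ⟨?_⟩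
  rw [jumpTrunc, Measure.restrict_apply_univ, jump, Measure.map_apply continuous_proj.measurable
    (measurableSet_lt_cylNorm ε)]
  have hd' : (0 : ℝ) < d := by exact_mod_cast hd
  -- The cover carries the sup norm, so `ε < cylNorm (proj z)` only forces `‖z‖² ≥ ε² / d`. Then `c`
  -- bounds `min 1 ‖z‖²` from below and Markov's inequality applies.
  set c : ℝ := min 1 (ε ^ 2 / d) with hc
  have hc0 : 0 < c := by positivity
  have hsub : proj ⁻¹' {w : Cyl d | ε < cylNorm w} ⊆
      {z | ENNReal.ofReal c ≤ ENNReal.ofReal (min 1 (‖z‖ ^ 2))} := by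
    intro z hz
    refine ENNReal.ofReal_le_ofReal (min_le_min_left _ ?_)
    rw [div_le_iff₀ hd', mul_comm]
    exact (pow_le_pow_left₀ hε.le (le_of_lt hz) 2).trans (cylNorm_proj_le hd z)
  refine lt_of_le_of_lt (measure_mono hsub) ?_
  refine lt_of_le_of_lt (meas_ge_le_lintegral_div (by fun_prop) (by simpa using hc0) (by simp)) ?_
  exact ENNReal.div_lt_top (lintegral_coverJump_min_lt_top hd hH).ne (by simpa using hc0)

theorem map_neg_jumpTrunc {d : ℕ} {H : Cover d → ℝ} (hH : KernelAssumptions d H) (ε : ℝ) :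
    (jumpTrunc H ε).map Neg.neg = jumpTrunc H ε := by
  have h1 : (jump H).map Neg.neg = jump H := by
    rw [jump, Measure.map_map measurable_neg continuous_proj.measurable]
    conv_rhs => rw [← map_neg_coverJump hH, Measure.map_map continuous_proj.measurable
      measurable_neg]
    congr 1
  have h2 : {w : Cyl d | ε < cylNorm w} = Neg.neg ⁻¹' {w : Cyl d | ε < cylNorm w} := by
    ext w; simp [cylNorm_neg]
  conv_rhs => rw [jumpTrunc, ← h1]
  rw [Measure.restrict_map measurable_neg (measurableSet_lt_cylNorm ε), ← h2, jumpTrunc]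

theorem jumpTrunc_mono {d : ℕ} {H : Cover d → ℝ} {ε δ : ℝ} (h : ε ≤ δ) :
    jumpTrunc H δ ≤ jumpTrunc H ε :=
  Measure.restrict_mono (fun _ hw => lt_of_le_of_lt h hw) le_rfl

/-- The infinite jump mass does not sit at the origin of the cylinder, whose preimage is Lebesgue
null. Divergence of the truncated masses is what rules out exceptional points in `eq_of_solvesAt`.
-/
theorem tendsto_jumpTrunc_univ {d : ℕ} (hd : 1 ≤ d) {H : Cover d → ℝ}
    (hH : KernelAssumptions d H) :
    Tendsto (fun n : ℕ => jumpTrunc H (1 / ((n : ℝ) + 1)) Set.univ) atTop (𝓝 ⊤) := by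
  have h1 : ⋃ n : ℕ, {w : Cyl d | 1 / ((n : ℝ) + 1) < cylNorm w} = {0}ᶜ := by
    ext w
    simp only [Set.mem_iUnion, Set.mem_ofPred_eq, Set.mem_compl_iff, Set.mem_singleton_iff]
    constructor
    · rintro ⟨n, hn⟩ rfl
      rw [cylNorm_eq_zero.2 rfl] at hn
      have : 0 < 1 / ((n : ℝ) + 1) := by positivity
      linarith
    · exact fun hw => exists_nat_one_div_lt (cylNorm_pos hw)
  have hmono : Monotone fun n : ℕ => {w : Cyl d | 1 / ((n : ℝ) + 1) < cylNorm w} := by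
    intro n m hnm w hw
    have hw : 1 / ((n : ℝ) + 1) < cylNorm w := hw
    exact lt_of_le_of_lt (Nat.one_div_le_one_div hnm) hw
  have h2 := tendsto_measure_iUnion_atTop (μ := jump H) hmono
  have h3 : jump H {0}ᶜ = ⊤ := by
    have h4 : jump H {0} = 0 := by
      rw [jump, Measure.map_apply continuous_proj.measurable (measurableSet_singleton 0)]
      refine withDensity_absolutelyContinuous _ _ ?_
      refine measure_mono_null (t := {z : Cover d | z.1 = 0}) (fun z hz => ?_) ?_
      · have := congrArg Prod.fst (show proj z = 0 from hz)
        exact this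
      · have : {z : Cover d | z.1 = 0} = {(0 : ℝ)} ×ˢ Set.univ := by ext z; simp
        rw [this, Measure.volume_eq_prod, Measure.prod_prod]
        simp
    have h5 := measure_add_measure_compl (μ := jump H) (measurableSet_singleton (0 : Cyl d))
    rw [h4, zero_add] at h5
    rw [h5, jump, Measure.map_apply continuous_proj.measurable MeasurableSet.univ,
      Set.preimage_univ, coverJump_univ hd hH]
  rw [h1, h3] at h2
  simp only [jumpTrunc, Measure.restrict_apply_univ]
  exact h2

/-! ### The symbol of the truncated operators -/

theorem chi_proj {d : ℕ} (ν : Freq d) (z : Cover d) :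
    chi ν (proj z) = Complex.exp ((2 * Real.pi * (ν.1 * z.1 + ∑ i, ν.2 i * z.2 i) : ℝ) *
      Complex.I) := by
  have h1 : UnitAddTorus.mFourier ν.2 (proj z).2 =
      ∏ i, Complex.exp (2 * Real.pi * Complex.I * ν.2 i * z.2 i) := by
    change ∏ i, (fourier (ν.2 i) ((proj z).2 i) : ℂ) = _
    refine Finset.prod_congr rfl fun i _ => ?_
    have : (proj z).2 i = ((z.2 i : ℝ) : UnitAddCircle) := rfl
    rw [this, fourier_coe_apply]
    simp
  rw [chi, h1, lineChar, ← Complex.exp_sum, ← Complex.exp_add]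
  congr 1
  push_cast
  rw [mul_add, add_mul, Finset.mul_sum, Finset.sum_mul]
  congr 1
  · simp only [proj]; ring
  · exact Finset.sum_congr rfl fun i _ => by ring

theorem abs_fst_le_freqNorm {d : ℕ} (ν : Freq d) : |ν.1| ≤ freqNorm ν.1 ν.2 := by
  rw [freqNorm, ← Real.sqrt_sq_eq_abs]
  refine Real.sqrt_le_sqrt ?_
  have : 0 ≤ ∑ i, (ν.2 i : ℝ) ^ 2 := by positivity
  linarith

theorem abs_snd_le_freqNorm {d : ℕ} (ν : Freq d) (i : Fin (d - 1)) :
    |(ν.2 i : ℝ)| ≤ freqNorm ν.1 ν.2 := by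
  rw [freqNorm, ← Real.sqrt_sq_eq_abs]
  refine Real.sqrt_le_sqrt ?_
  have := Finset.single_le_sum (f := fun i => (ν.2 i : ℝ) ^ 2) (fun i _ => sq_nonneg _)
    (Finset.mem_univ i)
  have h2 : 0 ≤ ν.1 ^ 2 := sq_nonneg _
  linarith

theorem abs_phase_le {d : ℕ} (hd : 1 ≤ d) (ν : Freq d) (z : Cover d) :
    |ν.1 * z.1 + ∑ i, ν.2 i * z.2 i| ≤ d * freqNorm ν.1 ν.2 * ‖z‖ := by
  have h0 : 0 ≤ freqNorm ν.1 ν.2 := Real.sqrt_nonneg _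
  have h1 : |ν.1 * z.1| ≤ freqNorm ν.1 ν.2 * ‖z‖ := by
    rw [abs_mul]
    exact mul_le_mul (abs_fst_le_freqNorm ν) (norm_fst_le z) (abs_nonneg _) h0
  have h2 : |∑ i, ν.2 i * z.2 i| ≤ ∑ _i : Fin (d - 1), freqNorm ν.1 ν.2 * ‖z‖ := by
    refine (Finset.abs_sum_le_sum_abs _ _).trans (Finset.sum_le_sum fun i _ => ?_)
    rw [abs_mul]
    exact mul_le_mul (abs_snd_le_freqNorm ν i) ((norm_le_pi_norm z.2 i).trans (norm_snd_le z))
      (abs_nonneg _) h0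
  rw [Finset.sum_const, Finset.card_univ, Fintype.card_fin, nsmul_eq_mul, Nat.cast_sub hd] at h2
  push_cast at h2
  have h3 := abs_add_le (ν.1 * z.1) (∑ i, ν.2 i * z.2 i)
  linarith

theorem continuous_chi {d : ℕ} (ν : Freq d) : Continuous (chi ν : Cyl d → ℂ) := by
  have h1 : Continuous fun a : Cyl d => lineChar a.1 ν.1 := by
    unfold lineChar
    fun_prop
  exact h1.mul ((UnitAddTorus.mFourier ν.2).continuous.comp continuous_snd)

theorem chi_re_le_one {d : ℕ} (ν : Freq d) (w : Cyl d) : (chi ν w).re ≤ 1 :=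
  (Complex.re_le_norm _).trans (norm_chi ν w).le

theorem one_sub_chi_proj_le {d : ℕ} (hd : 1 ≤ d) (ν : Freq d) (z : Cover d) :
    1 - (chi ν (proj z)).re ≤
      2 * min 1 ((2 * Real.pi * d * freqNorm ν.1 ν.2 * ‖z‖) ^ 2) := by
  rw [chi_proj, Complex.exp_ofReal_mul_I_re]
  set p := ν.1 * z.1 + ∑ i, ν.2 i * z.2 i with hp
  have h1 := Real.one_sub_sq_div_two_le_cos (x := 2 * Real.pi * p)
  have h2 := Real.neg_one_le_cos (2 * Real.pi * p)
  have h3 : (2 * Real.pi * p) ^ 2 ≤ (2 * Real.pi * d * freqNorm ν.1 ν.2 * ‖z‖) ^ 2 := by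
    rw [← sq_abs]
    refine pow_le_pow_left₀ (abs_nonneg _) ?_ 2
    rw [abs_mul, abs_of_pos (by positivity : 0 < 2 * Real.pi)]
    calc 2 * Real.pi * |p| ≤ 2 * Real.pi * (d * freqNorm ν.1 ν.2 * ‖z‖) :=
          mul_le_mul_of_nonneg_left (abs_phase_le hd ν z) (by positivity)
      _ = _ := by ring
  rw [mul_min_of_nonneg _ _ zero_le_two]
  refine le_min (by linarith) ?_
  nlinarith [sq_nonneg (2 * Real.pi * p)]

/-- The symbols of the truncated operators are bounded by a multiple of `|ν|`. -/
theorem exists_symbol_bound {d : ℕ} (hd : 1 ≤ d) {H : Cover d → ℝ} (hH : KernelAssumptions d H) :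
    ∃ C : ℝ, 0 ≤ C ∧ ∀ ε : ℝ, 0 < ε → ∀ ν : Freq d,
      ∫ w, (1 - (chi ν w).re) ∂jumpTrunc H ε ≤ C * freqNorm ν.1 ν.2 := by
  have hν : ∀ ν : Freq d, 0 ≤ freqNorm ν.1 ν.2 := fun ν => Real.sqrt_nonneg _
  set A := ∫⁻ z, ENNReal.ofReal (min 1 (‖z‖ ^ 2)) ∂coverJump H with hA
  have hAt : A < ⊤ := lintegral_coverJump_min_lt_top hd hH
  refine ⟨4 * Real.pi * d * A.toReal, by positivity, fun ε hε ν => ?_⟩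
  have hm' : Measurable fun w : Cyl d => 1 - (chi ν w).re :=
    (continuous_const.sub (Complex.continuous_re.comp (continuous_chi ν))).measurable
  have hm := hm'.ennreal_ofReal
  have hd' : (0 : ℝ) < d := by exact_mod_cast hd
  rw [integral_eq_lintegral_of_nonneg_ae (ae_of_all _ fun w => sub_nonneg.2 (chi_re_le_one ν w))
    hm'.aestronglyMeasurable]
  have h1 : ∫⁻ w, ENNReal.ofReal (1 - (chi ν w).re) ∂jumpTrunc H ε ≤
      ENNReal.ofReal (4 * Real.pi * d * freqNorm ν.1 ν.2) * A := by
    calc ∫⁻ w, ENNReal.ofReal (1 - (chi ν w).re) ∂jumpTrunc H ε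
        ≤ ∫⁻ w, ENNReal.ofReal (1 - (chi ν w).re) ∂jump H :=
          lintegral_mono' Measure.restrict_le_self le_rfl
      _ = ∫⁻ z, ENNReal.ofReal (1 - (chi ν (proj z)).re) ∂coverJump H := by
          rw [jump, lintegral_map hm continuous_proj.measurable]
      -- The bound `1 - cos t ≤ 2 min 1 t²` is a function of a dilate of `z`. Scaling then extracts
      -- the factor `|ν|` from a fixed integral; since dilations must be positive, `ν = 0` is
      -- treated apart.
      _ ≤ ∫⁻ z, 2 * ENNReal.ofReal (min 1 (‖(2 * Real.pi * d * freqNorm ν.1 ν.2) • z‖ ^ 2))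
            ∂coverJump H := by
          refine lintegral_mono fun z => ?_
          have h0 : 0 ≤ 2 * Real.pi * d * freqNorm ν.1 ν.2 :=
            mul_nonneg (by positivity) (hν ν)
          rw [norm_smul, Real.norm_of_nonneg h0,
            show (2 : ENNReal) = ENNReal.ofReal 2 by simp, ← ENNReal.ofReal_mul zero_le_two]
          exact ENNReal.ofReal_le_ofReal (one_sub_chi_proj_le hd ν z)
      _ = ENNReal.ofReal (4 * Real.pi * d * freqNorm ν.1 ν.2) * A := by
          rw [lintegral_const_mul _ (by fun_prop)]
          rcases (hν ν).eq_or_lt with h0 | h0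
          · rw [← h0]; simp
          · rw [lintegral_coverJump_smul hd hH
              (F := fun z => ENNReal.ofReal (min 1 (‖z‖ ^ 2))) (by fun_prop) (by positivity),
              ← mul_assoc, ← hA]
            congr 1
            rw [show (2 : ENNReal) = ENNReal.ofReal 2 by simp, ← ENNReal.ofReal_mul zero_le_two]
            congr 1; ring
  have h2 := ENNReal.toReal_mono (ENNReal.mul_ne_top ENNReal.ofReal_ne_top hAt.ne) h1
  rw [ENNReal.toReal_mul, ENNReal.toReal_ofReal
    (mul_nonneg (by positivity) (hν ν))] at h2
  linarith

/-! ### Unfolding the periodization -/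

/-- The fundamental domain `ℝ × [0,1)^(d-1)`, translated by `j`. -/
def cell {d : ℕ} (j : Fin (d - 1) → ℤ) : Set (Cover d) := {z | ∀ i, ⌊z.2 i⌋ = j i}

theorem measurableSet_cell {d : ℕ} (j : Fin (d - 1) → ℤ) :
    MeasurableSet (cell j : Set (Cover d)) := by
  have : (cell j : Set (Cover d)) = ⋂ i, {z | ⌊z.2 i⌋ = j i} := by
    ext z; simp [cell]
  rw [this]
  refine MeasurableSet.iInter fun i => ?_
  have hm : Measurable fun z : Cover d => ⌊z.2 i⌋ :=
    Int.measurable_floor.comp ((measurable_pi_apply i).comp measurable_snd)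
  exact hm (measurableSet_singleton (j i))

theorem measurePreserving_proj_cell (d : ℕ) :
    MeasurePreserving (proj : Cover d → Cyl d) (volume.restrict (cell 0)) volume := by
  have h1 : (cell 0 : Set (Cover d)) = Set.univ ×ˢ (Set.univ.pi fun _ => Set.Ico (0 : ℝ) 1) := by
    ext z
    simp [cell, Int.floor_eq_zero_iff, Set.mem_pi]
  have h2 : MeasurePreserving (fun (y : Fin (d - 1) → ℝ) i => (y i : UnitAddCircle))
      (volume.restrict (Set.univ.pi fun _ => Set.Ico (0 : ℝ) 1)) volume := by
    rw [volume_pi, Measure.restrict_pi_pi, volume_pi]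
    refine measurePreserving_pi _ _ fun i => ?_
    have := UnitAddCircle.measurePreserving_mk 0
    rw [zero_add, ← restrict_Ico_eq_restrict_Ioc] at this
    exact this
  rw [h1, Measure.volume_eq_prod, ← Measure.prod_restrict, Measure.restrict_univ,
    Measure.volume_eq_prod]
  exact (MeasurePreserving.id volume).prod h2

theorem shift_eq_add {d : ℕ} (z : Cover d) (j : Fin (d - 1) → ℤ) :
    shift z j = z + ((0, fun i => (j i : ℝ)) : Cover d) :=
  Prod.ext (add_zero _).symm rfl

theorem measurePreserving_shift {d : ℕ} (j : Fin (d - 1) → ℤ) :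
    MeasurePreserving (fun z : Cover d => shift z j) := by
  simp only [shift_eq_add]
  exact measurePreserving_add_right volume _

theorem proj_shift {d : ℕ} (z : Cover d) (j : Fin (d - 1) → ℤ) : proj (shift z j) = proj z := by
  refine Prod.ext rfl (funext fun i => ?_)
  simp only [proj, shift, AddCircle.coe_add]
  rw [add_eq_left, AddCircle.coe_eq_zero_iff]
  exact ⟨j i, by simp⟩

theorem preimage_shift_cell {d : ℕ} (j : Fin (d - 1) → ℤ) :
    (fun z : Cover d => shift z j) ⁻¹' cell j = cell 0 := by
  ext z
  simp [cell, shift]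

theorem rep_proj_of_mem_cell {d : ℕ} {z : Cover d} (hz : z ∈ cell 0) : rep (proj z) = z := by
  refine Prod.ext rfl (funext fun i => ?_)
  have h : z.2 i ∈ Set.Ico (0 : ℝ) (0 + 1) := by
    have := hz i
    simpa [Int.floor_eq_zero_iff] using this
  exact congrArg Subtype.val (AddCircle.equivIco_coe_eq (p := (1 : ℝ)) h)

theorem lintegral_eq_tsum_cell {d : ℕ} {F : Cover d → ENNReal} (hF : Measurable F) :
    ∫⁻ z, F z = ∑' j, ∫⁻ z in cell 0, F (shift z j) := by
  have h1 : ⋃ j, (cell j : Set (Cover d)) = Set.univ := by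
    ext z
    simp only [Set.mem_iUnion, Set.mem_univ, iff_true]
    exact ⟨fun i => ⌊z.2 i⌋, fun i => rfl⟩
  have hdisj : Pairwise (Function.onFun Disjoint (cell : (Fin (d - 1) → ℤ) → Set (Cover d))) := by
    intro j k hjk
    refine Set.disjoint_left.2 fun z hz hz' => hjk (funext fun i => ?_)
    rw [← hz i, ← hz' i]
  rw [← setLIntegral_univ, ← h1, lintegral_iUnion measurableSet_cell hdisj]
  congr 1; ext j
  rw [← preimage_shift_cell j,
    (measurePreserving_shift j).setLIntegral_comp_preimage (measurableSet_cell j) hF]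

/-- The kernel `K` with values in `[0, ∞]`. -/
def eperiodize {d : ℕ} (H : Cover d → ℝ) (w : Cyl d) : ENNReal :=
  ∑' j : Fin (d - 1) → ℤ, ENNReal.ofReal (H (shift (rep w) j))

theorem measurable_rep {d : ℕ} : Measurable (rep : Cyl d → Cover d) := by
  unfold rep
  refine measurable_fst.prodMk (measurable_pi_lambda _ fun i => ?_)
  have h := (AddCircle.measurableEquivIco (1 : ℝ) 0).measurable
  exact measurable_subtype_coe.comp (h.comp ((measurable_pi_apply i).comp measurable_snd))

theorem measurable_eperiodize {d : ℕ} {H : Cover d → ℝ} (hH : Measurable H) :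
    Measurable (eperiodize H) := by
  unfold eperiodize
  refine Measurable.tsum fun j => ?_
  exact (hH.comp ((measurePreserving_shift j).measurable.comp measurable_rep)).ennreal_ofReal

/-- Unfolding: the cover is cut into integer translates of the fundamental domain, and summing `H`
over the translates produces the periodized kernel. -/
theorem jump_eq_withDensity {d : ℕ} {H : Cover d → ℝ} (hH : KernelAssumptions d H) :
    jump H = volume.withDensity (eperiodize H) := by
  refine Measure.ext_of_lintegral _ fun F hF => ?_
  have hK := measurable_eperiodize hH.measurable
  rw [jump, lintegral_map hF continuous_proj.measurable,
    lintegral_coverJump hH (F := fun z => F (proj z)) (hF.comp continuous_proj.measurable),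
    lintegral_withDensity_eq_lintegral_mul _ hK hF, ← (measurePreserving_proj_cell d).lintegral_comp
      (hK.mul hF), lintegral_eq_tsum_cell (F := fun z => F (proj z) * ENNReal.ofReal (H z))
      ((hF.comp continuous_proj.measurable).mul hH.measurable.ennreal_ofReal), ← lintegral_tsum]
  · refine setLIntegral_congr_fun (measurableSet_cell 0) fun z hz => ?_
    simp only [Pi.mul_apply, proj_shift, ENNReal.tsum_mul_left, eperiodize,
      rep_proj_of_mem_cell hz]
    rw [mul_comm]
  · intro j
    have := (measurePreserving_shift (d := d) j).measurable
    exact (((hF.comp continuous_proj.measurable).mul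
      hH.measurable.ennreal_ofReal).comp this).aemeasurable

/-- No summability is needed, since a divergent series gives the default value `0` on both sides. At
`w = 0` the series contains `H 0`, whose sign is not controlled. -/
theorem periodize_eq_toReal {d : ℕ} {H : Cover d → ℝ} (hH : KernelAssumptions d H) {w : Cyl d}
    (hw : w ≠ 0) : periodize H w = (eperiodize H w).toReal := by
  rw [periodize, eperiodize, ENNReal.tsum_toReal_eq fun _ => ENNReal.ofReal_ne_top]
  refine tsum_congr fun j => ?_
  rw [ENNReal.toReal_ofReal]
  refine (hH.pos _ fun h => hw ?_).le
  rw [← proj_rep w, ← proj_shift (rep w) j, h]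
  exact Prod.ext rfl (funext fun i => by simp [proj])

theorem eperiodize_pos {d : ℕ} {H : Cover d → ℝ} (hH : KernelAssumptions d H) {w : Cyl d}
    (hw : w ≠ 0) : 0 < eperiodize H w := by
  have h : ENNReal.ofReal (H (shift (rep w) 0)) ≤ eperiodize H w := ENNReal.le_tsum 0
  refine lt_of_lt_of_le (ENNReal.ofReal_pos.2 (hH.pos _ fun h => hw ?_)) h
  rw [← proj_rep w, ← proj_shift (rep w) 0, h]
  exact Prod.ext rfl (funext fun i => by simp [proj])

theorem ae_ne_zero_cyl (d : ℕ) : ∀ᵐ w : Cyl d, w ≠ 0 := by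
  have h : (volume : Measure (Cyl d)) {0} = 0 := by
    refine measure_mono_null (t := {(0 : ℝ)} ×ˢ Set.univ) (fun z hz => ?_) ?_
    · have : z = 0 := hz
      simp [this]
    · rw [Measure.volume_eq_prod, Measure.prod_prod]
      simp
  exact compl_mem_ae_iff.2 h

theorem jumpTrunc_eq {d : ℕ} {H : Cover d → ℝ} (hH : KernelAssumptions d H) (ε : ℝ) :
    jumpTrunc H ε = (volume.restrict {w : Cyl d | ε < cylNorm w}).withDensity (eperiodize H) := by
  rw [jumpTrunc, jump_eq_withDensity hH, restrict_withDensity (measurableSet_lt_cylNorm ε)]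

theorem jumpTrunc_absolutelyContinuous {d : ℕ} {H : Cover d → ℝ} (hH : KernelAssumptions d H)
    (ε : ℝ) : jumpTrunc H ε ≪ volume := by
  rw [jumpTrunc_eq hH]
  exact (withDensity_absolutelyContinuous _ _).trans Measure.restrict_le_self.absolutelyContinuous

/-- A property that holds almost everywhere for all truncated jump measures holds almost
everywhere. -/
theorem ae_of_forall_ae_jumpTrunc {d : ℕ} {H : Cover d → ℝ} (hH : KernelAssumptions d H)
    {P : Cyl d → Prop} (h : ∀ n : ℕ, ∀ᵐ w ∂jumpTrunc H (1 / ((n : ℝ) + 1)), P w) :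
    ∀ᵐ w, P w := by
  have h1 : ∀ n : ℕ, ∀ᵐ w : Cyl d, 1 / ((n : ℝ) + 1) < cylNorm w → P w := by
    intro n
    have h2 := h n
    rw [jumpTrunc_eq hH, ae_withDensity_iff (measurable_eperiodize hH.measurable),
      ae_restrict_iff' (measurableSet_lt_cylNorm _)] at h2
    filter_upwards [h2, ae_ne_zero_cyl d] with w hw hw0 hn
    exact hw hn (eperiodize_pos hH hw0).ne'
  filter_upwards [ae_all_iff.2 h1, ae_ne_zero_cyl d] with w hw hw0
  obtain ⟨n, hn⟩ := exists_nat_one_div_lt (cylNorm_pos hw0)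
  exact hw n hn

/-- The truncated principal value as an integral against the truncated jump measure. -/
theorem setIntegral_eq_integral_jumpTrunc {d : ℕ} (hd : 1 ≤ d) {H : Cover d → ℝ}
    (hH : KernelAssumptions d H) (u : Cyl d → ℝ) (w : Cyl d) {ε : ℝ} (hε : 0 < ε) :
    ∫ w' in {w' : Cyl d | ε < cylNorm (w - w')}, (u w - u w') * periodize H (w - w') =
      ∫ z, (u w - u (w - z)) ∂jumpTrunc H ε := by
  have hfin := isFiniteMeasure_jumpTrunc hd hH hε
  have hlt : ∀ᵐ z ∂volume.restrict {w : Cyl d | ε < cylNorm w}, eperiodize H z < ⊤ := by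
    refine ae_lt_top (measurable_eperiodize hH.measurable) ?_
    rw [← setLIntegral_univ, ← withDensity_apply _ MeasurableSet.univ, ← jumpTrunc_eq hH]
    exact measure_ne_top _ _
  have hS : MeasurableSet {w' : Cyl d | ε < cylNorm (w - w')} :=
    (isOpen_lt continuous_const
      (continuous_cylNorm.comp (continuous_const.sub continuous_id))).measurableSet
  rw [jumpTrunc_eq hH, integral_withDensity_eq_integral_toReal_smul
    (measurable_eperiodize hH.measurable) hlt, ← integral_indicator hS,
    ← integral_indicator (measurableSet_lt_cylNorm ε), ← integral_sub_left_eq_self _ volume w]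
  refine integral_congr_ae (ae_of_all _ fun z => ?_)
  simp only [Set.indicator, Set.mem_ofPred_eq, sub_sub_cancel]
  split_ifs with h
  · have hz : z ≠ 0 := by
      intro h0; rw [h0, cylNorm_eq_zero.2 rfl] at h; linarith
    rw [periodize_eq_toReal hH hz, smul_eq_mul, mul_comm]
  · rfl

theorem HasL.tendsto {d : ℕ} (hd : 1 ≤ d) {H : Cover d → ℝ} (hH : KernelAssumptions d H)
    {u : Cyl d → ℝ} {w : Cyl d} {l : ℝ} (h : HasL H u w l) :
    Tendsto (fun n : ℕ => ∫ z, (u w - u (w - z)) ∂jumpTrunc H (1 / ((n : ℝ) + 1))) atTop (𝓝 l) := by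
  have h1 : Tendsto (fun n : ℕ => 1 / ((n : ℝ) + 1)) atTop (𝓝[>] 0) :=
    tendsto_nhdsWithin_iff.2 ⟨tendsto_one_div_add_atTop_nhds_zero_nat,
      Eventually.of_forall fun n => by simp only [Set.mem_Ioi]; positivity⟩
  refine (h.comp h1).congr fun n => ?_
  exact setIntegral_eq_integral_jumpTrunc hd hH u w (by positivity)

/-! ### Finite symmetric jump operators on a group -/

/-- The bounded nonlocal operator `f ↦ ∫ (f(w) - f(w - z)) dκ(z)`. -/
def nonlocal {G : Type*} [AddCommGroup G] [MeasurableSpace G] (κ : Measure G) (f : G → ℝ) (w : G) :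
    ℝ := ∫ z, (f w - f (w - z)) ∂κ

section Group

variable {G : Type*} [AddCommGroup G] [MeasurableSpace G] [MeasurableAdd₂ G] [MeasurableNeg G]

theorem measurePreserving_sub_prod_id (μ κ : Measure G) [SFinite μ] [SFinite κ]
    [μ.IsAddLeftInvariant] :
    MeasurePreserving (fun p : G × G => (p.1 - p.2, p.2)) (μ.prod κ) (μ.prod κ) := by
  have h1 : MeasurePreserving (fun p : G × G => (p.1, p.2 - p.1)) (κ.prod μ) (κ.prod μ) := by
    refine (MeasurePreserving.id κ).skew_product (g := fun z w => w - z) ?_ ?_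
    · exact measurable_snd.sub measurable_fst
    · refine ae_of_all _ fun z => ?_
      simp only [sub_eq_add_neg]
      exact (measurePreserving_add_right μ (-z)).map_eq
  exact (Measure.measurePreserving_swap.comp h1).comp Measure.measurePreserving_swap

/-- In terms of the endpoints `p.1` and `p.1 - p.2` of a jump, this map exchanges them. It is the
involution behind the symmetrization of the Wronskian. -/
theorem measurePreserving_sub_prod_neg (μ κ : Measure G) [SFinite μ] [SFinite κ]
    [μ.IsAddLeftInvariant] (hκ : κ.map Neg.neg = κ) :
    MeasurePreserving (fun p : G × G => (p.1 - p.2, -p.2)) (μ.prod κ) (μ.prod κ) := by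
  have h1 : MeasurePreserving (Neg.neg : G → G) κ κ := ⟨measurable_neg, hκ⟩
  exact ((MeasurePreserving.id μ).prod h1).comp (measurePreserving_sub_prod_id μ κ)

variable {μ κ : Measure G} [SFinite μ] [μ.IsAddLeftInvariant] [IsFiniteMeasure κ]

theorem memLp_comp_fst {α β : Type*} [MeasurableSpace α] [MeasurableSpace β] {μ : Measure α}
    {κ : Measure β} [SFinite μ] [IsFiniteMeasure κ] {f : α → ℝ} (hf : MemLp f 2 μ) :
    MemLp (fun p : α × β => f p.1) 2 (μ.prod κ) := by
  rw [memLp_two_iff_integrable_sq hf.1.comp_fst]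
  exact hf.integrable_sq.comp_fst κ

theorem memLp_comp_sub {f : G → ℝ} (hf : MemLp f 2 μ) :
    MemLp (fun p : G × G => f (p.1 - p.2)) 2 (μ.prod κ) :=
  (memLp_comp_fst hf).comp_measurePreserving (measurePreserving_sub_prod_id μ κ)

theorem memLp_comp_add {f : G → ℝ} (hκ : κ.map Neg.neg = κ) (hf : MemLp f 2 μ) :
    MemLp (fun p : G × G => f (p.1 + p.2)) 2 (μ.prod κ) := by
  have h1 : MeasurePreserving (Neg.neg : G → G) κ κ := ⟨measurable_neg, hκ⟩
  simpa [Function.comp_def] using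
    (memLp_comp_sub hf).comp_measurePreserving ((MeasurePreserving.id μ).prod h1)

theorem ae_memLp_two_section {α β : Type*} [MeasurableSpace α] [MeasurableSpace β] {μ : Measure α}
    {ν : Measure β} [SFinite μ] [SFinite ν] {f : α × β → ℝ} (hf : MemLp f 2 (μ.prod ν)) :
    ∀ᵐ x ∂μ, MemLp (fun y => f (x, y)) 2 ν := by
  filter_upwards [hf.1.prodMk_left, hf.integrable_sq.prod_right_ae] with x h1 h2
  exact (memLp_two_iff_integrable_sq h1).2 h2

theorem ae_integrable_comp_sub {f : G → ℝ} (hf : MemLp f 2 μ) :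
    ∀ᵐ w ∂μ, Integrable (fun z => f (w - z)) κ :=
  (ae_memLp_two_section (memLp_comp_sub hf)).mono fun _ h => h.integrable one_le_two

/-- Averaging over `z` and `-z` gives second differences, whose symbol `1 - cos` is real and
nonnegative. -/
theorem ae_nonlocal_eq_symm {f : G → ℝ} (hκ : κ.map Neg.neg = κ) (hf : MemLp f 2 μ) :
    ∀ᵐ w ∂μ, nonlocal κ f w = ∫ z, (f w - (1 / 2) * f (w - z) - (1 / 2) * f (w + z)) ∂κ := by
  filter_upwards [ae_integrable_comp_sub (κ := κ) hf,
    (ae_memLp_two_section (memLp_comp_add hκ hf)).mono fun _ h => h.integrable one_le_two]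
    with w h1 h2
  have h1' : Integrable (fun z => f w - f (w - z)) κ := (integrable_const _).sub h1
  have h2' : Integrable (fun z => f w - f (w + z)) κ := (integrable_const _).sub h2
  have e1 : ∫ z, (f w - f (w + z)) ∂κ = nonlocal κ f w := by
    have h3 : MeasurePreserving (Neg.neg : G → G) κ κ := ⟨measurable_neg, hκ⟩
    have := h3.integral_comp (MeasurableEquiv.neg G).measurableEmbedding
      (fun z => f w - f (w - z))
    simpa [sub_neg_eq_add, nonlocal] using this
  have e2 : nonlocal κ f w = (1 / 2) * nonlocal κ f w + (1 / 2) * ∫ z, (f w - f (w + z)) ∂κ := by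
    rw [e1]; ring
  rw [e2, nonlocal, ← integral_const_mul, ← integral_const_mul,
    ← integral_add (h1'.const_mul _) (h2'.const_mul _)]
  congr 1; ext z; ring

theorem aestronglyMeasurable_nonlocal {f : G → ℝ} (hf : MemLp f 2 μ) :
    AEStronglyMeasurable (nonlocal κ f) μ :=
  ((memLp_comp_fst hf).sub (memLp_comp_sub (κ := κ) hf)).1.integral_prod_right'

/-- Symmetrization of the Wronskian of a nonlocal operator. -/
theorem integral_mul_wronskian {v w φ : G → ℝ} (hκ : κ.map Neg.neg = κ) (hv : MemLp v 2 μ)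
    (hw : MemLp w 2 μ) (hφ : AEStronglyMeasurable φ μ) {M : ℝ} (hM : ∀ p, |φ p| ≤ M) :
    Integrable (fun p : G × G => (w p.1 * v (p.1 - p.2) - v p.1 * w (p.1 - p.2)) *
      (φ p.1 - φ (p.1 - p.2))) (μ.prod κ) ∧
    ∫ p, φ p * (v p * nonlocal κ w p - w p * nonlocal κ v p) ∂μ =
      (1 / 2) * ∫ p : G × G, (w p.1 * v (p.1 - p.2) - v p.1 * w (p.1 - p.2)) *
        (φ p.1 - φ (p.1 - p.2)) ∂(μ.prod κ) := by
  set A : G × G → ℝ := fun p => w p.1 * v (p.1 - p.2) - v p.1 * w (p.1 - p.2) with hA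
  have hAi : Integrable A (μ.prod κ) :=
    ((memLp_comp_fst hw).integrable_mul (memLp_comp_sub hv)).sub
      ((memLp_comp_fst hv).integrable_mul (memLp_comp_sub hw))
  have hφ1 : AEStronglyMeasurable (fun p : G × G => φ p.1) (μ.prod κ) := hφ.comp_fst
  have hφ2 : AEStronglyMeasurable (fun p : G × G => φ (p.1 - p.2)) (μ.prod κ) :=
    hφ1.comp_measurePreserving (measurePreserving_sub_prod_id μ κ)
  have hi1 : Integrable (fun p => φ p.1 * A p) (μ.prod κ) :=
    hAi.bdd_mul hφ1 (ae_of_all _ fun p => hM _)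
  have hi2 : Integrable (fun p => φ (p.1 - p.2) * A p) (μ.prod κ) :=
    hAi.bdd_mul hφ2 (ae_of_all _ fun p => hM _)
  have hT := measurePreserving_sub_prod_neg μ κ hκ
  -- Exchanging the endpoints of the jump preserves the measure, changes the sign of `A` and moves
  -- `φ` to the other endpoint.
  have e1 : ∫ p, φ p.1 * A p ∂(μ.prod κ) = - ∫ p, φ (p.1 - p.2) * A p ∂(μ.prod κ) := by
    rw [← hT.map_eq, integral_map hT.aemeasurable (by rw [hT.map_eq]; exact hi1.1), hT.map_eq,
      ← integral_neg]
    congr 1; ext p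
    simp only [hA, sub_neg_eq_add, sub_add_cancel]
    ring
  have e2 : ∫ p, φ p * (v p * nonlocal κ w p - w p * nonlocal κ v p) ∂μ =
      ∫ p, φ p.1 * A p ∂(μ.prod κ) := by
    rw [integral_prod _ hi1]
    refine integral_congr_ae ?_
    filter_upwards [ae_integrable_comp_sub (κ := κ) hv, ae_integrable_comp_sub (κ := κ) hw]
      with p h1 h2
    rw [nonlocal, nonlocal, integral_const_mul, ← integral_const_mul (v p),
      ← integral_const_mul (w p), ← integral_sub]
    · congr 2; ext z; simp only [hA]; ring
    · exact ((integrable_const _).sub h2).const_mul _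
    · exact ((integrable_const _).sub h1).const_mul _
  have e3 : ∀ p : G × G, A p * (φ p.1 - φ (p.1 - p.2)) = φ p.1 * A p - φ (p.1 - p.2) * A p :=
    fun p => by ring
  have h4 : Integrable (fun p : G × G => A p * (φ p.1 - φ (p.1 - p.2))) (μ.prod κ) := by
    simp only [e3]; exact hi1.sub hi2
  refine ⟨h4, ?_⟩
  rw [e2]
  change _ = (1 / 2) * ∫ p, A p * (φ p.1 - φ (p.1 - p.2)) ∂(μ.prod κ)
  simp only [e3]
  rw [integral_sub hi1 hi2]
  linarith

end Group

/-! ### Weak convergence in `L²` from almost everywhere convergence -/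

theorem abs_integral_mul_le {α : Type*} [MeasurableSpace α] {μ : Measure α} {f g : α → ℝ}
    (hf : MemLp f 2 μ) (hg : MemLp g 2 μ) :
    |∫ x, f x * g x ∂μ| ≤ √(∫ x, f x ^ 2 ∂μ) * √(∫ x, g x ^ 2 ∂μ) := by
  have h := integral_mul_norm_le_Lp_mul_Lq (p := 2) (q := 2) (f := f) (g := g) (μ := μ)
    (by constructor <;> norm_num) (by simpa using hf) (by simpa using hg)
  have h2 : ∀ x, ‖f x‖ * ‖g x‖ = ‖f x * g x‖ := fun x => (norm_mul _ _).symm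
  simp only [Real.rpow_two, Real.norm_eq_abs, sq_abs] at h
  rw [← Real.sqrt_eq_rpow, ← Real.sqrt_eq_rpow] at h
  refine le_trans ?_ h
  refine (abs_integral_le_integral_abs).trans (le_of_eq ?_)
  congr 1; ext x; exact abs_mul _ _

theorem memLp_two_of_tendsto_ae {α : Type*} [MeasurableSpace α] {μ : Measure α} {h : ℕ → α → ℝ}
    {h₀ : α → ℝ} {C : ℝ} (hh : ∀ n, MemLp (h n) 2 μ) (hC : ∀ n, ∫ x, h n x ^ 2 ∂μ ≤ C)
    (hlim : ∀ᵐ x ∂μ, Tendsto (fun n => h n x) atTop (𝓝 (h₀ x))) :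
    MemLp h₀ 2 μ ∧ ∫ x, h₀ x ^ 2 ∂μ ≤ C := by
  have hm : AEStronglyMeasurable h₀ μ :=
    aestronglyMeasurable_of_tendsto_ae _ (fun n => (hh n).1) hlim
  have h1 : ∫⁻ x, ENNReal.ofReal (h₀ x ^ 2) ∂μ ≤ ENNReal.ofReal C := by
    calc ∫⁻ x, ENNReal.ofReal (h₀ x ^ 2) ∂μ
        = ∫⁻ x, liminf (fun n => ENNReal.ofReal (h n x ^ 2)) atTop ∂μ := by
          refine lintegral_congr_ae (hlim.mono fun x hx => ?_)
          exact (((ENNReal.continuous_ofReal.tendsto _).comp (hx.pow 2)).liminf_eq).symm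
      _ ≤ liminf (fun n => ∫⁻ x, ENNReal.ofReal (h n x ^ 2) ∂μ) atTop :=
          lintegral_liminf_le' fun n => ((hh n).1.aemeasurable.pow_const 2).ennreal_ofReal
      _ ≤ ENNReal.ofReal C := by
          refine liminf_le_of_frequently_le' (Frequently.of_forall fun n => ?_)
          rw [← ofReal_integral_eq_lintegral_ofReal (hh n).integrable_sq
            (ae_of_all _ fun x => sq_nonneg _)]
          exact ENNReal.ofReal_le_ofReal (hC n)
  have hC0 : 0 ≤ C := (integral_nonneg fun x => sq_nonneg _).trans (hC 0)
  have h2 : Integrable (fun x => h₀ x ^ 2) μ := by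
    refine ⟨hm.pow 2, ?_⟩
    rw [hasFiniteIntegral_iff_ofReal (ae_of_all _ fun x => sq_nonneg _)]
    exact h1.trans_lt ENNReal.ofReal_lt_top
  refine ⟨(memLp_two_iff_integrable_sq hm).2 h2, ?_⟩
  rw [← ofReal_integral_eq_lintegral_ofReal h2 (ae_of_all _ fun x => sq_nonneg _)] at h1
  exact (ENNReal.ofReal_le_ofReal_iff hC0).1 h1

/-- Write `|h n - h₀| |ψ|` as the product of the minimum and the maximum of the two factors. The
minimum is dominated by `|ψ|`, so it tends to zero in `L²`; the maximum, bounded by the sum, stays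
bounded in `L²`. -/
theorem tendsto_integral_mul_of_tendsto_ae {α : Type*} [MeasurableSpace α] {μ : Measure α}
    {h : ℕ → α → ℝ} {h₀ ψ : α → ℝ} {C : ℝ} (hh : ∀ n, MemLp (h n) 2 μ)
    (hC : ∀ n, ∫ x, h n x ^ 2 ∂μ ≤ C)
    (hlim : ∀ᵐ x ∂μ, Tendsto (fun n => h n x) atTop (𝓝 (h₀ x))) (hψ : MemLp ψ 2 μ) :
    Tendsto (fun n => ∫ x, h n x * ψ x ∂μ) atTop (𝓝 (∫ x, h₀ x * ψ x ∂μ)) := by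
  obtain ⟨hh₀, -⟩ := memLp_two_of_tendsto_ae hh hC hlim
  have hD : ∀ n, MemLp (fun x => h n x - h₀ x) 2 μ := fun n => (hh n).sub hh₀
  set θ : ℕ → α → ℝ := fun n x => min |ψ x| |h n x - h₀ x| with hθ
  have hθm : ∀ n, MemLp (θ n) 2 μ := fun n => by
    refine hψ.of_le (hψ.1.norm.inf (hD n).1.norm) (ae_of_all _ fun x => ?_)
    rw [Real.norm_of_nonneg (le_min (abs_nonneg _) (abs_nonneg _))]
    exact min_le_left _ _
  have hθ0 : Tendsto (fun n => ∫ x, θ n x ^ 2 ∂μ) atTop (𝓝 0) := by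
    rw [← integral_zero α ℝ (μ := μ)]
    refine tendsto_integral_of_dominated_convergence (fun x => ψ x ^ 2)
      (fun n => (hθm n).1.pow 2) hψ.integrable_sq (fun n => ae_of_all _ fun x => ?_) ?_
    · rw [Real.norm_of_nonneg (sq_nonneg _), ← sq_abs (ψ x)]
      exact pow_le_pow_left₀ (le_min (abs_nonneg _) (abs_nonneg _)) (min_le_left _ _) 2
    · filter_upwards [hlim] with x hx
      have h1 : Tendsto (fun n => |h n x - h₀ x|) atTop (𝓝 0) := by
        simpa using (hx.sub_const (h₀ x)).abs
      have h2 := (tendsto_const_nhds (x := |ψ x|)).min h1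
      rw [min_eq_right (abs_nonneg _)] at h2
      simpa using h2.pow 2
  have hmax : ∀ n, MemLp (fun x => |ψ x| + |h n x - h₀ x|) 2 μ := fun n => hψ.abs.add (hD n).abs
  set K := 2 * ∫ x, ψ x ^ 2 ∂μ + 4 * C + 4 * ∫ x, h₀ x ^ 2 ∂μ with hK
  have hKb : ∀ n, ∫ x, (|ψ x| + |h n x - h₀ x|) ^ 2 ∂μ ≤ K := by
    intro n
    have i1 := hψ.integrable_sq.const_mul 2
    have i2 := (hh n).integrable_sq.const_mul 4
    have i3 := hh₀.integrable_sq.const_mul 4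
    have i12 : Integrable (fun x => 2 * ψ x ^ 2 + 4 * h n x ^ 2) μ := i1.add i2
    calc ∫ x, (|ψ x| + |h n x - h₀ x|) ^ 2 ∂μ
        ≤ ∫ x, (2 * ψ x ^ 2 + 4 * h n x ^ 2 + 4 * h₀ x ^ 2) ∂μ := by
          refine integral_mono (hmax n).integrable_sq (i12.add i3) fun x => ?_
          have e1 := sq_abs (ψ x)
          have e2 := sq_abs (h n x - h₀ x)
          simp only
          nlinarith [sq_nonneg (|ψ x| - |h n x - h₀ x|), sq_nonneg (h n x + h₀ x)]
      _ = 2 * ∫ x, ψ x ^ 2 ∂μ + 4 * ∫ x, h n x ^ 2 ∂μ + 4 * ∫ x, h₀ x ^ 2 ∂μ := by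
          rw [integral_add i12 i3, integral_add i1 i2, integral_const_mul,
            integral_const_mul, integral_const_mul]
      _ ≤ K := by rw [hK]; linarith [hC n]
  rw [tendsto_iff_dist_tendsto_zero]
  have hlim2 : Tendsto (fun n => √(∫ x, θ n x ^ 2 ∂μ) * √K) atTop (𝓝 0) := by
    simpa using hθ0.sqrt.mul_const (√K)
  refine squeeze_zero (fun n => dist_nonneg) (fun n => ?_) hlim2
  have im : Integrable (fun x => h n x * ψ x) μ := (hh n).integrable_mul hψ
  have im₀ : Integrable (fun x => h₀ x * ψ x) μ := hh₀.integrable_mul hψ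
  rw [Real.dist_eq, ← integral_sub im im₀]
  calc |∫ x, (h n x * ψ x - h₀ x * ψ x) ∂μ|
      ≤ ∫ x, |h n x * ψ x - h₀ x * ψ x| ∂μ := abs_integral_le_integral_abs
    _ ≤ ∫ x, θ n x * (|ψ x| + |h n x - h₀ x|) ∂μ := by
        refine integral_mono (im.sub im₀).abs
          ((hθm n).integrable_mul (hmax n)) fun x => ?_
        simp only [hθ]
        rw [← sub_mul, abs_mul]
        rcases le_total |ψ x| |h n x - h₀ x| with hle | hle
        · rw [min_eq_left hle]; nlinarith [abs_nonneg (ψ x)]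
        · rw [min_eq_right hle]; nlinarith [abs_nonneg (h n x - h₀ x)]
    _ ≤ |∫ x, θ n x * (|ψ x| + |h n x - h₀ x|) ∂μ| := le_abs_self _
    _ ≤ √(∫ x, θ n x ^ 2 ∂μ) * √(∫ x, (|ψ x| + |h n x - h₀ x|) ^ 2 ∂μ) :=
        abs_integral_mul_le (hθm n) (hmax n)
    _ ≤ √(∫ x, θ n x ^ 2 ∂μ) * √K :=
        mul_le_mul_of_nonneg_left (Real.sqrt_le_sqrt (hKb n)) (Real.sqrt_nonneg _)

/-! ### Consequences of the spectral representation -/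

/-- `m` is a finite measure whose cosine transform is the autocorrelation of `f ∈ L²`. -/
structure IsSpectral {d : ℕ} (f : Cyl d → ℝ) (m : Measure (Freq d)) : Prop where
  memLp : MemLp f 2
  finite : IsFiniteMeasure m
  moment : Integrable (fun ν => freqNorm ν.1 ν.2 ^ 2) m
  corr : ∀ a : Cyl d, ∫ w, f (w + a) * f w = ∫ ν, (chi ν a).re ∂m

theorem measurable_freqNorm {d : ℕ} : Measurable fun ν : Freq d => freqNorm ν.1 ν.2 := by
  unfold freqNorm
  have : Measurable fun ν : Freq d => ν.1 ^ 2 + ∑ i, (ν.2 i : ℝ) ^ 2 := by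
    refine (measurable_fst.pow_const 2).add (Finset.measurable_sum _ fun i _ => ?_)
    exact ((measurable_from_top (f := fun n : ℤ => (n : ℝ))).comp
      ((measurable_pi_apply i).comp measurable_snd)).pow_const 2
  exact this.sqrt

theorem MemH.exists_isSpectral {d : ℕ} {f : Cyl d → ℝ} (hf : MemH 1 f) :
    ∃ m : Measure (Freq d), IsSpectral f m := by
  obtain ⟨m, h1, h2, h3⟩ := hf.exists_spectral
  refine ⟨m, hf.1, h1, ⟨(measurable_freqNorm.pow_const 2).aestronglyMeasurable, ?_⟩, h3⟩
  rw [hasFiniteIntegral_iff_ofReal (ae_of_all _ fun x => sq_nonneg _)]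
  refine lt_of_le_of_lt (le_of_eq ?_) h2
  congr 1; ext ν
  exact ENNReal.ofReal_pow (Real.sqrt_nonneg _) 2

theorem measurable_chi_comp {α : Type*} [MeasurableSpace α] {d : ℕ} {ν : α → Freq d}
    {a : α → Cyl d} (hν : Measurable ν) (ha : Measurable a) :
    Measurable fun x => chi (ν x) (a x) := by
  have h := measurable_chi.comp (hν.prodMk ha)
  exact h

theorem measurable_chi_left {d : ℕ} (a : Cyl d) : Measurable fun ν : Freq d => chi ν a :=
  measurable_chi_comp measurable_id measurable_const

namespace IsSpectral

variable {d : ℕ} {f : Cyl d → ℝ} {m : Measure (Freq d)}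

theorem memLp_translate (hf : IsSpectral f m) (a : Cyl d) : MemLp (fun w => f (w + a)) 2 :=
  hf.memLp.comp_measurePreserving (measurePreserving_add_right volume a)

theorem integral_translate_mul (hf : IsSpectral f m) (a b : Cyl d) :
    ∫ w, f (w + a) * f (w + b) = ∫ ν, (chi ν a * conj (chi ν b)).re ∂m := by
  have h := integral_add_right_eq_self (μ := (volume : Measure (Cyl d)))
    (fun w => f (w + (a - b)) * f w) b
  have h2 : ∀ w : Cyl d, w + b + (a - b) = w + a := fun w => by abel
  simp only [h2] at h
  rw [h, hf.corr]
  simp only [chi_sub]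

theorem integrable_chi_mul (hf : IsSpectral f m) (a b : Cyl d) :
    Integrable (fun ν => (chi ν a * conj (chi ν b)).re) m := by
  have := hf.finite
  refine Integrable.of_bound (C := 1) ?_ (ae_of_all _ fun ν => ?_)
  · exact (Complex.measurable_re.comp ((measurable_chi_left a).mul
      (Complex.continuous_conj.measurable.comp (measurable_chi_left b)))).aestronglyMeasurable
  · refine (Complex.abs_re_le_norm _).trans ?_
    rw [norm_mul, RCLike.norm_conj, norm_chi, norm_chi, one_mul]

/-- Polarized Plancherel. The autocorrelation alone determines all inner products between finite
combinations of translates, so second differences and difference quotients need no other knowledge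
of the Fourier transform. -/
theorem integral_sum_translate_mul {ι ι' : Type*} [Fintype ι] [Fintype ι'] (hf : IsSpectral f m)
    (c : ι → ℝ) (a : ι → Cyl d) (c' : ι' → ℝ) (a' : ι' → Cyl d) :
    ∫ w, (∑ i, c i * f (w + a i)) * ∑ j, c' j * f (w + a' j) =
      ∫ ν, ((∑ i, c i * chi ν (a i)) * conj (∑ j, c' j * chi ν (a' j))).re ∂m := by
  have e1 : ∀ w, (∑ i, c i * f (w + a i)) * ∑ j, c' j * f (w + a' j) =
      ∑ i, ∑ j, (c i * c' j) * (f (w + a i) * f (w + a' j)) := by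
    intro w
    rw [Finset.sum_mul_sum]
    exact Finset.sum_congr rfl fun i _ => Finset.sum_congr rfl fun j _ => by ring
  have e2 : ∀ ν : Freq d, ((∑ i, c i * chi ν (a i)) * conj (∑ j, c' j * chi ν (a' j))).re =
      ∑ i, ∑ j, (c i * c' j) * (chi ν (a i) * conj (chi ν (a' j))).re := by
    intro ν
    rw [map_sum, Finset.sum_mul_sum, Complex.re_sum]
    refine Finset.sum_congr rfl fun i _ => ?_
    rw [Complex.re_sum]
    refine Finset.sum_congr rfl fun j _ => ?_
    rw [map_mul, Complex.conj_ofReal, ← Complex.re_ofReal_mul]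
    congr 1; push_cast; ring
  simp only [e1, e2]
  rw [integral_finsetSum, integral_finsetSum]
  · refine Finset.sum_congr rfl fun i _ => ?_
    rw [integral_finsetSum, integral_finsetSum]
    · refine Finset.sum_congr rfl fun j _ => ?_
      rw [integral_const_mul, integral_const_mul, hf.integral_translate_mul]
    · exact fun j _ => (hf.integrable_chi_mul _ _).const_mul _
    · exact fun j _ => ((hf.memLp_translate _).integrable_mul (hf.memLp_translate _)).const_mul _
  · exact fun i _ => integrable_finsetSum _ fun j _ => (hf.integrable_chi_mul _ _).const_mul _
  · exact fun i _ => integrable_finsetSum _ fun j _ =>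
      ((hf.memLp_translate _).integrable_mul (hf.memLp_translate _)).const_mul _

theorem integral_sum_translate_sq {ι : Type*} [Fintype ι] (hf : IsSpectral f m)
    (c : ι → ℝ) (a : ι → Cyl d) :
    ∫ w, (∑ i, c i * f (w + a i)) ^ 2 = ∫ ν, ‖∑ i, c i * chi ν (a i)‖ ^ 2 ∂m := by
  simp only [sq (∑ i, c i * f _)]
  rw [hf.integral_sum_translate_mul]
  congr 1; ext ν
  rw [mul_comm, ← Complex.normSq_eq_conj_mul_self, Complex.ofReal_re, Complex.normSq_eq_norm_sq]

theorem integral_second_difference_mul (hf : IsSpectral f m) (z z' : Cyl d) :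
    ∫ w, (f w - (1 / 2) * f (w - z) - (1 / 2) * f (w + z)) *
        (f w - (1 / 2) * f (w - z') - (1 / 2) * f (w + z')) =
      ∫ ν, (1 - (chi ν z).re) * (1 - (chi ν z').re) ∂m := by
  have h := hf.integral_sum_translate_mul ![1, -(1 / 2), -(1 / 2)] ![0, -z, z]
    ![1, -(1 / 2), -(1 / 2)] ![0, -z', z']
  have e1 : ∀ z : Cyl d, ∀ w, ∑ i, (![1, -(1 / 2), -(1 / 2)] : Fin 3 → ℝ) i *
      f (w + (![0, -z, z] : Fin 3 → Cyl d) i) =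
      f w - (1 / 2) * f (w - z) - (1 / 2) * f (w + z) := by
    intro z w
    simp only [Fin.sum_univ_three, Matrix.cons_val, add_zero, ← sub_eq_add_neg]
    ring
  have e2 : ∀ z : Cyl d, ∀ ν : Freq d, ∑ i, ((![1, -(1 / 2), -(1 / 2)] : Fin 3 → ℝ) i : ℂ) *
      chi ν ((![0, -z, z] : Fin 3 → Cyl d) i) = ((1 - (chi ν z).re : ℝ) : ℂ) := by
    intro z ν
    simp only [Fin.sum_univ_three, Matrix.cons_val, chi_zero, chi_neg]
    push_cast
    rw [Complex.re_eq_add_conj]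
    ring
  simp only [e1, e2] at h
  rw [h]
  congr 1; ext ν
  rw [Complex.conj_ofReal, ← Complex.ofReal_mul, Complex.ofReal_re]

/-- Finite jump operators act on `L²` through their symbol. -/
theorem nonlocal_bound (hf : IsSpectral f m) {κ : Measure (Cyl d)} [IsFiniteMeasure κ]
    (hκ : κ.map Neg.neg = κ) {C : ℝ}
    (hσ : ∀ ν : Freq d, ∫ w, (1 - (chi ν w).re) ∂κ ≤ C * freqNorm ν.1 ν.2) :
    MemLp (nonlocal κ f) 2 ∧
      ∫ w, nonlocal κ f w ^ 2 ≤ C ^ 2 * ∫ ν, freqNorm ν.1 ν.2 ^ 2 ∂m := by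
  have := hf.finite
  -- The square of the operator is a double integral over two independent jumps. For a fixed pair,
  -- the integral over `w` is the inner product of two second differences; Fubini then assembles the
  -- squared symbol.
  set F : Cyl d × Cyl d → ℝ := fun p =>
    f p.1 - (1 / 2) * f (p.1 - p.2) - (1 / 2) * f (p.1 + p.2) with hF
  have hF2 : MemLp F 2 (volume.prod κ) :=
    ((memLp_comp_fst hf.memLp).sub ((memLp_comp_sub hf.memLp).const_mul _)).sub
      ((memLp_comp_add hκ hf.memLp).const_mul _)
  have hF1 : MemLp (fun p : Cyl d × (Cyl d × Cyl d) => F (p.1, p.2.1)) 2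
      (volume.prod (κ.prod κ)) := by
    have h1 : MemLp (fun p : (Cyl d × Cyl d) × Cyl d => F p.1) 2 ((volume.prod κ).prod κ) :=
      memLp_comp_fst hF2
    have h2 := (measurePreserving_prodAssoc (volume : Measure (Cyl d)) κ κ).symm
    exact h1.comp_measurePreserving h2
  have hF3 : MemLp (fun p : Cyl d × (Cyl d × Cyl d) => F (p.1, p.2.2)) 2
      (volume.prod (κ.prod κ)) :=
    hF1.comp_measurePreserving ((MeasurePreserving.id volume).prod Measure.measurePreserving_swap)
  have hΦ : Integrable (fun p : Cyl d × (Cyl d × Cyl d) => F (p.1, p.2.1) * F (p.1, p.2.2))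
      (volume.prod (κ.prod κ)) := hF1.integrable_mul hF3
  have e1 : ∀ᵐ w : Cyl d, ∫ q : Cyl d × Cyl d, F (w, q.1) * F (w, q.2) ∂(κ.prod κ) =
      nonlocal κ f w ^ 2 := by
    filter_upwards [ae_nonlocal_eq_symm hκ hf.memLp] with w hw
    rw [integral_prod_mul (fun z => F (w, z)) (fun z => F (w, z)), hw, sq]
  have hint : Integrable fun w => nonlocal κ f w ^ 2 := hΦ.integral_prod_left.congr e1
  refine ⟨(memLp_two_iff_integrable_sq (aestronglyMeasurable_nonlocal hf.memLp)).2 hint, ?_⟩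
  have hg : Integrable (fun p : (Cyl d × Cyl d) × Freq d =>
      (1 - (chi p.2 p.1.1).re) * (1 - (chi p.2 p.1.2).re)) ((κ.prod κ).prod m) := by
    refine Integrable.of_bound (C := 2 * 2) ?_ (ae_of_all _ fun p => ?_)
    · have h1 : Measurable fun p : (Cyl d × Cyl d) × Freq d => (chi p.2 p.1.1).re :=
        Complex.measurable_re.comp (measurable_chi_comp
          measurable_snd (measurable_fst.comp measurable_fst))
      have h2 : Measurable fun p : (Cyl d × Cyl d) × Freq d => (chi p.2 p.1.2).re :=
        Complex.measurable_re.comp (measurable_chi_comp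
          measurable_snd (measurable_snd.comp measurable_fst))
      exact ((measurable_const.sub h1).mul (measurable_const.sub h2)).aestronglyMeasurable
    · have hb : ∀ z : Cyl d, ‖1 - (chi p.2 z).re‖ ≤ 2 := by
        intro z
        have h1 := (Complex.abs_re_le_norm (chi p.2 z)).trans (norm_chi _ _).le
        rw [abs_le] at h1
        rw [Real.norm_eq_abs, abs_le]
        constructor <;> linarith
      rw [norm_mul]
      exact mul_le_mul (hb _) (hb _) (norm_nonneg _) zero_le_two
  calc ∫ w, nonlocal κ f w ^ 2
      = ∫ w : Cyl d, (∫ q : Cyl d × Cyl d, F (w, q.1) * F (w, q.2) ∂(κ.prod κ)) :=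
        (integral_congr_ae e1).symm
    _ = ∫ q : Cyl d × Cyl d, (∫ w : Cyl d, F (w, q.1) * F (w, q.2)) ∂(κ.prod κ) :=
        integral_integral_swap hΦ
    _ = ∫ q : Cyl d × Cyl d, (∫ ν : Freq d,
          (1 - (chi ν q.1).re) * (1 - (chi ν q.2).re) ∂m) ∂(κ.prod κ) := by
        congr 1; ext q; exact hf.integral_second_difference_mul q.1 q.2
    _ = ∫ ν : Freq d, (∫ q : Cyl d × Cyl d,
          (1 - (chi ν q.1).re) * (1 - (chi ν q.2).re) ∂(κ.prod κ)) ∂m :=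
        integral_integral_swap hg
    _ = ∫ ν, (∫ w, (1 - (chi ν w).re) ∂κ) ^ 2 ∂m := by
        congr 1; ext ν
        rw [integral_prod_mul (fun z : Cyl d => 1 - (chi ν z).re)
          (fun z : Cyl d => 1 - (chi ν z).re), sq]
    _ ≤ ∫ ν, C ^ 2 * freqNorm ν.1 ν.2 ^ 2 ∂m := by
        refine integral_mono_of_nonneg (ae_of_all _ fun ν => sq_nonneg _)
          (hf.moment.const_mul _) (ae_of_all _ fun ν => ?_)
        simp only
        rw [← mul_pow]
        exact pow_le_pow_left₀ (integral_nonneg fun w => sub_nonneg.2 (chi_re_le_one ν w)) (hσ ν) 2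
    _ = C ^ 2 * ∫ ν, freqNorm ν.1 ν.2 ^ 2 ∂m := integral_const_mul _ _

end IsSpectral

/-! ### Difference quotients -/

theorem norm_sq_toLp {α : Type*} [MeasurableSpace α] {μ : Measure α} {g : α → ℝ}
    (hg : MemLp g 2 μ) : ‖hg.toLp‖ ^ 2 = ∫ x, g x ^ 2 ∂μ := by
  rw [← real_inner_self_eq_norm_sq, L2.inner_def]
  refine integral_congr_ae (hg.coeFn_toLp.mono fun x hx => ?_)
  simp only [RCLike.inner_apply, conj_trivial]
  rw [hx, sq]

/-- `L²` is complete. -/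
theorem exists_tendsto_of_cauchy {α : Type*} [MeasurableSpace α] {μ : Measure α}
    {g : ℕ → α → ℝ} (hg : ∀ n, MemLp (g n) 2 μ) {E : ℕ → ℝ} (hE : Tendsto E atTop (𝓝 0))
    (h : ∀ n l, ∫ x, (g n x - g l x) ^ 2 ∂μ ≤ E n + E l) :
    ∃ g₀, MemLp g₀ 2 μ ∧ Tendsto (fun n => ∫ x, (g n x - g₀ x) ^ 2 ∂μ) atTop (𝓝 0) := by
  have hd : ∀ n l, ‖(hg n).toLp - (hg l).toLp‖ ^ 2 ≤ E n + E l := by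
    intro n l
    rw [← MemLp.toLp_sub, norm_sq_toLp]
    exact h n l
  have hc : CauchySeq fun n => (hg n).toLp := by
    rw [Metric.cauchySeq_iff]
    intro ε hε
    obtain ⟨N, hN⟩ := eventually_atTop.1
      (hE.eventually (gt_mem_nhds (by positivity : 0 < ε ^ 2 / 2)))
    refine ⟨N, fun n hn l hl => ?_⟩
    rw [dist_eq_norm]
    refine lt_of_pow_lt_pow_left₀ 2 hε.le ((hd n l).trans_lt ?_)
    linarith [hN n hn, hN l hl]
  obtain ⟨G, hG⟩ := cauchySeq_tendsto_of_complete hc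
  refine ⟨G, Lp.memLp G, ?_⟩
  have h1 : Tendsto (fun n => ‖(hg n).toLp - G‖ ^ 2) atTop (𝓝 0) := by
    simpa using (tendsto_iff_norm_sub_tendsto_zero.1 hG).pow 2
  refine h1.congr fun n => ?_
  have h2 : (hg n).toLp - G = ((hg n).sub (Lp.memLp G)).toLp := by
    rw [MemLp.toLp_sub (hg n) (Lp.memLp G), Lp.toLp_coeFn]
  rw [h2, norm_sq_toLp]
  rfl

/-- The `n`-th difference quotient in direction `b`. -/
def diffQuot {d : ℕ} (b : Cover d) (n : ℕ) (f : Cyl d → ℝ) (w : Cyl d) : ℝ :=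
  (n + 1) * (f (w + proj ((1 / ((n : ℝ) + 1)) • b)) - f w)

/-- The symbol of the difference quotient, as a function of the phase. -/
def diffSymbol (n : ℕ) (p : ℝ) : ℂ :=
  (n + 1) * (Complex.exp ((1 / ((n : ℝ) + 1) * p : ℝ) * Complex.I) - 1)

theorem norm_diffSymbol_le (n : ℕ) (p : ℝ) : ‖diffSymbol n p‖ ≤ |p| := by
  have h := Real.norm_exp_I_mul_ofReal_sub_one_le (x := 1 / ((n : ℝ) + 1) * p)
  rw [diffSymbol, norm_mul, mul_comm _ Complex.I]
  have h1 : ‖((n : ℂ) + 1)‖ = (n : ℝ) + 1 := by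
    have : ((n : ℂ) + 1) = ((n + 1 : ℕ) : ℂ) := by push_cast; rfl
    rw [this, Complex.norm_natCast]; push_cast; rfl
  have h0 : (0 : ℝ) < (n : ℝ) + 1 := by positivity
  rw [h1]
  calc ((n : ℝ) + 1) * _ ≤ ((n : ℝ) + 1) * ‖1 / ((n : ℝ) + 1) * p‖ :=
        mul_le_mul_of_nonneg_left h h0.le
    _ = |p| := by
        rw [Real.norm_eq_abs, abs_mul, abs_of_pos (by positivity)]
        field_simp

theorem tendsto_diffSymbol (p : ℝ) :
    Tendsto (fun n => diffSymbol n p) atTop (𝓝 (p * Complex.I)) := by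
  have h1 : HasDerivAt (fun t : ℝ => Complex.exp ((t * p : ℝ) * Complex.I)) (p * Complex.I) 0 := by
    have h2 : HasDerivAt (fun t : ℝ => ((t * p : ℝ) : ℂ) * Complex.I) (p * Complex.I) 0 := by
      have := ((hasDerivAt_id (0 : ℝ)).mul_const p).ofReal_comp.mul_const Complex.I
      simpa using this
    simpa using h2.cexp
  have h3 := h1.tendsto_slope_zero_right
  have h4 : Tendsto (fun n : ℕ => 1 / ((n : ℝ) + 1)) atTop (𝓝[>] 0) :=
    tendsto_nhdsWithin_iff.2 ⟨tendsto_one_div_add_atTop_nhds_zero_nat,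
      Eventually.of_forall fun n => by simp only [Set.mem_Ioi]; positivity⟩
  refine (h3.comp h4).congr fun n => ?_
  simp only [Function.comp, diffSymbol]
  rw [Complex.real_smul]
  push_cast
  simp

theorem chi_proj_smul {d : ℕ} (ν : Freq d) (b : Cover d) (t : ℝ) :
    chi ν (proj (t • b)) =
      Complex.exp ((t * (2 * Real.pi * (ν.1 * b.1 + ∑ i, ν.2 i * b.2 i)) : ℝ) * Complex.I) := by
  rw [chi_proj]
  congr 3
  simp only [Prod.smul_fst, Prod.smul_snd, Pi.smul_apply, smul_eq_mul]
  have : ∑ i, (ν.2 i : ℝ) * (t * b.2 i) = t * ∑ i, ν.2 i * b.2 i := by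
    rw [Finset.mul_sum]; exact Finset.sum_congr rfl fun i _ => by ring
  rw [this]; ring

namespace IsSpectral

variable {d : ℕ} {f : Cyl d → ℝ} {m : Measure (Freq d)}

theorem memLp_diffQuot (hf : IsSpectral f m) (b : Cover d) (n : ℕ) : MemLp (diffQuot b n f) 2 :=
  ((hf.memLp_translate _).sub hf.memLp).const_mul _

theorem integral_diffQuot_sq_le (hd : 1 ≤ d) (hf : IsSpectral f m) (b : Cover d) (n : ℕ) :
    ∫ w, diffQuot b n f w ^ 2 ≤
      (2 * Real.pi * (d * ‖b‖)) ^ 2 * ∫ ν, freqNorm ν.1 ν.2 ^ 2 ∂m := by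
  have h := hf.integral_sum_translate_sq ![(n : ℝ) + 1, -((n : ℝ) + 1)]
    ![proj ((1 / ((n : ℝ) + 1)) • b), 0]
  have e1 : ∀ w, ∑ i, (![(n : ℝ) + 1, -((n : ℝ) + 1)] : Fin 2 → ℝ) i *
      f (w + (![proj ((1 / ((n : ℝ) + 1)) • b), 0] : Fin 2 → Cyl d) i) = diffQuot b n f w := by
    intro w
    simp only [Fin.sum_univ_two, Matrix.cons_val, add_zero, diffQuot]
    ring
  have e2 : ∀ ν : Freq d, ∑ i, ((![(n : ℝ) + 1, -((n : ℝ) + 1)] : Fin 2 → ℝ) i : ℂ) *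
      chi ν ((![proj ((1 / ((n : ℝ) + 1)) • b), 0] : Fin 2 → Cyl d) i) =
      diffSymbol n (2 * Real.pi * (ν.1 * b.1 + ∑ i, ν.2 i * b.2 i)) := by
    intro ν
    simp only [Fin.sum_univ_two, Matrix.cons_val, chi_zero, chi_proj_smul, diffSymbol]
    push_cast; ring
  simp only [e1, e2] at h
  rw [h, ← integral_const_mul]
  refine integral_mono_of_nonneg (ae_of_all _ fun ν => by positivity)
    (hf.moment.const_mul _) (ae_of_all _ fun ν => ?_)
  simp only
  rw [← mul_pow]
  refine pow_le_pow_left₀ (norm_nonneg _) ((norm_diffSymbol_le _ _).trans ?_) 2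
  rw [abs_mul, abs_of_pos (by positivity : 0 < 2 * Real.pi)]
  calc 2 * Real.pi * |ν.1 * b.1 + ∑ i, ν.2 i * b.2 i|
      ≤ 2 * Real.pi * (d * freqNorm ν.1 ν.2 * ‖b‖) :=
        mul_le_mul_of_nonneg_left (abs_phase_le hd ν b) (by positivity)
    _ = _ := by ring

/-- The symbols of the quotients are at most a multiple of `|ν|` and converge pointwise, so they
converge in `L²(m)` by the second moment of `m`. The difference of two quotients combines three
translates, and Plancherel makes the quotients Cauchy. -/
theorem exists_diffQuot_limit (hd : 1 ≤ d) (hf : IsSpectral f m) (b : Cover d) :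
    ∃ g, MemLp g 2 ∧ Tendsto (fun n => ∫ w, (diffQuot b n f w - g w) ^ 2) atTop (𝓝 0) := by
  set p : Freq d → ℝ := fun ν => 2 * Real.pi * (ν.1 * b.1 + ∑ i, ν.2 i * b.2 i) with hp
  have hpm : Measurable p := by
    refine measurable_const.mul ((measurable_fst.mul_const _).add
      (Finset.measurable_sum _ fun i _ => ?_))
    exact ((measurable_from_top (f := fun n : ℤ => (n : ℝ))).comp
      ((measurable_pi_apply i).comp measurable_snd)).mul_const _
  have hpb : ∀ ν, |p ν| ≤ 2 * Real.pi * (d * ‖b‖) * freqNorm ν.1 ν.2 := by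
    intro ν
    rw [hp, abs_mul, abs_of_pos (by positivity : 0 < 2 * Real.pi)]
    calc 2 * Real.pi * |ν.1 * b.1 + ∑ i, ν.2 i * b.2 i|
        ≤ 2 * Real.pi * (d * freqNorm ν.1 ν.2 * ‖b‖) :=
          mul_le_mul_of_nonneg_left (abs_phase_le hd ν b) (by positivity)
      _ = _ := by ring
  have hsm : ∀ n, Measurable fun ν => diffSymbol n (p ν) := by
    intro n
    have : Measurable (diffSymbol n) := by unfold diffSymbol; fun_prop
    exact this.comp hpm
  set E : ℕ → ℝ := fun n => 2 * ∫ ν, ‖diffSymbol n (p ν) - p ν * Complex.I‖ ^ 2 ∂m with hE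
  have hbd : ∀ n ν, ‖diffSymbol n (p ν) - p ν * Complex.I‖ ^ 2 ≤
      4 * (2 * Real.pi * (d * ‖b‖)) ^ 2 * freqNorm ν.1 ν.2 ^ 2 := by
    intro n ν
    have h1 : ‖diffSymbol n (p ν) - p ν * Complex.I‖ ≤
        2 * (2 * Real.pi * (d * ‖b‖) * freqNorm ν.1 ν.2) := by
      refine (norm_sub_le _ _).trans ?_
      have h2 := norm_diffSymbol_le n (p ν)
      rw [norm_mul, Complex.norm_I, mul_one, Complex.norm_real, Real.norm_eq_abs]
      linarith [hpb ν]
    calc _ ≤ (2 * (2 * Real.pi * (d * ‖b‖) * freqNorm ν.1 ν.2)) ^ 2 :=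
          pow_le_pow_left₀ (norm_nonneg _) h1 2
      _ = _ := by ring
  have hms : ∀ n, AEStronglyMeasurable (fun ν => ‖diffSymbol n (p ν) - p ν * Complex.I‖ ^ 2) m :=
    fun n => (((hsm n).sub ((Complex.measurable_ofReal.comp hpm).mul_const _)).norm.pow_const
      2).aestronglyMeasurable
  have hsi : ∀ n, Integrable (fun ν => ‖diffSymbol n (p ν) - p ν * Complex.I‖ ^ 2) m :=
    fun n => (hf.moment.const_mul _).mono' (hms n) (ae_of_all _ fun ν => by
      rw [Real.norm_of_nonneg (by positivity)]; exact hbd n ν)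
  have hE0 : Tendsto E atTop (𝓝 0) := by
    have h1 : Tendsto (fun n => ∫ ν, ‖diffSymbol n (p ν) - p ν * Complex.I‖ ^ 2 ∂m) atTop
        (𝓝 (∫ ν : Freq d, (0 : ℝ) ∂m)) := by
      refine tendsto_integral_of_dominated_convergence _ hms
        (hf.moment.const_mul (4 * (2 * Real.pi * (d * ‖b‖)) ^ 2))
        (fun n => ae_of_all _ fun ν => ?_) (ae_of_all _ fun ν => ?_)
      · rw [Real.norm_of_nonneg (by positivity)]; exact hbd n ν
      · have := ((tendsto_diffSymbol (p ν)).sub_const (p ν * Complex.I)).norm.pow 2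
        simpa using this
    rw [integral_zero] at h1
    simpa [hE] using h1.const_mul 2
  refine exists_tendsto_of_cauchy (hf.memLp_diffQuot b) hE0 fun n l => ?_
  have h := hf.integral_sum_translate_sq
    ![(n : ℝ) + 1, -((l : ℝ) + 1), ((l : ℝ) + 1) - ((n : ℝ) + 1)]
    ![proj ((1 / ((n : ℝ) + 1)) • b), proj ((1 / ((l : ℝ) + 1)) • b), 0]
  have e1 : ∀ w, ∑ i, (![(n : ℝ) + 1, -((l : ℝ) + 1), ((l : ℝ) + 1) - ((n : ℝ) + 1)] :
      Fin 3 → ℝ) i * f (w + (![proj ((1 / ((n : ℝ) + 1)) • b), proj ((1 / ((l : ℝ) + 1)) • b), 0] :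
        Fin 3 → Cyl d) i) = diffQuot b n f w - diffQuot b l f w := by
    intro w
    simp only [Fin.sum_univ_three, Matrix.cons_val, add_zero, diffQuot]
    ring
  have e2 : ∀ ν : Freq d, ∑ i, ((![(n : ℝ) + 1, -((l : ℝ) + 1), ((l : ℝ) + 1) - ((n : ℝ) + 1)] :
      Fin 3 → ℝ) i : ℂ) * chi ν ((![proj ((1 / ((n : ℝ) + 1)) • b),
        proj ((1 / ((l : ℝ) + 1)) • b), 0] : Fin 3 → Cyl d) i) =
      diffSymbol n (p ν) - diffSymbol l (p ν) := by
    intro ν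
    simp only [Fin.sum_univ_three, Matrix.cons_val, chi_zero, chi_proj_smul, diffSymbol, hp]
    push_cast; ring
  simp only [e1, e2] at h
  rw [h]
  calc ∫ ν, ‖diffSymbol n (p ν) - diffSymbol l (p ν)‖ ^ 2 ∂m
      ≤ ∫ ν, (2 * ‖diffSymbol n (p ν) - p ν * Complex.I‖ ^ 2 +
          2 * ‖diffSymbol l (p ν) - p ν * Complex.I‖ ^ 2) ∂m := by
        refine integral_mono_of_nonneg (ae_of_all _ fun ν => by positivity)
          (((hsi n).const_mul 2).add ((hsi l).const_mul 2)) (ae_of_all _ fun ν => ?_)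
        simp only
        have h1 : ‖diffSymbol n (p ν) - diffSymbol l (p ν)‖ ≤
            ‖diffSymbol n (p ν) - p ν * Complex.I‖ + ‖diffSymbol l (p ν) - p ν * Complex.I‖ := by
          have := norm_sub_le (diffSymbol n (p ν) - p ν * Complex.I)
            (diffSymbol l (p ν) - p ν * Complex.I)
          simpa using this
        have h2 := pow_le_pow_left₀ (norm_nonneg _) h1 2
        nlinarith [sq_nonneg (‖diffSymbol n (p ν) - p ν * Complex.I‖ -
          ‖diffSymbol l (p ν) - p ν * Complex.I‖)]
    _ = E n + E l := by
        rw [integral_add ((hsi n).const_mul 2) ((hsi l).const_mul 2), integral_const_mul,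
          integral_const_mul]

end IsSpectral

/-! ### Functions of the axial variable -/

open FourierTransform in
/-- Smooth compactly supported functions of `x` have spectral measures. -/
theorem exists_isSpectral_fst {d : ℕ} {θ : ℝ → ℝ} (hθ : ContDiff ℝ ∞ θ)
    (hc : HasCompactSupport θ) :
    ∃ m : Measure (Freq d), IsSpectral (fun w : Cyl d => θ w.1) m := by
  have hc' : HasCompactSupport fun x => (θ x : ℂ) := hc.comp_left (g := fun r : ℝ => (r : ℂ)) rfl
  have hs' : ContDiff ℝ ∞ fun x => (θ x : ℂ) := Complex.ofRealCLM.contDiff.comp hθ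
  set S : SchwartzMap ℝ ℂ := hc'.toSchwartzMap hs' with hS
  set m₀ : Measure ℝ := volume.withDensity fun ξ => ‖𝓕 S ξ‖ₑ ^ 2 with hm₀
  have hSm : Measurable fun ξ => ‖𝓕 S ξ‖ₑ ^ 2 := ((𝓕 S).continuous.enorm.measurable).pow_const 2
  have hmk := measurable_freq_mk (d := d) 0
  have hint : ∀ k : ℕ, Integrable (fun ξ => ξ ^ k) m₀ := by
    intro k
    rw [hm₀, integrable_withDensity_iff_integrable_smul' hSm (ae_of_all _ fun ξ => by simp)]
    have h1 := (𝓕 S).integrable_pow_mul volume k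
    refine (h1.const_mul (SchwartzMap.seminorm ℝ 0 0 (𝓕 S))).mono'
      (hSm.ennreal_toReal.smul (measurable_id.pow_const k)).aestronglyMeasurable
      (ae_of_all _ fun ξ => ?_)
    rw [ENNReal.toReal_pow, toReal_enorm, norm_smul, norm_pow, norm_norm, norm_pow]
    have h2 := SchwartzMap.norm_le_seminorm ℝ (𝓕 S) ξ
    calc ‖𝓕 S ξ‖ ^ 2 * ‖ξ‖ ^ k = ‖𝓕 S ξ‖ * (‖ξ‖ ^ k * ‖𝓕 S ξ‖) := by ring
      _ ≤ _ := mul_le_mul_of_nonneg_right h2 (by positivity)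
  have hfin : IsFiniteMeasure m₀ := by
    have h := hint 0
    simp only [pow_zero] at h
    exact (integrable_const_iff_isFiniteMeasure one_ne_zero).1 h
  have hL2 : MemLp θ 2 := hθ.continuous.memLp_of_hasCompactSupport hc
  have hnorm : ∀ ξ : ℝ, freqNorm (d := d) ξ 0 ^ 2 = ξ ^ 2 := by
    intro ξ
    rw [freqNorm, Real.sq_sqrt (by positivity)]
    simp
  -- A function of `x` alone has its spectrum on the line `k = 0`, with density `|𝓕θ|²`.
  refine ⟨m₀.map fun ξ => (ξ, 0), hL2.comp_fst _, inferInstance, ?_, fun a => ?_⟩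
  · rw [integrable_map_measure (measurable_freqNorm.pow_const 2).aestronglyMeasurable
      hmk.aemeasurable]
    exact (hint 2).congr (ae_of_all _ fun ξ => (hnorm ξ).symm)
  have hchi : ∀ ξ : ℝ, chi (d := d) (ξ, 0) a = lineChar a.1 ξ := by
    intro ξ
    simp [chi, UnitAddTorus.mFourier_zero]
  rw [integral_map (f := fun ν : Freq d => (chi ν a).re) hmk.aemeasurable
    (Complex.measurable_re.comp (measurable_chi_left a)).aestronglyMeasurable]
  simp only [hchi]
  have e1 : ∫ w : Cyl d, θ (w + a).1 * θ w.1 = ∫ x, θ (x + a.1) * θ x := by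
    have := integral_fun_fst (μ := (volume : Measure ℝ))
      (ν := (volume : Measure (Fin (d - 1) → UnitAddCircle))) (fun x => θ (x + a.1) * θ x)
    rw [probReal_univ, one_smul] at this
    exact this
  have hi : Integrable (fun ξ => lineChar a.1 ξ) m₀ :=
    Integrable.of_bound (continuous_lineChar _).aestronglyMeasurable 1
      (ae_of_all _ fun ξ => (norm_lineChar _ _).le)
  have e2 : ((∫ x, θ (x + a.1) * θ x : ℝ) : ℂ) = ∫ ξ, lineChar a.1 ξ ∂m₀ := by
    have h := integral_translate_line (S.toLp 2) a.1
    rw [SchwartzMap.toLp_fourier_eq] at h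
    rw [hm₀, integral_withDensity_eq_integral_toReal_smul hSm (ae_of_all _ fun ξ => by simp),
      ← integral_complex_ofReal]
    trans ∫ x, conj (S.toLp 2 volume x) * S.toLp 2 volume (x + a.1)
    · refine integral_congr_ae ?_
      have h1 := S.coeFn_toLp 2 volume
      filter_upwards [h1, (measurePreserving_add_right volume a.1).quasiMeasurePreserving.ae h1]
        with x hx hx'
      rw [hx, hx']
      change ((θ (x + a.1) * θ x : ℝ) : ℂ) = conj (θ x : ℂ) * (θ (x + a.1) : ℂ)
      rw [Complex.conj_ofReal]; push_cast; ring
    · rw [h]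
      refine integral_congr_ae (((𝓕 S).coeFn_toLp 2 volume).mono fun ξ hξ => ?_)
      simp only
      rw [hξ, ENNReal.toReal_pow, toReal_enorm, Complex.real_smul, mul_comm]
  have e3 : ∫ ξ, (lineChar a.1 ξ).re ∂m₀ = (∫ ξ, lineChar a.1 ξ ∂m₀).re := integral_re hi
  rw [e1, e3, ← e2, Complex.ofReal_re]

/-! ### Functions on which the truncated operators converge -/

/-- The truncated jump measures along `ε = 1/(n+1)`. -/
abbrev jumpSeq {d : ℕ} (H : Cover d → ℝ) (n : ℕ) : Measure (Cyl d) :=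
  jumpTrunc H (1 / ((n : ℝ) + 1))

theorem isFiniteMeasure_jumpSeq {d : ℕ} (hd : 1 ≤ d) {H : Cover d → ℝ}
    (hH : KernelAssumptions d H) (n : ℕ) : IsFiniteMeasure (jumpSeq H n) :=
  isFiniteMeasure_jumpTrunc hd hH (by positivity)

theorem jumpSeq_mono {d : ℕ} {H : Cover d → ℝ} {n l : ℕ} (h : n ≤ l) :
    jumpSeq H n ≤ jumpSeq H l :=
  jumpTrunc_mono (Nat.one_div_le_one_div h)

/-- The truncated operators are uniformly bounded in `L²` at `g`. -/
structure IsTruncBounded {d : ℕ} (H : Cover d → ℝ) (g : Cyl d → ℝ) : Prop where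
  memLp : MemLp g 2
  trunc : ∀ n, MemLp (nonlocal (jumpSeq H n) g) 2
  bound : ∃ C, ∀ n, ∫ w, nonlocal (jumpSeq H n) g w ^ 2 ≤ C

/-- The symbol bound does not depend on the truncation, hence neither does the `L²` bound. -/
theorem IsSpectral.isTruncBounded {d : ℕ} (hd : 1 ≤ d) {H : Cover d → ℝ}
    (hH : KernelAssumptions d H) {f : Cyl d → ℝ} {m : Measure (Freq d)} (hf : IsSpectral f m) :
    IsTruncBounded H f := by
  obtain ⟨C, -, hC⟩ := exists_symbol_bound hd hH
  have h : ∀ n, _ := fun n : ℕ =>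
    have := isFiniteMeasure_jumpSeq hd hH n
    hf.nonlocal_bound (map_neg_jumpTrunc hH (1 / ((n : ℝ) + 1)))
      (hC (1 / ((n : ℝ) + 1)) (by positivity))
  exact ⟨hf.memLp, fun n => (h n).1, _, fun n => (h n).2⟩

theorem nonlocal_translate {d : ℕ} (κ : Measure (Cyl d)) (f : Cyl d → ℝ) (a w : Cyl d) :
    nonlocal κ (fun w => f (w + a)) w = nonlocal κ f (w + a) := by
  simp only [nonlocal, sub_add_eq_add_sub]

theorem ae_nonlocal_sub {d : ℕ} {κ : Measure (Cyl d)} [IsFiniteMeasure κ] {f g : Cyl d → ℝ}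
    (hf : MemLp f 2) (hg : MemLp g 2) :
    ∀ᵐ w, nonlocal κ (fun w => f w - g w) w = nonlocal κ f w - nonlocal κ g w := by
  filter_upwards [ae_integrable_comp_sub (κ := κ) hf, ae_integrable_comp_sub (κ := κ) hg]
    with w h1 h2
  have h1' : Integrable (fun z => f w - f (w - z)) κ := (integrable_const _).sub h1
  have h2' : Integrable (fun z => g w - g (w - z)) κ := (integrable_const _).sub h2
  rw [nonlocal, nonlocal, nonlocal, ← integral_sub h1' h2']
  congr 1; ext z; ring

namespace IsTruncBounded

variable {d : ℕ} {H : Cover d → ℝ} {f g : Cyl d → ℝ}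

theorem translate (hf : IsTruncBounded H f) (a : Cyl d) :
    IsTruncBounded H (fun w => f (w + a)) := by
  have hmp := measurePreserving_add_right (volume : Measure (Cyl d)) a
  have e : ∀ n, nonlocal (jumpSeq H n) (fun w => f (w + a)) =
      fun w => nonlocal (jumpSeq H n) f (w + a) := fun n => funext (nonlocal_translate _ f a)
  obtain ⟨C, hC⟩ := hf.bound
  refine ⟨hf.memLp.comp_measurePreserving hmp, fun n => ?_, C, fun n => ?_⟩
  · rw [e]; exact (hf.trunc n).comp_measurePreserving hmp
  · rw [e]
    exact (integral_add_right_eq_self (fun w => nonlocal (jumpSeq H n) f w ^ 2) a).trans_le (hC n)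

theorem sub (hd : 1 ≤ d) (hH : KernelAssumptions d H) (hf : IsTruncBounded H f)
    (hg : IsTruncBounded H g) : IsTruncBounded H (fun w => f w - g w) := by
  obtain ⟨C, hC⟩ := hf.bound
  obtain ⟨C', hC'⟩ := hg.bound
  have e : ∀ n, nonlocal (jumpSeq H n) (fun w => f w - g w) =ᵐ[volume]
      fun w => nonlocal (jumpSeq H n) f w - nonlocal (jumpSeq H n) g w := fun n =>
    have := isFiniteMeasure_jumpSeq hd hH n
    ae_nonlocal_sub hf.memLp hg.memLp
  refine ⟨hf.memLp.sub hg.memLp, fun n => ?_, 2 * C + 2 * C', fun n => ?_⟩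
  · exact ((hf.trunc n).sub (hg.trunc n)).ae_eq (e n).symm
  · have i1 := (hf.trunc n).integrable_sq.const_mul 2
    have i2 := (hg.trunc n).integrable_sq.const_mul 2
    calc ∫ w, nonlocal (jumpSeq H n) (fun w => f w - g w) w ^ 2
        = ∫ w, (nonlocal (jumpSeq H n) f w - nonlocal (jumpSeq H n) g w) ^ 2 :=
          integral_congr_ae ((e n).mono fun w hw => by simp only; rw [hw])
      _ ≤ ∫ w, (2 * nonlocal (jumpSeq H n) f w ^ 2 + 2 * nonlocal (jumpSeq H n) g w ^ 2) := by
          refine integral_mono ((hf.trunc n).sub (hg.trunc n)).integrable_sq (i1.add i2) fun w => ?_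
          simp only
          nlinarith [sq_nonneg (nonlocal (jumpSeq H n) f w + nonlocal (jumpSeq H n) g w)]
      _ = 2 * (∫ w, nonlocal (jumpSeq H n) f w ^ 2) +
          2 * ∫ w, nonlocal (jumpSeq H n) g w ^ 2 := by
          rw [integral_add i1 i2, integral_const_mul, integral_const_mul]
      _ ≤ _ := by linarith [hC n, hC' n]

theorem const_mul (hf : IsTruncBounded H f) (c : ℝ) : IsTruncBounded H (fun w => c * f w) := by
  have e : ∀ n, nonlocal (jumpSeq H n) (fun w => c * f w) =
      fun w => c * nonlocal (jumpSeq H n) f w := by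
    intro n; ext w
    simp only [nonlocal, ← mul_sub, integral_const_mul]
  obtain ⟨C, hC⟩ := hf.bound
  refine ⟨hf.memLp.const_mul c, fun n => ?_, c ^ 2 * C, fun n => ?_⟩
  · rw [e]; exact (hf.trunc n).const_mul c
  · rw [e]
    simp only [mul_pow, integral_const_mul]
    exact mul_le_mul_of_nonneg_left (hC n) (sq_nonneg c)

theorem congr (hf : IsTruncBounded H f) (h : ∀ w, f w = g w) : IsTruncBounded H g := by
  rwa [← funext h]

end IsTruncBounded

/-! ### The Liouville inequality -/

/-- The Wronskian is `v v'` times the increment of the ratio, and arctan is increasing. -/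
theorem arctan_wronskian_nonneg {v v' w w' : ℝ} (hv : 0 < v) (hv' : 0 < v') :
    0 ≤ (w * v' - v * w') * (Real.arctan (w / v) - Real.arctan (w' / v')) := by
  have h : w * v' - v * w' = v * v' * (w / v - w' / v') := by field_simp
  rw [h, mul_assoc]
  refine mul_nonneg (mul_pos hv hv').le ?_
  rcases le_total (w / v) (w' / v') with h | h
  · exact mul_nonneg_of_nonpos_of_nonpos (sub_nonpos.2 h)
      (sub_nonpos.2 (Real.arctan_strictMono.monotone h))
  · exact mul_nonneg (sub_nonneg.2 h) (sub_nonneg.2 (Real.arctan_strictMono.monotone h))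

/-- The equality case: arctan is injective, so either factor vanishes only when the two ratios
agree. -/
theorem div_eq_div_of_arctan_wronskian {v v' w w' : ℝ} (hv : 0 < v) (hv' : 0 < v')
    (h0 : (w * v' - v * w') * (Real.arctan (w / v) - Real.arctan (w' / v')) = 0) :
    w / v = w' / v' := by
  rcases mul_eq_zero.1 h0 with h | h
  · rw [div_eq_div_iff hv.ne' hv'.ne']; linarith
  · exact Real.arctan_strictMono.injective (sub_eq_zero.1 h)

theorem abs_arctan_le (x : ℝ) : |Real.arctan x| ≤ 2 := by
  have h1 := Real.neg_pi_div_two_lt_arctan x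
  have h2 := Real.arctan_lt_pi_div_two x
  have h3 := Real.pi_lt_four
  rw [abs_le]; constructor <;> linarith

theorem memLp_arctan_mul {α : Type*} [MeasurableSpace α] {μ : Measure α} {f g h : α → ℝ}
    (hf : AEStronglyMeasurable f μ) (hg : AEStronglyMeasurable g μ) (hh : MemLp h 2 μ) :
    MemLp (fun x => Real.arctan (f x / g x) * h x) 2 μ := by
  refine (hh.const_mul 2).of_le ?_ (ae_of_all _ fun x => ?_)
  · exact (Real.measurable_arctan.comp_aemeasurable
      (hf.aemeasurable.div hg.aemeasurable)).aestronglyMeasurable.mul hh.1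
  · rw [norm_mul, norm_mul, Real.norm_eq_abs]
    exact mul_le_mul_of_nonneg_right ((abs_arctan_le _).trans (by norm_num)) (norm_nonneg _)

/-- If `v > 0` and `w` have limits `Dv`, `Dw` under the truncated operators, then the Dirichlet-type
energy of `w / v` is controlled by the Wronskian `v Dw - w Dv`. -/
theorem wronskian_energy_le {d : ℕ} (hd : 1 ≤ d) {H : Cover d → ℝ} (hH : KernelAssumptions d H)
    {v w Dv Dw : Cyl d → ℝ} (hv : IsTruncBounded H v) (hw : IsTruncBounded H w)
    (hpos : ∀ p, 0 < v p)
    (hDv : ∀ᵐ p, Tendsto (fun n => nonlocal (jumpSeq H n) v p) atTop (𝓝 (Dv p)))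
    (hDw : ∀ᵐ p, Tendsto (fun n => nonlocal (jumpSeq H n) w p) atTop (𝓝 (Dw p))) (n : ℕ) :
    Integrable (fun p : Cyl d × Cyl d => (w p.1 * v (p.1 - p.2) - v p.1 * w (p.1 - p.2)) *
      (Real.arctan (w p.1 / v p.1) - Real.arctan (w (p.1 - p.2) / v (p.1 - p.2))))
      (volume.prod (jumpSeq H n)) ∧
    ∫ p : Cyl d × Cyl d, (w p.1 * v (p.1 - p.2) - v p.1 * w (p.1 - p.2)) *
      (Real.arctan (w p.1 / v p.1) - Real.arctan (w (p.1 - p.2) / v (p.1 - p.2)))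
      ∂(volume.prod (jumpSeq H n)) ≤
    2 * ∫ p, Real.arctan (w p / v p) * (v p * Dw p - w p * Dv p) := by
  set φ : Cyl d → ℝ := fun p => Real.arctan (w p / v p) with hφ
  have hφm : AEStronglyMeasurable φ :=
    (Real.measurable_arctan.comp_aemeasurable
      (hw.memLp.1.aemeasurable.div hv.memLp.1.aemeasurable)).aestronglyMeasurable
  have key : ∀ l, _ := fun l =>
    have := isFiniteMeasure_jumpSeq hd hH l
    integral_mul_wronskian (map_neg_jumpTrunc hH (1 / ((l : ℝ) + 1))) hv.memLp hw.memLp hφm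
      fun p => abs_arctan_le _
  refine ⟨(key n).1, ?_⟩
  have hφv : MemLp (fun p => φ p * v p) 2 := memLp_arctan_mul hw.memLp.1 hv.memLp.1 hv.memLp
  have hφw : MemLp (fun p => φ p * w p) 2 := memLp_arctan_mul hw.memLp.1 hv.memLp.1 hw.memLp
  obtain ⟨Cv, hCv⟩ := hv.bound
  obtain ⟨Cw, hCw⟩ := hw.bound
  have hDv2 := (memLp_two_of_tendsto_ae hv.trunc hCv hDv).1
  have hDw2 := (memLp_two_of_tendsto_ae hw.trunc hCw hDw).1
  have l1 := tendsto_integral_mul_of_tendsto_ae hw.trunc hCw hDw hφv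
  have l2 := tendsto_integral_mul_of_tendsto_ae hv.trunc hCv hDv hφw
  have e : ∀ (D D' : Cyl d → ℝ), MemLp D 2 → MemLp D' 2 →
      ∫ p, φ p * (v p * D p - w p * D' p) =
        (∫ p, D p * (φ p * v p)) - ∫ p, D' p * (φ p * w p) := by
    intro D D' h1 h2
    have i1 : Integrable fun p => D p * (φ p * v p) := h1.integrable_mul hφv
    have i2 : Integrable fun p => D' p * (φ p * w p) := h2.integrable_mul hφw
    rw [← integral_sub i1 i2]
    congr 1; ext p; ring
  have l3 := (l1.sub l2).const_mul 2
  rw [← e _ _ hDw2 hDv2] at l3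
  -- For `l ≥ n` the jump measure is larger and the integrand nonnegative, so the energy at
  -- truncation `n` is at most the one at `l`. The latter equals a tested Wronskian, which converges
  -- as `l → ∞`.
  refine ge_of_tendsto l3 (eventually_atTop.2 ⟨n, fun l hl => ?_⟩)
  rw [← e _ _ (hw.trunc l) (hv.trunc l), (key l).2, ← mul_assoc]
  norm_num only [one_mul]
  refine integral_mono_measure ?_ ?_ (key l).1
  · have := isFiniteMeasure_jumpSeq hd hH l
    exact Measure.prod_mono le_rfl (jumpSeq_mono hl)
  · exact ae_of_all _ fun p => arctan_wronskian_nonneg (hpos _) (hpos _)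

theorem ae_eq_zero_of_tendsto_of_integral_le {α : Type*} [MeasurableSpace α] {μ : Measure α}
    {Φ : ℕ → α → ℝ} {Φ₀ : α → ℝ} {E : ℕ → ℝ} (hΦ : ∀ n, Integrable (Φ n) μ)
    (hnn : ∀ n x, 0 ≤ Φ n x) (hE : ∀ n, ∫ x, Φ n x ∂μ ≤ E n) (hE0 : Tendsto E atTop (𝓝 0))
    (hlim : ∀ᵐ x ∂μ, Tendsto (fun n => Φ n x) atTop (𝓝 (Φ₀ x))) : ∀ᵐ x ∂μ, Φ₀ x = 0 := by
  have h1 : ∫⁻ x, ENNReal.ofReal (Φ₀ x) ∂μ ≤ 0 := by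
    calc ∫⁻ x, ENNReal.ofReal (Φ₀ x) ∂μ
        = ∫⁻ x, liminf (fun n => ENNReal.ofReal (Φ n x)) atTop ∂μ := by
          refine lintegral_congr_ae (hlim.mono fun x hx => ?_)
          exact (((ENNReal.continuous_ofReal.tendsto _).comp hx).liminf_eq).symm
      _ ≤ liminf (fun n => ∫⁻ x, ENNReal.ofReal (Φ n x) ∂μ) atTop :=
          lintegral_liminf_le' fun n => (hΦ n).1.aemeasurable.ennreal_ofReal
      _ ≤ liminf (fun n => ENNReal.ofReal (E n)) atTop := by
          refine liminf_le_liminf (Eventually.of_forall fun n => ?_)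
          rw [← ofReal_integral_eq_lintegral_ofReal (hΦ n) (ae_of_all _ (hnn n))]
          exact ENNReal.ofReal_le_ofReal (hE n)
      _ = 0 := by
          have := ((ENNReal.continuous_ofReal.tendsto _).comp hE0).liminf_eq
          exact this.trans (by simp)
  have hm : AEStronglyMeasurable Φ₀ μ :=
    aestronglyMeasurable_of_tendsto_ae _ (fun n => (hΦ n).1) hlim
  rw [nonpos_iff_eq_zero, lintegral_eq_zero_iff' hm.aemeasurable.ennreal_ofReal] at h1
  filter_upwards [h1, hlim] with x h2 h3
  refine le_antisymm (ENNReal.ofReal_eq_zero.1 h2) (ge_of_tendsto' h3 fun n => hnn n x)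

/-! ### Layer solutions -/

namespace IsLayerSolution

variable {d : ℕ} {H : Cover d → ℝ} {γ η : ℝ → ℝ} {u : Cyl d → ℝ}

theorem strictMono (h : IsLayerSolution H γ u) (y : Fin (d - 1) → UnitAddCircle) :
    StrictMono fun x => u (x, y) :=
  strictMono_of_deriv_pos fun x => h.deriv_pos x y

theorem continuous_fst (h : IsLayerSolution H γ u) (y : Fin (d - 1) → UnitAddCircle) :
    Continuous fun x => u (x, y) :=
  Differentiable.continuous fun x => h.differentiable x y

theorem mem_Icc (h : IsLayerSolution H γ u) (w : Cyl d) : u w ∈ Set.Icc (-1 : ℝ) 1 :=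
  ⟨(h.strictMono w.2).monotone.le_of_tendsto (h.tendsto_bot w.2) w.1,
    (h.strictMono w.2).monotone.ge_of_tendsto (h.tendsto_top w.2) w.1⟩

theorem abs_le_one (h : IsLayerSolution H γ u) (w : Cyl d) : |u w| ≤ 1 :=
  abs_le.2 (h.mem_Icc w)

theorem ae_tendsto_nonlocal (hd : 1 ≤ d) (hH : KernelAssumptions d H)
    (h : IsLayerSolution H γ u) :
    ∀ᵐ w, Tendsto (fun n => nonlocal (jumpSeq H n) u w) atTop (𝓝 (-deriv γ (u w))) := by
  filter_upwards [h.solves] with w ⟨l, hl, hl0⟩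
  rw [← eq_neg_of_add_eq_zero_left hl0]
  exact hl.tendsto hd hH

end IsLayerSolution

namespace IsProfile

variable {d : ℕ} {η : ℝ → ℝ}

theorem deriv_eq_zero (hη : IsProfile η) {x : ℝ} (hx : x ∉ Set.Icc (-1 : ℝ) 1) :
    deriv η x = 0 := by
  rw [Set.mem_Icc, not_and_or, not_le, not_le] at hx
  rcases hx with hx | hx
  · have : η =ᶠ[𝓝 x] fun _ => -1 := (eventually_lt_nhds hx).mono fun t ht => hη.left t ht.le
    rw [this.deriv_eq, deriv_const]
  · have : η =ᶠ[𝓝 x] fun _ => 1 := (eventually_gt_nhds hx).mono fun t ht => hη.right t ht.le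
    rw [this.deriv_eq, deriv_const]

theorem exists_lipschitz (hη : IsProfile η) : ∃ L, 0 ≤ L ∧ ∀ x y, |η x - η y| ≤ L * |x - y| := by
  have hc : Continuous (deriv η) := hη.smooth.continuous_deriv (by simp)
  obtain ⟨L, hL⟩ := (isCompact_Icc (a := (-1 : ℝ)) (b := 1)).exists_bound_of_continuousOn
    hc.continuousOn
  have hL' : ∀ x, ‖deriv η x‖ ≤ max L 0 := fun x => by
    by_cases hx : x ∈ Set.Icc (-1 : ℝ) 1
    · exact (hL x hx).trans (le_max_left _ _)
    · rw [hη.deriv_eq_zero hx, norm_zero]; exact le_max_right _ _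
  refine ⟨max L 0, le_max_right _ _, fun x y => ?_⟩
  exact convex_univ.norm_image_sub_le_of_norm_deriv_le
    (fun x _ => (hη.smooth.differentiable (by simp)) x) (fun x _ => hL' x)
    (Set.mem_univ y) (Set.mem_univ x)

theorem exists_bound (hη : IsProfile η) : ∃ C, ∀ x, |η x| ≤ C := by
  obtain ⟨L, hL⟩ := (isCompact_Icc (a := (-1 : ℝ)) (b := 1)).exists_bound_of_continuousOn
    hη.smooth.continuous.continuousOn
  refine ⟨max L 1, fun x => ?_⟩
  by_cases hx : x ∈ Set.Icc (-1 : ℝ) 1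
  · exact (hL x hx).trans (le_max_left _ _)
  · rw [Set.mem_Icc, not_and_or, not_le, not_le] at hx
    rcases hx with hx | hx
    · simp [hη.left x hx.le]
    · simp [hη.right x hx.le]

theorem translate_sub_eq_zero (hη : IsProfile η) {t x : ℝ} (hx : 1 + |t| < |x|) :
    η (x + t) - η x = 0 := by
  have h1 := neg_abs_le t
  have h2 := le_abs_self t
  have h3 := abs_nonneg t
  rcases le_total 0 x with h | h
  · rw [abs_of_nonneg h] at hx
    rw [hη.right _ (by linarith), hη.right _ (by linarith), sub_self]
  · rw [abs_of_nonpos h] at hx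
    rw [hη.left _ (by linarith), hη.left _ (by linarith), sub_self]

theorem exists_isSpectral_translate_sub (hη : IsProfile η) (t : ℝ) :
    ∃ m : Measure (Freq d), IsSpectral (fun w : Cyl d => η (w.1 + t) - η w.1) m := by
  refine exists_isSpectral_fst (θ := fun x => η (x + t) - η x)
    ((hη.smooth.comp (contDiff_id.add contDiff_const)).sub hη.smooth) ?_
  refine HasCompactSupport.intro (isCompact_closedBall (0 : ℝ) (1 + |t|)) fun x hx => ?_
  rw [mem_closedBall_zero_iff, not_le, Real.norm_eq_abs] at hx
  exact hη.translate_sub_eq_zero hx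

end IsProfile

section Perturbation

variable {d : ℕ} {H : Cover d → ℝ} {γ η : ℝ → ℝ} {u : Cyl d → ℝ} {m : Measure (Freq d)}

/-- Splits `u` into `u - η` and `η`; the two signs put the sum in the shape required by
`IsTruncBounded.sub`. -/
theorem diffQuot_profile_add (b : Cover d) (n : ℕ) (w : Cyl d) :
    diffQuot b n u w = diffQuot b n (fun w => u w - η w.1) w -
      -((n : ℝ) + 1) * (η (w.1 + 1 / ((n : ℝ) + 1) * b.1) - η w.1) := by
  simp only [diffQuot, proj, Prod.fst_add, Prod.smul_fst, smul_eq_mul]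
  ring

/-- Although `u` is not in `L²`, its increments are: those of `u - η` inherit a bound from the
spectral measure, and those of `η` are smooth functions of `x` with compact support. -/
theorem isTruncBounded_diffQuot (hd : 1 ≤ d) (hH : KernelAssumptions d H) (hη : IsProfile η)
    (hf : IsSpectral (fun w : Cyl d => u w - η w.1) m) (b : Cover d) (n : ℕ) :
    IsTruncBounded H (diffQuot b n u) := by
  have h1 := hf.isTruncBounded hd hH
  have h2 := ((h1.translate (proj ((1 / ((n : ℝ) + 1)) • b))).sub hd hH h1).const_mul (n + 1)
  obtain ⟨m', hm'⟩ := hη.exists_isSpectral_translate_sub (d := d) (1 / ((n : ℝ) + 1) * b.1)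
  have h3 := (hm'.isTruncBounded hd hH).const_mul (-((n : ℝ) + 1))
  exact (h2.sub hd hH h3).congr fun w => (diffQuot_profile_add b n w).symm

theorem aestronglyMeasurable_of_isSpectral (hη : IsProfile η)
    (hf : IsSpectral (fun w : Cyl d => u w - η w.1) m) : AEStronglyMeasurable u := by
  have h := hf.memLp.1.add (hη.smooth.continuous.comp continuous_fst).aestronglyMeasurable
  refine h.congr (ae_of_all _ fun w => ?_)
  simp

theorem ae_integrable_jump (hη : IsProfile η) (hf : IsSpectral (fun w : Cyl d => u w - η w.1) m)
    (κ : Measure (Cyl d)) [IsFiniteMeasure κ] :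
    ∀ᵐ w, Integrable (fun z => u (w - z)) κ := by
  obtain ⟨C, hC⟩ := hη.exists_bound
  filter_upwards [ae_integrable_comp_sub (κ := κ) hf.memLp] with w hw
  have h2 : Integrable (fun z : Cyl d => η (w - z).1) κ :=
    Integrable.of_bound (hη.smooth.continuous.comp
      (continuous_fst.comp (continuous_const.sub continuous_id))).aestronglyMeasurable C
      (ae_of_all _ fun z => hC _)
  exact (hw.add h2).congr (ae_of_all _ fun z => by simp)

/-- Subtract the equation at `w` from the equation at `w + a`. The truncated integrals split because
`u` is the sum of an `L²` function and a bounded one, hence almost surely integrable along finite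
jump measures. -/
theorem ae_tendsto_nonlocal_diffQuot (hd : 1 ≤ d) (hH : KernelAssumptions d H)
    (hη : IsProfile η) (hf : IsSpectral (fun w : Cyl d => u w - η w.1) m)
    (hu : IsLayerSolution H γ u) (b : Cover d) (n : ℕ) :
    ∀ᵐ w, Tendsto (fun l => nonlocal (jumpSeq H l) (diffQuot b n u) w) atTop
      (𝓝 (-diffQuot b n (fun w => deriv γ (u w)) w)) := by
  set a : Cyl d := proj ((1 / ((n : ℝ) + 1)) • b) with ha
  have hq := (measurePreserving_add_right (volume : Measure (Cyl d)) a).quasiMeasurePreserving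
  have hi : ∀ᵐ w, ∀ l, Integrable (fun z => u (w - z)) (jumpSeq H l) :=
    ae_all_iff.2 fun l =>
      have := isFiniteMeasure_jumpSeq hd hH l
      ae_integrable_jump hη hf _
  filter_upwards [hi, hq.ae hi, hu.ae_tendsto_nonlocal hd hH,
    hq.ae (hu.ae_tendsto_nonlocal hd hH)] with w h1 h2 h3 h4
  have h5 := (h4.sub h3).const_mul ((n : ℝ) + 1)
  have e : -diffQuot b n (fun w => deriv γ (u w)) w =
      ((n : ℝ) + 1) * (-deriv γ (u (w + a)) - -deriv γ (u w)) := by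
    simp only [diffQuot, ← ha]; ring
  rw [e]
  refine h5.congr fun l => ?_
  have := isFiniteMeasure_jumpSeq hd hH l
  have i1 : Integrable (fun z => u (w + a) - u (w + a - z)) (jumpSeq H l) :=
    (integrable_const _).sub (h2 l)
  have i2 : Integrable (fun z => u w - u (w - z)) (jumpSeq H l) :=
    (integrable_const _).sub (h1 l)
  rw [nonlocal, nonlocal, nonlocal, ← integral_sub i1 i2, ← integral_const_mul]
  congr 1; ext z
  simp only [diffQuot, ← ha, sub_add_eq_add_sub]
  ring

theorem exists_bound_profile_diffQuot (hη : IsProfile η) : ∃ C, ∀ n : ℕ,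
    ∫ w : Cyl d, (((n : ℝ) + 1) * (η (w.1 + 1 / ((n : ℝ) + 1)) - η w.1)) ^ 2 ≤ C := by
  obtain ⟨L, hL0, hL⟩ := hη.exists_lipschitz
  -- The step is at most `1`, so increments of `η` vanish outside `|x| ≤ 2`; inside, the Lipschitz
  -- constant bounds the quotients.
  set S : Set (Cyl d) := Set.Icc (-2 : ℝ) 2 ×ˢ Set.univ with hS
  have hSm : MeasurableSet S := measurableSet_Icc.prod MeasurableSet.univ
  have hSf : volume S ≠ ⊤ := by
    rw [hS, Measure.volume_eq_prod, Measure.prod_prod, measure_univ, mul_one, Real.volume_Icc]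
    exact ENNReal.ofReal_ne_top
  refine ⟨∫ w, S.indicator (fun _ => L ^ 2) w, fun n => ?_⟩
  refine integral_mono_of_nonneg (ae_of_all _ fun w => sq_nonneg _)
    ((integrable_indicator_iff hSm).2 (integrableOn_const hSf)) (ae_of_all _ fun w => ?_)
  have hn : (0 : ℝ) < (n : ℝ) + 1 := by positivity
  by_cases hw : w ∈ S
  · rw [Set.indicator_of_mem hw]
    refine sq_le_sq' ?_ ?_ <;>
    · have h := hL (w.1 + 1 / ((n : ℝ) + 1)) w.1
      rw [add_sub_cancel_left, abs_of_pos (by positivity : 0 < 1 / ((n : ℝ) + 1)), mul_one_div,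
        le_div_iff₀ hn] at h
      rw [mul_comm]
      have h' := abs_le.1 ((abs_mul _ _).trans_le
        ((mul_le_mul_of_nonneg_left (abs_of_pos hn).le (abs_nonneg _)).trans h))
      linarith [h'.1, h'.2]
  · have h1 : |1 / ((n : ℝ) + 1)| ≤ 1 := by
      rw [abs_of_pos (by positivity), div_le_one hn]; linarith [(Nat.cast_nonneg n : (0 : ℝ) ≤ n)]
    have h2 : 2 < |w.1| := by
      by_contra hc
      rw [not_lt, abs_le] at hc
      exact hw ⟨hc, trivial⟩
    rw [Set.indicator_of_notMem hw]
    simp only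
    rw [hη.translate_sub_eq_zero (by linarith), mul_zero, zero_pow two_ne_zero]

theorem exists_bound_diffQuot_axial (hd : 1 ≤ d) (hη : IsProfile η)
    (hf : IsSpectral (fun w : Cyl d => u w - η w.1) m) :
    ∃ C, ∀ n : ℕ, ∫ w, diffQuot ((1, 0) : Cover d) n u w ^ 2 ≤ C := by
  obtain ⟨C, hC⟩ := exists_bound_profile_diffQuot (d := d) hη
  refine ⟨2 * ((2 * Real.pi * (d * ‖((1, 0) : Cover d)‖)) ^ 2 *
    ∫ ν, freqNorm ν.1 ν.2 ^ 2 ∂m) + 2 * C, fun n => ?_⟩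
  obtain ⟨m', hm'⟩ := hη.exists_isSpectral_translate_sub (d := d) (1 / ((n : ℝ) + 1))
  have i1 := hf.memLp_diffQuot (1, 0) n
  have i2 := hm'.memLp.const_mul ((n : ℝ) + 1)
  have j1 := i1.integrable_sq.const_mul 2
  have j2 := i2.integrable_sq.const_mul 2
  calc ∫ w, diffQuot ((1, 0) : Cover d) n u w ^ 2
      ≤ ∫ w, (2 * diffQuot ((1, 0) : Cover d) n (fun w => u w - η w.1) w ^ 2 +
          2 * (((n : ℝ) + 1) * (η (w.1 + 1 / ((n : ℝ) + 1)) - η w.1)) ^ 2) := by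
        refine integral_mono_of_nonneg (ae_of_all _ fun w => sq_nonneg _) (j1.add j2)
          (ae_of_all _ fun w => ?_)
        simp only
        rw [diffQuot_profile_add (η := η), mul_one]
        nlinarith [sq_nonneg (diffQuot ((1, 0) : Cover d) n (fun w => u w - η w.1) w -
          ((n : ℝ) + 1) * (η (w.1 + 1 / ((n : ℝ) + 1)) - η w.1))]
    _ = 2 * (∫ w, diffQuot ((1, 0) : Cover d) n (fun w => u w - η w.1) w ^ 2) +
          2 * ∫ w : Cyl d, (((n : ℝ) + 1) * (η (w.1 + 1 / ((n : ℝ) + 1)) - η w.1)) ^ 2 := by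
        rw [integral_add j1 j2, integral_const_mul, integral_const_mul]
    _ ≤ _ :=
        add_le_add (mul_le_mul_of_nonneg_left (hf.integral_diffQuot_sq_le hd (1, 0) n) two_pos.le)
          (mul_le_mul_of_nonneg_left (hC n) two_pos.le)

end Perturbation

/-! ### The Liouville argument -/

theorem exists_subseq_tendsto_ae {α : Type*} [MeasurableSpace α] {μ : Measure α} {w : ℕ → α → ℝ}
    {w₀ : α → ℝ} (hw : ∀ n, MemLp (w n) 2 μ) (hw₀ : MemLp w₀ 2 μ)
    (hlim : Tendsto (fun n => ∫ x, (w n x - w₀ x) ^ 2 ∂μ) atTop (𝓝 0)) :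
    ∃ ns : ℕ → ℕ, StrictMono ns ∧
      ∀ᵐ x ∂μ, Tendsto (fun k => w (ns k) x) atTop (𝓝 (w₀ x)) := by
  have hD : ∀ n, MemLp (fun x => w n x - w₀ x) 2 μ := fun n => (hw n).sub hw₀
  have h1 : TendstoInMeasure μ (fun n x => (w n x - w₀ x) ^ 2) atTop (fun _ => (0 : ℝ)) := by
    refine tendstoInMeasure_of_tendsto_eLpNorm one_ne_zero (fun n => (hD n).1.pow 2)
      aestronglyMeasurable_const ?_
    have h2 := (ENNReal.continuous_ofReal.tendsto _).comp hlim
    rw [ENNReal.ofReal_zero] at h2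
    refine h2.congr fun n => ?_
    rw [eLpNorm_one_eq_lintegral_enorm, Function.comp_apply,
      ofReal_integral_eq_lintegral_ofReal (hD n).integrable_sq (ae_of_all _ fun x => sq_nonneg _)]
    refine lintegral_congr fun x => ?_
    rw [Pi.sub_apply, sub_zero, Real.enorm_of_nonneg (sq_nonneg _)]
  obtain ⟨ns, hns, h3⟩ := h1.exists_seq_tendsto_ae
  refine ⟨ns, hns, h3.mono fun x hx => ?_⟩
  have h4 := hx.sqrt
  simp only [Real.sqrt_sq_eq_abs, Real.sqrt_zero] at h4
  have h5 := (tendsto_zero_iff_abs_tendsto_zero _).2 h4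
  simpa using h5.add_const (w₀ x)

/-- Split `e n * w n` into `e n * (w n - w₀)`, small because `e n` is bounded, and `e n * w₀`, small
by dominated convergence. -/
theorem tendsto_integral_mul_sq {α : Type*} [MeasurableSpace α] {μ : Measure α}
    {e w : ℕ → α → ℝ} {w₀ : α → ℝ} {K : ℝ} (he : ∀ n, AEStronglyMeasurable (e n) μ)
    (hK : ∀ n x, |e n x| ≤ K) (he0 : ∀ᵐ x ∂μ, Tendsto (fun n => e n x) atTop (𝓝 0))
    (hw : ∀ n, MemLp (w n) 2 μ) (hw₀ : MemLp w₀ 2 μ)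
    (hlim : Tendsto (fun n => ∫ x, (w n x - w₀ x) ^ 2 ∂μ) atTop (𝓝 0)) :
    Tendsto (fun n => ∫ x, (e n x * w n x) ^ 2 ∂μ) atTop (𝓝 0) := by
  have hsq : ∀ n x, e n x ^ 2 ≤ K ^ 2 := fun n x => by
    rw [← sq_abs]; exact pow_le_pow_left₀ (abs_nonneg _) (hK n x) 2
  have hD : ∀ n, Integrable (fun x => 2 * K ^ 2 * (w n x - w₀ x) ^ 2) μ := fun n =>
    ((hw n).sub hw₀).integrable_sq.const_mul _
  have hm : ∀ n, AEStronglyMeasurable (fun x => (e n x * w₀ x) ^ 2) μ := fun n =>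
    ((he n).mul hw₀.1).pow 2
  have hb : ∀ n x, ‖(e n x * w₀ x) ^ 2‖ ≤ K ^ 2 * w₀ x ^ 2 := fun n x => by
    rw [Real.norm_of_nonneg (sq_nonneg _), mul_pow]
    exact mul_le_mul_of_nonneg_right (hsq n x) (sq_nonneg _)
  have hB : Integrable (fun x => K ^ 2 * w₀ x ^ 2) μ := hw₀.integrable_sq.const_mul _
  have h1 : Tendsto (fun n => ∫ x, (e n x * w₀ x) ^ 2 ∂μ) atTop (𝓝 0) := by
    rw [← integral_zero α ℝ (μ := μ)]
    refine tendsto_integral_of_dominated_convergence _ hm hB (fun n => ae_of_all _ (hb n)) ?_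
    filter_upwards [he0] with x hx
    simpa using (hx.mul_const (w₀ x)).pow 2
  have h2 := (hlim.const_mul (2 * K ^ 2)).add (h1.const_mul 2)
  simp only [mul_zero, add_zero] at h2
  refine squeeze_zero (fun n => integral_nonneg fun x => sq_nonneg _) (fun n => ?_) h2
  have i2 : Integrable (fun x => 2 * (e n x * w₀ x) ^ 2) μ :=
    (hB.mono' (hm n) (ae_of_all _ (hb n))).const_mul 2
  rw [← integral_const_mul, ← integral_const_mul, ← integral_add (hD n) i2]
  refine integral_mono_of_nonneg (ae_of_all _ fun x => sq_nonneg _) ((hD n).add i2)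
    (ae_of_all _ fun x => ?_)
  simp only
  have h3 := mul_le_mul_of_nonneg_right (hsq n x) (sq_nonneg (w n x - w₀ x))
  nlinarith [sq_nonneg (e n x * (w n x - w₀ x) - e n x * w₀ x)]

theorem measurable_dslope {g : ℝ → ℝ} (hg : Measurable g) :
    Measurable fun p : ℝ × ℝ => dslope g p.1 p.2 := by
  have e : (fun p : ℝ × ℝ => dslope g p.1 p.2) =
      fun p => if p.2 = p.1 then deriv g p.1 else (p.2 - p.1)⁻¹ * (g p.2 - g p.1) := by
    ext p
    split_ifs with h
    · rw [h, dslope_same]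
    · rw [dslope_of_ne _ h, slope_def_module, smul_eq_mul]
  rw [e]
  exact Measurable.ite (measurableSet_eq_fun measurable_snd measurable_fst)
    ((measurable_deriv g).comp measurable_fst)
    ((measurable_snd.sub measurable_fst).inv.mul
      ((hg.comp measurable_snd).sub (hg.comp measurable_fst)))

theorem exists_dslope_bound {g : ℝ → ℝ} (hg : ContDiff ℝ ∞ g) (a b : ℝ) :
    ∃ M, ∀ x ∈ Set.Icc a b, ∀ y ∈ Set.Icc a b, |dslope g x y| ≤ M := by
  have hc : Continuous (deriv g) := hg.continuous_deriv (by simp)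
  obtain ⟨M, hM⟩ := (isCompact_Icc (a := a) (b := b)).exists_bound_of_continuousOn
    hc.continuousOn
  refine ⟨M, fun x hx y hy => ?_⟩
  rcases eq_or_ne y x with rfl | h
  · rw [dslope_same]; exact hM _ hy
  · rw [dslope_of_ne _ h, slope_def_field, abs_div, div_le_iff₀ (abs_pos.2 (sub_ne_zero.2 h))]
    exact (convex_Icc a b).norm_image_sub_le_of_norm_deriv_le
      (fun t _ => (hg.differentiable (by simp)) t) hM hx hy

section Liouville

variable {d : ℕ} {H : Cover d → ℝ} {γ η : ℝ → ℝ} {u : Cyl d → ℝ} {m : Measure (Freq d)}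

/-- A discrete chain rule. Since `dslope` equals the derivative on the diagonal, it holds also where
the increment of `u` is zero. -/
theorem diffQuot_comp (g : ℝ → ℝ) (b : Cover d) (n : ℕ) (w : Cyl d) :
    diffQuot b n (fun w => g (u w)) w =
      dslope g (u w) (u (w + proj ((1 / ((n : ℝ) + 1)) • b))) * diffQuot b n u w := by
  have h := sub_smul_dslope g (u w) (u (w + proj ((1 / ((n : ℝ) + 1)) • b)))
  rw [diffQuot, diffQuot, ← h, smul_eq_mul]
  ring

theorem add_proj_axial (w : Cyl d) (t : ℝ) :
    w + proj (t • ((1, 0) : Cover d)) = (w.1 + t, w.2) := by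
  refine Prod.ext (by simp [proj]) (funext fun i => ?_)
  simp [proj]

namespace IsLayerSolution

theorem diffQuot_axial_pos (hu : IsLayerSolution H γ u) (n : ℕ) (w : Cyl d) :
    0 < diffQuot ((1, 0) : Cover d) n u w := by
  rw [diffQuot, add_proj_axial]
  exact mul_pos (by positivity)
    (sub_pos.2 (hu.strictMono w.2 (lt_add_of_pos_right _ (by positivity))))

theorem tendsto_diffQuot_axial (hu : IsLayerSolution H γ u) (w : Cyl d) :
    Tendsto (fun n => diffQuot ((1, 0) : Cover d) n u w) atTop
      (𝓝 (deriv (fun t => u (t, w.2)) w.1)) := by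
  have h1 := hasDerivAt_iff_tendsto_slope_zero.1 (hu.differentiable w.1 w.2).hasDerivAt
  have h2 : Tendsto (fun n : ℕ => 1 / ((n : ℝ) + 1)) atTop (𝓝[≠] 0) :=
    tendsto_nhdsWithin_iff.2 ⟨tendsto_one_div_add_atTop_nhds_zero_nat,
      Eventually.of_forall fun n => (by positivity : 1 / ((n : ℝ) + 1) ≠ 0)⟩
  refine (h1.comp h2).congr fun n => ?_
  simp only [Function.comp_apply, one_div, inv_inv, smul_eq_mul]
  rw [diffQuot, add_proj_axial, one_div]

end IsLayerSolution

/-- The translates in `diffQuot` converge wherever the difference quotients do. -/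
theorem tendsto_of_tendsto_diffQuot {b : Cover d} {ns : ℕ → ℕ} (hns : StrictMono ns) {w : Cyl d}
    {l : ℝ} (h : Tendsto (fun k => diffQuot b (ns k) u w) atTop (𝓝 l)) :
    Tendsto (fun k => u (w + proj ((1 / ((ns k : ℝ) + 1)) • b))) atTop (𝓝 (u w)) := by
  have h1 := (tendsto_one_div_add_atTop_nhds_zero_nat (𝕜 := ℝ)).comp hns.tendsto_atTop
  have h2 := (h1.mul h).add_const (u w)
  rw [zero_mul, zero_add] at h2
  refine h2.congr fun k => ?_
  simp only [Function.comp_apply, diffQuot]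
  have : (ns k : ℝ) + 1 ≠ 0 := by positivity
  field_simp
  ring

/-- Limits in `L²` of difference quotients of a layer solution are multiples of `∂u/∂x`. -/
theorem ae_eq_const_mul_deriv (hd : 1 ≤ d) (hH : KernelAssumptions d H) (hγ : ContDiff ℝ ∞ γ)
    (hη : IsProfile η) (hf : IsSpectral (fun w : Cyl d => u w - η w.1) m)
    (hu : IsLayerSolution H γ u) (b : Cover d) {w₀ : Cyl d → ℝ} (hw₀ : MemLp w₀ 2)
    (hlim : Tendsto (fun n => ∫ w, (diffQuot b n u w - w₀ w) ^ 2) atTop (𝓝 0)) :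
    ∃ c, ∀ᵐ w, w₀ w = c * deriv (fun t => u (t, w.2)) w.1 := by
  have hv := isTruncBounded_diffQuot hd hH hη hf (1, 0)
  have hw := isTruncBounded_diffQuot hd hH hη hf b
  -- Axial quotients converge at every point because `∂u/∂x` exists; the quotients in direction `b`
  -- need a subsequence to converge almost everywhere.
  obtain ⟨ns, hns, hsub⟩ := exists_subseq_tendsto_ae (fun n => (hw n).memLp) hw₀ hlim
  obtain ⟨C, hC⟩ := exists_bound_diffQuot_axial hd hη hf
  have hg : ContDiff ℝ ∞ (deriv γ) := ((contDiff_infty_iff_deriv (𝕜 := ℝ)).1 hγ).2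
  obtain ⟨M, hM⟩ := exists_dslope_bound hg (-1) 1
  have hum := aestronglyMeasurable_of_isSpectral hη hf
  set v : ℕ → Cyl d → ℝ := fun k => diffQuot (1, 0) (ns k) u with hvdef
  set w : ℕ → Cyl d → ℝ := fun k => diffQuot b (ns k) u with hwdef
  set v₀ : Cyl d → ℝ := fun p => deriv (fun t => u (t, p.2)) p.1 with hv₀
  set cc : Cover d → ℕ → Cyl d → ℝ := fun b k p =>
    dslope (deriv γ) (u p) (u (p + proj ((1 / ((ns k : ℝ) + 1)) • b))) with hcc
  have hccm : ∀ b k, AEStronglyMeasurable (cc b k) := fun b k =>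
    ((measurable_dslope hg.continuous.measurable).comp_aemeasurable
      (hum.aemeasurable.prodMk (hum.comp_quasiMeasurePreserving
        (measurePreserving_add_right _ _).quasiMeasurePreserving).aemeasurable)
      ).aestronglyMeasurable
  have hccM : ∀ b k p, |cc b k p| ≤ M := fun b k p => hM _ (hu.mem_Icc _) _ (hu.mem_Icc _)
  have hccl : ∀ b p l, Tendsto (fun k => diffQuot b (ns k) u p) atTop (𝓝 l) →
      Tendsto (fun k => cc b k p) atTop (𝓝 (deriv (deriv γ) (u p))) := by
    intro b p l hl
    have h1 : ContinuousAt (dslope (deriv γ) (u p)) (u p) :=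
      continuousAt_dslope_same.2 (hg.differentiable (by simp) _)
    have h2 := h1.tendsto.comp (tendsto_of_tendsto_diffQuot hns hl)
    rwa [dslope_same] at h2
  have hv0 : ∀ p, Tendsto (fun k => v k p) atTop (𝓝 (v₀ p)) := fun p =>
    (hu.tendsto_diffQuot_axial p).comp hns.tendsto_atTop
  have hvpos : ∀ k p, 0 < v k p := fun k p => hu.diffQuot_axial_pos _ p
  -- The Wronskian source tested with arctan is exactly `v k * e k * w k`. It would vanish if both
  -- discrete coefficients were `γ''(u)`; they do converge to it where `w k` converges.
  set e : ℕ → Cyl d → ℝ := fun k p =>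
    Real.arctan (w k p / v k p) * (cc (1, 0) k p - cc b k p) with he
  have hem : ∀ k, AEStronglyMeasurable (e k) := fun k =>
    (Real.measurable_arctan.comp_aemeasurable ((hw (ns k)).memLp.1.aemeasurable.div
      (hv (ns k)).memLp.1.aemeasurable)).aestronglyMeasurable.mul ((hccm _ k).sub (hccm _ k))
  have heM : ∀ k p, |e k p| ≤ 2 * (M + M) := fun k p => by
    rw [abs_mul]
    exact mul_le_mul (abs_arctan_le (w k p / v k p)) ((norm_sub_le (cc (1, 0) k p) (cc b k p)).trans
      (add_le_add (hccM _ _ _) (hccM _ _ _)))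
      (abs_nonneg _) two_pos.le
  have he0 : ∀ᵐ p, Tendsto (fun k => e k p) atTop (𝓝 0) := by
    filter_upwards [hsub] with p hp
    have h1 := (hccl (1, 0) p _ (hv0 p)).sub (hccl b p _ hp)
    rw [sub_self] at h1
    exact bdd_le_mul_tendsto_zero' 2 (Eventually.of_forall fun k =>
      abs_arctan_le (w k p / v k p)) h1
  have hE := tendsto_integral_mul_sq hem heM he0 (fun k => (hw (ns k)).memLp) hw₀
    (hlim.comp hns.tendsto_atTop)
  have hew : ∀ k, MemLp (fun p => e k p * w k p) 2 := fun k => by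
    refine ((hw (ns k)).memLp.const_mul (2 * (M + M))).of_le
      ((hem k).mul (hw (ns k)).memLp.1) (ae_of_all _ fun p => ?_)
    have h1 := mul_le_mul_of_nonneg_right ((heM k p).trans (le_abs_self _)) (abs_nonneg (w k p))
    rwa [← abs_mul, ← abs_mul] at h1
  -- Only a bound on `v k` in `L²` is used here: strong convergence of `w k` already sends `e k * w
  -- k` to zero in `L²`.
  have hR : Tendsto (fun k => 2 * (√C * √(∫ p, (e k p * w k p) ^ 2))) atTop (𝓝 0) := by
    simpa using (hE.sqrt.const_mul √C).const_mul 2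
  have henergy : ∀ N k, _ := fun N k =>
    wronskian_energy_le hd hH (hv (ns k)) (hw (ns k)) (hvpos k)
      (ae_tendsto_nonlocal_diffQuot hd hH hη hf hu (1, 0) (ns k))
      (ae_tendsto_nonlocal_diffQuot hd hH hη hf hu b (ns k)) N
  have hrhs : ∀ k, 2 * (∫ p, Real.arctan (w k p / v k p) *
      (v k p * -diffQuot b (ns k) (fun p => deriv γ (u p)) p -
        w k p * -diffQuot (1, 0) (ns k) (fun p => deriv γ (u p)) p)) ≤
      2 * (√C * √(∫ p, (e k p * w k p) ^ 2)) := by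
    intro k
    refine mul_le_mul_of_nonneg_left ?_ two_pos.le
    calc _ = ∫ p, v k p * (e k p * w k p) := by
          congr 1; ext p
          rw [diffQuot_comp, diffQuot_comp]
          simp only [he, hcc, hvdef, hwdef]
          ring
      _ ≤ √(∫ p, v k p ^ 2) * √(∫ p, (e k p * w k p) ^ 2) :=
          (le_abs_self _).trans (abs_integral_mul_le (hv (ns k)).memLp (hew k))
      _ ≤ _ := mul_le_mul_of_nonneg_right (Real.sqrt_le_sqrt (hC _)) (Real.sqrt_nonneg _)
  have hv₀pos : ∀ p, 0 < v₀ p := fun p => hu.deriv_pos p.1 p.2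
  have hprod : ∀ N, ∀ᵐ p : Cyl d × Cyl d ∂(volume.prod (jumpSeq H N)),
      w₀ p.1 / v₀ p.1 = w₀ (p.1 - p.2) / v₀ (p.1 - p.2) := by
    intro N
    have := isFiniteMeasure_jumpSeq hd hH N
    have hs1 := (Measure.quasiMeasurePreserving_fst (μ := (volume : Measure (Cyl d)))
      (ν := jumpSeq H N)).ae hsub
    have hs2 := (Measure.quasiMeasurePreserving_fst.comp
      (measurePreserving_sub_prod_id (volume : Measure (Cyl d))
        (jumpSeq H N)).quasiMeasurePreserving).ae hsub
    have hdiv : ∀ p, Tendsto (fun k => w k p) atTop (𝓝 (w₀ p)) →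
        Tendsto (fun k => Real.arctan (w k p / v k p)) atTop (𝓝 (Real.arctan (w₀ p / v₀ p))) :=
      fun p hp => (Real.continuous_arctan.tendsto _).comp (hp.div (hv0 p) (hv₀pos p).ne')
    -- Fatou at a fixed truncation `N`: the energies tend to zero, so the limiting nonnegative
    -- integrand vanishes.
    have h0 := ae_eq_zero_of_tendsto_of_integral_le (fun k => (henergy N k).1)
      (fun k p => arctan_wronskian_nonneg (hvpos _ _) (hvpos _ _))
      (fun k => (henergy N k).2.trans (hrhs k)) hR
      (Φ₀ := fun p => (w₀ p.1 * v₀ (p.1 - p.2) - v₀ p.1 * w₀ (p.1 - p.2)) *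
        (Real.arctan (w₀ p.1 / v₀ p.1) - Real.arctan (w₀ (p.1 - p.2) / v₀ (p.1 - p.2)))) (by
      filter_upwards [hs1, hs2] with p h1 h2
      exact ((h1.mul (hv0 _)).sub ((hv0 _).mul h2)).mul ((hdiv _ h1).sub (hdiv _ h2)))
    exact h0.mono fun p hp => div_eq_div_of_arctan_wronskian (hv₀pos _) (hv₀pos _) hp
  have hall : ∀ᵐ p : Cyl d, ∀ N, ∀ᵐ z ∂(jumpSeq H N),
      w₀ p / v₀ p = w₀ (p - z) / v₀ (p - z) := by
    refine ae_all_iff.2 fun N => ?_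
    have := isFiniteMeasure_jumpSeq hd hH N
    exact Measure.ae_ae_of_ae_prod (hprod N)
  -- One base point suffices: by positivity of the kernel, almost every `z` for all truncated jump
  -- measures means almost every `z` for volume, so almost every point is compared with `p`.
  obtain ⟨p, hp⟩ := hall.exists
  have hz := ae_of_forall_ae_jumpTrunc hH hp
  refine ⟨w₀ p / v₀ p, ?_⟩
  have hq := (Measure.measurePreserving_sub_left
    (volume : Measure (Cyl d)) p).quasiMeasurePreserving
  filter_upwards [hq.ae hz] with q hq
  rw [sub_sub_cancel] at hq
  rw [hq, div_mul_cancel₀ _ (hv₀pos q).ne']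

end Liouville

/-! ### One-dimensional symmetry -/

/-- Iterating a translation `k` times increases the `L²` modulus of continuity at most `k`-fold. -/
theorem integral_translate_nsmul_sq_le {G : Type*} [AddCommGroup G] [MeasurableSpace G]
    [MeasurableAdd G] {μ : Measure G} [μ.IsAddRightInvariant] {f : G → ℝ} (hf : MemLp f 2 μ)
    (a : G) (k : ℕ) :
    ∫ w, (f (w + k • a) - f w) ^ 2 ∂μ ≤ (k : ℝ) ^ 2 * ∫ w, (f (w + a) - f w) ^ 2 ∂μ := by
  have ht : ∀ a, MemLp (fun w => f (w + a) - f w) 2 μ := fun a =>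
    (hf.comp_measurePreserving (measurePreserving_add_right μ a)).sub hf
  set I := ∫ w, (f (w + a) - f w) ^ 2 ∂μ with hI
  have hI0 : 0 ≤ I := integral_nonneg fun w => sq_nonneg _
  induction k with
  | zero => simp
  | succ k ih =>
    rcases Nat.eq_zero_or_pos k with rfl | hk
    · simp [hI]
    have hk' : (0 : ℝ) < k := Nat.cast_pos.2 hk
    have e : ∫ w, (f (w + a + k • a) - f (w + a)) ^ 2 ∂μ = ∫ w, (f (w + k • a) - f w) ^ 2 ∂μ :=
      integral_add_right_eq_self (fun w => (f (w + k • a) - f w) ^ 2) a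
    have i1 : Integrable (fun w => ((k : ℝ) + 1) * (f (w + a + k • a) - f (w + a)) ^ 2) μ :=
      ((ht (k • a)).comp_measurePreserving
        (measurePreserving_add_right μ a)).integrable_sq.const_mul _
    have i2 : Integrable (fun w => (k : ℝ) * (k + 1) * (f (w + a) - f w) ^ 2) μ :=
      (ht a).integrable_sq.const_mul _
    -- Integrated form of `k (a + b)² ≤ (k + 1) a² + k (k + 1) b²`, whose defect is `(a - k b)²`.
    -- The right side totals `k (k + 1)² I`; dividing by `k` requires `k = 0` to be treated before.
    have h : (k : ℝ) * ∫ w, (f (w + (k + 1) • a) - f w) ^ 2 ∂μ ≤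
        (k + 1) * (k ^ 2 * I) + k * (k + 1) * I := by
      calc (k : ℝ) * ∫ w, (f (w + (k + 1) • a) - f w) ^ 2 ∂μ
          = ∫ w, k * (f (w + (k + 1) • a) - f w) ^ 2 ∂μ := (integral_const_mul _ _).symm
        _ ≤ ∫ w, (((k : ℝ) + 1) * (f (w + a + k • a) - f (w + a)) ^ 2 +
              k * (k + 1) * (f (w + a) - f w) ^ 2) ∂μ := by
            refine integral_mono ((ht _).integrable_sq.const_mul _) (i1.add i2) fun w => ?_
            have e2 : w + (k + 1) • a = w + a + k • a := by rw [succ_nsmul]; abel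
            simp only [e2]
            nlinarith [sq_nonneg ((f (w + a + k • a) - f (w + a)) - k * (f (w + a) - f w))]
        _ = (k + 1) * (∫ w, (f (w + k • a) - f w) ^ 2 ∂μ) + k * (k + 1) * I := by
            rw [integral_add i1 i2, integral_const_mul, integral_const_mul, e]
        _ ≤ _ := by gcongr
    push_cast
    refine le_of_mul_le_mul_left (h.trans (le_of_eq ?_)) hk'
    ring

section Symmetry

variable {d : ℕ} {H : Cover d → ℝ} {γ η : ℝ → ℝ} {u : Cyl d → ℝ} {m : Measure (Freq d)}

theorem diffQuot_transversal (b : Fin (d - 1) → ℝ) (n : ℕ) (w : Cyl d) :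
    diffQuot ((0, b) : Cover d) n (fun w => u w - η w.1) w = diffQuot (0, b) n u w := by
  simp [diffQuot, proj]

/-- The slab `[0,1] × 𝕋^(d-1)`. -/
def slab (d : ℕ) : Set (Cyl d) := Set.Icc (0 : ℝ) 1 ×ˢ Set.univ

theorem measurableSet_slab : MeasurableSet (slab d) := measurableSet_Icc.prod MeasurableSet.univ

theorem volume_slab : volume (slab d) = 1 := by
  rw [slab, Measure.volume_eq_prod, Measure.prod_prod, measure_univ, mul_one, Real.volume_Icc]
  simp

/-- Translations along the torus preserve the slab, and `u` is integrable on it. -/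
theorem setIntegral_slab_diffQuot (hum : AEStronglyMeasurable u) (hu1 : ∀ w, |u w| ≤ 1)
    (b : Fin (d - 1) → ℝ) (n : ℕ) : ∫ w in slab d, diffQuot ((0, b) : Cover d) n u w = 0 := by
  set a : Cyl d := proj ((1 / ((n : ℝ) + 1)) • ((0, b) : Cover d)) with ha
  have ha1 : a.1 = 0 := by simp [ha, proj]
  have hfin : volume (slab d) ≠ ⊤ := by rw [volume_slab]; exact ENNReal.one_ne_top
  have hmp := measurePreserving_add_right (volume : Measure (Cyl d)) a
  have i1 : IntegrableOn u (slab d) :=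
    Measure.integrableOn_of_bounded hfin hum (ae_of_all _ hu1)
  have i2 : IntegrableOn (fun w => u (w + a)) (slab d) :=
    Measure.integrableOn_of_bounded hfin
      (hum.comp_quasiMeasurePreserving hmp.quasiMeasurePreserving) (ae_of_all _ fun w => hu1 _)
  have e : ∫ w in slab d, u (w + a) = ∫ w in slab d, u w := by
    rw [← integral_indicator measurableSet_slab, ← integral_indicator measurableSet_slab,
      ← integral_add_right_eq_self ((slab d).indicator u) a]
    congr 1; ext w
    have : w + a ∈ slab d ↔ w ∈ slab d := by simp [slab, ha1]
    by_cases hw : w ∈ slab d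
    · rw [Set.indicator_of_mem hw, Set.indicator_of_mem (this.2 hw)]
    · rw [Set.indicator_of_notMem hw, Set.indicator_of_notMem (fun h => hw (this.1 h))]
  simp only [diffQuot, ← ha]
  rw [integral_const_mul, integral_sub i2 i1, e, sub_self, mul_zero]

theorem setIntegral_slab_eq_zero_of_tendsto {w : ℕ → Cyl d → ℝ} {w₀ : Cyl d → ℝ}
    (hw : ∀ n, MemLp (w n) 2) (hw₀ : MemLp w₀ 2)
    (hlim : Tendsto (fun n => ∫ p, (w n p - w₀ p) ^ 2) atTop (𝓝 0))
    (h0 : ∀ n, ∫ p in slab d, w n p = 0) : ∫ p in slab d, w₀ p = 0 := by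
  have hprob : IsFiniteMeasure ((volume : Measure (Cyl d)).restrict (slab d)) :=
    ⟨by rw [Measure.restrict_apply_univ, volume_slab]; exact ENNReal.one_lt_top⟩
  have hD : ∀ n, MemLp (fun p => w n p - w₀ p) 2 := fun n => (hw n).sub hw₀
  have h1 : ∀ n, |∫ p in slab d, w₀ p| ≤ √(∫ p, (w n p - w₀ p) ^ 2) := by
    intro n
    have i1 : IntegrableOn (w n) (slab d) := ((hw n).restrict _).integrable one_le_two
    have i2 : IntegrableOn w₀ (slab d) := (hw₀.restrict _).integrable one_le_two
    have h2 := abs_integral_mul_le (memLp_const (1 : ℝ)) ((hD n).restrict (slab d))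
    have h3 : ∫ p in slab d, (1 : ℝ) * (w n p - w₀ p) = -∫ p in slab d, w₀ p := by
      simp only [one_mul]
      rw [integral_sub i1 i2, h0, zero_sub]
    have h4 : ∫ _ in slab d, (1 : ℝ) ^ 2 = 1 := by
      simp [Measure.real, volume_slab]
    rw [h3, abs_neg, h4, Real.sqrt_one, one_mul] at h2
    exact h2.trans (Real.sqrt_le_sqrt (setIntegral_le_integral (hD n).integrable_sq
      (ae_of_all _ fun p => sq_nonneg _)))
  have h2 : Tendsto (fun n => √(∫ p, (w n p - w₀ p) ^ 2)) atTop (𝓝 0) := by simpa using hlim.sqrt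
  exact abs_eq_zero.1 (le_antisymm (ge_of_tendsto' h2 h1) (abs_nonneg _))

/-- Layer solutions are invariant under translations of the torus, up to null sets. -/
theorem ae_translate_eq (hd : 1 ≤ d) (hH : KernelAssumptions d H) (hγ : ContDiff ℝ ∞ γ)
    (hη : IsProfile η) (hf : IsSpectral (fun w : Cyl d => u w - η w.1) m)
    (hu : IsLayerSolution H γ u) (b : Fin (d - 1) → ℝ) :
    ∀ᵐ w, u (w + proj ((0, b) : Cover d)) = u w := by
  obtain ⟨w₀, hw₀, hlim⟩ := hf.exists_diffQuot_limit hd (0, b)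
  have hw := fun n => hf.memLp_diffQuot (0, b) n
  have hsymm : ∀ n, diffQuot ((0, b) : Cover d) n (fun w => u w - η w.1) = diffQuot (0, b) n u :=
    fun n => funext (diffQuot_transversal b n)
  simp only [hsymm] at hlim hw
  obtain ⟨c, hc⟩ := ae_eq_const_mul_deriv hd hH hγ hη hf hu (0, b) hw₀ hlim
  have h0 := setIntegral_slab_eq_zero_of_tendsto hw hw₀ hlim
    (setIntegral_slab_diffQuot (aestronglyMeasurable_of_isSpectral hη hf) hu.abs_le_one b)
  have hprob : IsFiniteMeasure ((volume : Measure (Cyl d)).restrict (slab d)) :=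
    ⟨by rw [Measure.restrict_apply_univ, volume_slab]; exact ENNReal.one_lt_top⟩
  -- The function `c * w₀ = c² ∂u/∂x` is nonnegative with zero integral over the slab, yet positive
  -- there if `c ≠ 0`.
  have hc0 : c = 0 := by
    by_contra hne
    have i : IntegrableOn (fun w => c * w₀ w) (slab d) :=
      ((hw₀.restrict _).integrable one_le_two).const_mul c
    have hnn : 0 ≤ᵐ[volume.restrict (slab d)] fun w => c * w₀ w := by
      filter_upwards [ae_restrict_of_ae hc] with w hw
      rw [Pi.zero_apply, hw, ← mul_assoc]
      exact mul_nonneg (mul_self_nonneg c) (hu.deriv_pos _ _).le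
    have h1 : ∫ w in slab d, c * w₀ w = 0 := by rw [integral_const_mul, h0, mul_zero]
    have h2 := (integral_eq_zero_iff_of_nonneg_ae hnn i).1 h1
    have h3 : ∀ᵐ _ ∂(volume : Measure (Cyl d)).restrict (slab d), False := by
      filter_upwards [h2, ae_restrict_of_ae hc] with w h4 h5
      rw [Pi.zero_apply, h5, ← mul_assoc] at h4
      exact (mul_pos (mul_self_pos.2 hne) (hu.deriv_pos w.1 w.2)).ne' h4
    rw [ae_iff] at h3
    simp [volume_slab] at h3
  have hw0 : ∀ᵐ w, w₀ w = 0 := hc.mono fun w hw => by rw [hw, hc0, zero_mul]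
  have hlim' : Tendsto (fun n => ∫ w, diffQuot ((0, b) : Cover d) n u w ^ 2) atTop (𝓝 0) := by
    refine hlim.congr fun n => integral_congr_ae (hw0.mono fun w hw => ?_)
    simp only
    rw [hw, sub_zero]
  set f : Cyl d → ℝ := fun w => u w - η w.1 with hfdef
  -- Translation by `b` consists of `n + 1` steps of length `1/(n+1)`. The factor `(n + 1)²` from
  -- iterating is exactly the normalization of the squared quotient, which tends to zero.
  have hbound : ∀ n : ℕ, ∫ w, (f (w + proj ((0, b) : Cover d)) - f w) ^ 2 ≤
      ∫ w, diffQuot ((0, b) : Cover d) n u w ^ 2 := by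
    intro n
    have h1 := integral_translate_nsmul_sq_le hf.memLp
      (proj ((1 / ((n : ℝ) + 1)) • ((0, b) : Cover d))) (n + 1)
    have h2 : (n + 1) • proj ((1 / ((n : ℝ) + 1)) • ((0, b) : Cover d)) = proj (0, b) := by
      have hn : (n : ℝ) + 1 ≠ 0 := by positivity
      refine Prod.ext (by simp [proj]) (funext fun i => ?_)
      simp only [proj, Prod.smul_snd, Pi.smul_apply, smul_eq_mul]
      rw [← AddCircle.coe_nsmul]
      congr 1
      rw [nsmul_eq_mul]
      push_cast
      field_simp
    rw [h2, ← integral_const_mul] at h1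
    refine h1.trans (le_of_eq ?_)
    rw [← hsymm n]
    congr 1; ext w
    rw [diffQuot, mul_pow]
    push_cast
    rfl
  have h1 : ∫ w, (f (w + proj ((0, b) : Cover d)) - f w) ^ 2 = 0 :=
    le_antisymm (ge_of_tendsto' hlim' hbound) (integral_nonneg fun w => sq_nonneg _)
  have h2 : MemLp (fun w => f (w + proj ((0, b) : Cover d)) - f w) 2 :=
    (hf.memLp_translate _).sub hf.memLp
  rw [integral_eq_zero_iff_of_nonneg (fun w => sq_nonneg _) h2.integrable_sq] at h1
  filter_upwards [h1] with w hw
  have h3 : f (w + proj (0, b)) - f w = 0 := pow_eq_zero_iff two_ne_zero |>.1 hw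
  have h4 : (w + proj ((0, b) : Cover d)).1 = w.1 := by simp [proj]
  simp only [hfdef, h4] at h3
  linarith

/-- Fubini turns "for every translation, almost every point" into "for almost every point, almost
every translation"; averaging over translations then gives the fibre mean. A strongly measurable `g`
makes the set of coincidences measurable. -/
theorem ae_eq_integral_of_translate_eq {g : Cyl d → ℝ} (hg : StronglyMeasurable g)
    (h : ∀ b : Fin (d - 1) → ℝ, ∀ᵐ w, g (w + proj ((0, b) : Cover d)) = g w) :
    ∀ᵐ w : Cyl d, g w = ∫ y, g (w.1, y) := by
  have h1 : ∀ y : Fin (d - 1) → UnitAddCircle, ∀ᵐ w : Cyl d, g (w + (0, y)) = g w := by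
    intro y
    have := h (rep ((0, y) : Cyl d)).2
    have e : proj ((0, (rep ((0, y) : Cyl d)).2) : Cover d) = (0, y) := proj_rep ((0, y) : Cyl d)
    rwa [e] at this
  have hm : MeasurableSet {p : Cyl d × (Fin (d - 1) → UnitAddCircle) |
      g (p.1 + (0, p.2)) = g p.1} :=
    measurableSet_eq_fun (hg.measurable.comp (measurable_fst.add
      (measurable_const.prodMk measurable_snd))) (hg.measurable.comp measurable_fst)
  have h2 : ∀ᵐ w : Cyl d, ∀ᵐ y : Fin (d - 1) → UnitAddCircle, g (w + (0, y)) = g w :=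
    (Measure.ae_ae_comm hm).2 (ae_of_all _ h1)
  filter_upwards [h2] with w hw
  have h3 : ∫ y, g (w.1, w.2 + y) = ∫ y, g (w.1, y) :=
    integral_add_left_eq_self (fun y => g (w.1, y)) w.2
  have h4 : ∫ y, g (w.1, w.2 + y) = ∫ _y : Fin (d - 1) → UnitAddCircle, g w := by
    refine integral_congr_ae (hw.mono fun y hy => ?_)
    rw [← hy]
    simp only
    congr 1
    exact Prod.ext (by simp) rfl
  rw [← h3, h4, integral_const, probReal_univ, one_smul]

/-- Outside a null set of `y`, a layer solution is the same function of `x`. -/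
theorem exists_profile (hum : AEStronglyMeasurable u) (hu : IsLayerSolution H γ u)
    (h : ∀ b : Fin (d - 1) → ℝ, ∀ᵐ w, u (w + proj ((0, b) : Cover d)) = u w) :
    ∃ y₀ : Fin (d - 1) → UnitAddCircle,
      ∀ᵐ y : Fin (d - 1) → UnitAddCircle, ∀ x, u (x, y) = u (x, y₀) := by
  set g := hum.mk u with hg
  have hgu : ∀ᵐ w, u w = g w := hum.ae_eq_mk
  have h1 := ae_eq_integral_of_translate_eq hum.stronglyMeasurable_mk (fun b => by
    have hq := (measurePreserving_add_right (volume : Measure (Cyl d))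
      (proj ((0, b) : Cover d))).quasiMeasurePreserving
    filter_upwards [hgu, hq.ae hgu, h b] with w h1 h2 h3
    rw [← hg, ← h1, ← h2, h3])
  have h2 : ∀ᵐ w : Cyl d, u w = ∫ y, g (w.1, y) := by
    filter_upwards [hgu, h1] with w h3 h4
    rw [h3]; exact h4
  have h3 : ∀ᵐ p ∂((volume : Measure (Fin (d - 1) → UnitAddCircle)).prod (volume : Measure ℝ)),
      u p.swap = ∫ y, g (p.swap.1, y) :=
    Measure.measurePreserving_swap.quasiMeasurePreserving.ae h2
  have h4 := Measure.ae_ae_of_ae_prod h3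
  obtain ⟨y₀, hy₀⟩ := h4.exists
  refine ⟨y₀, h4.mono fun y hy => ?_⟩
  -- Two slices that agree for almost every `x` agree for every `x`, being continuous in `x`.
  have h5 : (fun x => u (x, y)) =ᵐ[volume] fun x => u (x, y₀) := by
    filter_upwards [hy, hy₀] with x h6 h7
    exact h6.trans h7.symm
  exact congrFun (((hu.continuous_fst y).ae_eq_iff_eq volume (hu.continuous_fst y₀)).1 h5)

/-- If the equation holds everywhere, the symmetry holds everywhere. -/
theorem eq_of_solvesAt (hd : 1 ≤ d) (hH : KernelAssumptions d H) {φ : ℝ → ℝ} (hφ : Continuous φ)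
    (hφ1 : ∀ x, |φ x| ≤ 1)
    (hae : ∀ᵐ y : Fin (d - 1) → UnitAddCircle, ∀ x, u (x, y) = φ x)
    (hsol : ∀ w, SolvesAt H γ u w) (x : ℝ) (y : Fin (d - 1) → UnitAddCircle) :
    u (x, y) = φ x := by
  obtain ⟨y₁, hy₁⟩ := hae.exists
  -- Since `u = φ` almost everywhere, the truncated integral at `(x, y)` depends on `y` only through
  -- the value `u (x, y)`.
  have key : ∀ y, ∃ l, Tendsto (fun n => ∫ z, (u (x, y) - φ (x - z.1)) ∂jumpSeq H n)
      atTop (𝓝 l) := by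
    intro y
    obtain ⟨l, hl, -⟩ := hsol (x, y)
    refine ⟨l, (hl.tendsto hd hH).congr fun n => integral_congr_ae ?_⟩
    have h1 : ∀ᵐ z : Cyl d, ∀ x, u (x, z.2) = φ x := Measure.quasiMeasurePreserving_snd.ae hae
    have h2 := (Measure.measurePreserving_sub_left (volume : Measure (Cyl d))
      (x, y)).quasiMeasurePreserving.ae h1
    refine (jumpTrunc_absolutelyContinuous hH _).ae_le (h2.mono fun z hz => ?_)
    simp only
    rw [← hz]; rfl
  obtain ⟨l, hl⟩ := key y
  obtain ⟨l', hl'⟩ := key y₁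
  have h1 := hl.sub hl'
  -- Comparison with the good point `(x, y₁)`: the difference of the truncated integrals is the
  -- error in the value times the total jump mass. It converges, while the mass tends to infinity,
  -- so the error is zero.
  have h2 : ∀ n, (∫ z, (u (x, y) - φ (x - z.1)) ∂jumpSeq H n) -
      ∫ z, (u (x, y₁) - φ (x - z.1)) ∂jumpSeq H n =
      (u (x, y) - φ x) * (jumpSeq H n).real Set.univ := by
    intro n
    have := isFiniteMeasure_jumpSeq hd hH n
    have i : Integrable (fun z : Cyl d => φ (x - z.1)) (jumpSeq H n) :=
      Integrable.of_bound (hφ.comp (continuous_const.sub continuous_fst)).aestronglyMeasurable 1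
        (ae_of_all _ fun z => hφ1 _)
    rw [integral_sub (integrable_const _) i, integral_sub (integrable_const _) i, hy₁,
      integral_const, integral_const, smul_eq_mul, smul_eq_mul]
    ring
  simp only [h2] at h1
  by_contra hne
  have h3 : Tendsto (fun n => (jumpSeq H n).real Set.univ) atTop
      (𝓝 ((u (x, y) - φ x)⁻¹ * (l - l'))) := by
    refine (h1.const_mul (u (x, y) - φ x)⁻¹).congr fun n => ?_
    rw [inv_mul_cancel_left₀ (sub_ne_zero.2 hne)]
  have h4 := (ENNReal.continuous_ofReal.tendsto _).comp h3
  have h5 : Tendsto (fun n => jumpSeq H n Set.univ) atTop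
      (𝓝 (ENNReal.ofReal ((u (x, y) - φ x)⁻¹ * (l - l')))) := by
    refine h4.congr fun n => ?_
    have := isFiniteMeasure_jumpSeq hd hH n
    exact ofReal_measureReal
  exact ENNReal.ofReal_ne_top (tendsto_nhds_unique h5 (tendsto_jumpTrunc_univ hd hH))

end Symmetry

end DeGiorgi

end

/-! ### Conclusion: symmetry almost everywhere and at every point. -/

theorem mainTheorem2 (d : ℕ) (hd : 1 ≤ d)
    (H : DeGiorgi.Cover d → ℝ) (hH : DeGiorgi.KernelAssumptions d H)
    (γ : ℝ → ℝ) (hγ : DeGiorgi.IsDoubleWell γ)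
    (η : ℝ → ℝ) (hη : DeGiorgi.IsProfile η)
    (u : DeGiorgi.Cyl d → ℝ) (hu : DeGiorgi.MemH 1 (fun w : DeGiorgi.Cyl d => u w - η w.1))
    (hsol : DeGiorgi.IsLayerSolution H γ u) :
    ∃ φ : ℝ → ℝ,
      (∀ᵐ w : DeGiorgi.Cyl d, u w = φ w.1) ∧
      ((Continuous u ∨ ∀ w, DeGiorgi.SolvesAt H γ u w) → ∀ x y, u (x, y) = φ x) := by
  obtain ⟨m, hf⟩ := hu.exists_isSpectral
  obtain ⟨y₀, hae⟩ := DeGiorgi.exists_profile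
    (DeGiorgi.aestronglyMeasurable_of_isSpectral hη hf) hsol
    (DeGiorgi.ae_translate_eq hd hH hγ.smooth hη hf hsol)
  refine ⟨fun x => u (x, y₀), ?_, ?_⟩
  · have h : ∀ᵐ w : DeGiorgi.Cyl d, ∀ x, u (x, w.2) = u (x, y₀) :=
      Measure.quasiMeasurePreserving_snd.ae hae
    exact h.mono fun w hw => hw w.1
  · rintro (hc | hs) x y
    -- The good `y` have full measure, hence are dense; for continuous `u` they also form a closed
    -- set.
    · have hdense := Measure.dense_of_ae hae
      have hcl : IsClosed {y : Fin (d - 1) → UnitAddCircle | ∀ x, u (x, y) = u (x, y₀)} := by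
        simp only [Set.ofPred_forall]
        exact isClosed_iInter fun x => isClosed_eq
          (hc.comp (continuous_const.prodMk continuous_id)) continuous_const
      have huniv := hcl.closure_eq ▸ hdense.closure_eq
      have hy : y ∈ {y : Fin (d - 1) → UnitAddCircle | ∀ x, u (x, y) = u (x, y₀)} := by
        rw [huniv]; trivial
      exact hy x
    · exact DeGiorgi.eq_of_solvesAt hd hH (hsol.continuous_fst y₀)
        (fun x => hsol.abs_le_one (x, y₀)) hae hs x y
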